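/- Let $\mathcal C$ be a Gray category (the form in which we treat a tricategory): composition of 1-cells is strictly associative and unital, the homs are strict 2-categories of 1-cells, 2-cells ($\Rightarrow$) and 3-cells ($\to$), composition with a 1-cell on either side is a strict 2-functor, and horizontally composable 2-cells interchange up to coherent invertible 3-cells, written $\cong$. Juxtaposition denotes composition of 1-cells, whiskering of 2-cells by 1-cells, and composition of 2-cells; the cell on the right is applied first. A 3-cell between composites is labelled only by the 3-cell of which it is a whiskering. A *monad* $(X,B)$ in $\mathcal C$ is taken in the skew sense: a *skew monad* on an endomorphism $B:X\to X$ consists of 2-cells $p:BB\Rightarrow B$, $e:1_X\Rightarrow B$ and (not necessarily invertible) 3-cells $\alpha:p(pB)\to p(Bp)$, $\lambda:p(eB)\to 1_B$, $\rho:1_B\to p(Be)$ such that 1. $p(pB)(pBB)\xrightarrow{\alpha}p(pB)(BpB)\xrightarrow{\alpha}p(Bp)(BpB)\xrightarrow{\alpha}p(Bp)(BBp)$ equals $p(pB)(pBB)\xrightarrow{\alpha}p(Bp)(pBB)\cong p(pB)(BBp)\xrightarrow{\alpha}p(Bp)(BBp)$; 2. $p\xrightarrow{\rho}p(pB)(BeB)\xrightarrow{\alpha}p(Bp)(BeB)\xrightarrow{\lambda}p$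 is the identity; 3. $p(pB)(eBB)\xrightarrow{\alpha}p(Bp)(eBB)\cong p(eB)p\xrightarrow{\lambda}p$ equals $p(pB)(eBB)\xrightarrow{\lambda}p$; 4. $p\xrightarrow{\rho}p(Be)p\cong p(pB)(BBe)\xrightarrow{\alpha}p(Bp)(BBe)$ equals $p\xrightarrow{\rho}p(Bp)(BBe)$; 5. $e\xrightarrow{\rho}p(Be)e\cong p(eB)e\xrightarrow{\lambda}e$ is the identity. A *skew warping* from $(X,B)$ to an endomorphism $A:X\to X$ consists of 2-cells $t:ABA\Rightarrow AB$, $k:1_X\Rightarrow AB$ and 3-cells $\nu:t(ApA)(tBA)\to(Ap)(tB)(ABt)$, $\nu_0:t(kA)\to Ae$, $\kappa:1_{AB}\to(Ap)(tB)(ABk)$ such that 1. $t(ApA)(tBA)(ApABA)(tBABA)\xrightarrow{\nu}t(ApA)(ApBA)(tBBA)(ABtBA)\xrightarrow{\alpha}t(ApA)(ABpA)(tBBA)(ABtBA)\cong t(ApA)(tBA)(ABApA)(ABtBA)\xrightarrow{\nu}(Ap)(tB)(ABt)(ABApA)(ABtBA)\xrightarrow{\nu}(Ap)(tB)(ABAp)(ABtB)(ABABt)\cong(Ap)(ABp)(tBB)(ABtB)(ABABt)$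 equals $t(ApA)(tBA)(ApABA)(tBABA)\xrightarrow{\nu}(Ap)(tB)(ABt)(ApABA)(tBABA)\cong(Ap)(tB)(ApAB)(tBAB)(ABABt)\xrightarrow{\nu}(Ap)(ApB)(tBB)(ABtB)(ABABt)\xrightarrow{\alpha}(Ap)(ABp)(tBB)(ABtB)(ABABt)$; 2. $t\xrightarrow{\kappa}t(ApA)(tBA)(ABkA)\xrightarrow{\nu}(Ap)(tB)(ABt)(ABkA)\xrightarrow{\nu_0}(Ap)(tB)(ABAe)\cong(Ap)(ABe)t$ equals $t\xrightarrow{\rho}(Ap)(ABe)t$; 3. $t(ApA)(tBA)(kABA)\xrightarrow{\nu}(Ap)(tB)(ABt)(kABA)\cong(Ap)(tB)(kAB)t\xrightarrow{\nu_0}(Ap)(AeB)t\xrightarrow{\lambda}t$ equals $t(ApA)(tBA)(kABA)\xrightarrow{\nu_0}t(ApA)(AeBA)\xrightarrow{\lambda}t$; 4. $(Ap)(tB)\xrightarrow{\kappa}(Ap)(tB)(ABk)(Ap)(tB)\cong(Ap)(tB)(ApAB)(tBAB)(ABABk)\xrightarrow{\nu}(Ap)(ApB)(tBB)(ABtB)(ABABk)\xrightarrow{\alpha}(Ap)(ABp)(tBB)(ABtB)(ABABk)\cong(Ap)(tB)(ABAp)(ABtB)(ABABk)$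 equals $(Ap)(tB)\xrightarrow{\kappa}(Ap)(tB)(ABAp)(ABtB)(ABABk)$ (whiskering $\kappa$ by $AB$ on the left); 5. $k\xrightarrow{\kappa}(Ap)(tB)(ABk)k\cong(Ap)(tB)(kAB)k\xrightarrow{\nu_0}(Ap)(AeB)k\xrightarrow{\lambda}k$ is the identity. **Theorem.** Let $(t,k,\nu,\nu_0,\kappa)$ be a skew warping from a (skew) monad $(X,B)$ to an endomorphism $A$ of $X$. Then the following data form a skew monad on $AB$ (that is, they satisfy the five skew monad axioms): unit $k:1_X\Rightarrow AB$; multiplication $(Ap)(tB):ABAB\Rightarrow AB$; associator $$(Ap)(tB)(ApAB)(tBAB)\xrightarrow{\nu}(Ap)(ApB)(tBB)(ABtB)\xrightarrow{\alpha}(Ap)(ABp)(tBB)(ABtB)\cong(Ap)(tB)(ABAp)(ABtB);$$ left unitor $(Ap)(tB)(kAB)\xrightarrow{\nu_0}(Ap)(AeB)\xrightarrow{\lambda}1_{AB}$; and right unitor $\kappa:1_{AB}\to(Ap)(tB)(ABk)$. -/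

import Mathlib

open CategoryTheory Bicategory

universe z w v u

/-- Composition of 1-cells in the order `B A = B after A`. -/
notation:80 g:81 " ⊙ " f:80 => @CategoryStruct.comp _ _ _ _ _ f g

/-- A Gray category, in elementary form.  Objects and 1-cells form a category; for objects `X`, `Y`
the 1-cells `X ⟶ Y`, with the 2-cells and 3-cells between them, form a strict 2-category; every
1-cell acts by composition on either side as a strict 2-functor between the hom 2-categories,
strictly associatively and unitally; and horizontally composable 2-cells interchange up to a
coherent invertible 3-cell (so that composition is a cubical functor of two variables).
Equations between cells whose boundaries are equal but not syntactically so are stated with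
heterogeneous equality. -/
class GrayCategory (C : Type u) extends Category.{v} C where
  /-- The hom 2-categories: objects are 1-cells, morphisms are 2-cells, 2-morphisms are 3-cells. -/
  [homBicategory : ∀ X Y : C, Bicategory.{z, w} (X ⟶ Y)]
  [homStrict : ∀ X Y : C, Bicategory.Strict (X ⟶ Y)]
  /-- `g θ`: the 1-cell `g` composed after the 2-cell `θ`. -/
  post₂ {X Y Z : C} (g : Y ⟶ Z) {f f' : X ⟶ Y} (θ : f ⟶ f') : g ⊙ f ⟶ g ⊙ f'
  /-- `g Γ`: the 1-cell `g` composed after the 3-cell `Γ`. -/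
  post₃ {X Y Z : C} (g : Y ⟶ Z) {f f' : X ⟶ Y} {θ θ' : f ⟶ f'} (Γ : θ ⟶ θ') :
    post₂ g θ ⟶ post₂ g θ'
  /-- `φ f`: the 2-cell `φ` composed after the 1-cell `f`. -/
  pre₂ {X Y Z : C} {g g' : Y ⟶ Z} (φ : g ⟶ g') (f : X ⟶ Y) : g ⊙ f ⟶ g' ⊙ f
  /-- `Ξ f`: the 3-cell `Ξ` composed after the 1-cell `f`. -/
  pre₃ {X Y Z : C} {g g' : Y ⟶ Z} {φ φ' : g ⟶ g'} (Ξ : φ ⟶ φ') (f : X ⟶ Y) :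
    pre₂ φ f ⟶ pre₂ φ' f
  /-- The interchange 3-cell `(g' θ)(φ f) ≅ (φ f')(g θ)`. -/
  interchange {X Y Z : C} {g g' : Y ⟶ Z} {f f' : X ⟶ Y} (φ : g ⟶ g') (θ : f ⟶ f') :
    pre₂ φ f ≫ post₂ g' θ ≅ post₂ g θ ≫ pre₂ φ f'
  -- `g (-)` is a strict 2-functor
  post₂_id {X Y Z : C} (g : Y ⟶ Z) (f : X ⟶ Y) : post₂ g (𝟙 f) = 𝟙 (g ⊙ f)
  post₂_comp {X Y Z : C} (g : Y ⟶ Z) {f f' f'' : X ⟶ Y} (θ : f ⟶ f') (θ' : f' ⟶ f'') :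
    post₂ g (θ ≫ θ') = post₂ g θ ≫ post₂ g θ'
  post₃_id {X Y Z : C} (g : Y ⟶ Z) {f f' : X ⟶ Y} (θ : f ⟶ f') :
    post₃ g (𝟙 θ) = 𝟙 (post₂ g θ)
  post₃_comp {X Y Z : C} (g : Y ⟶ Z) {f f' : X ⟶ Y} {θ θ' θ'' : f ⟶ f'}
    (Γ : θ ⟶ θ') (Γ' : θ' ⟶ θ'') : post₃ g (Γ ≫ Γ') = post₃ g Γ ≫ post₃ g Γ'
  post₃_whiskerLeft {X Y Z : C} (g : Y ⟶ Z) {f f' f'' : X ⟶ Y} (θ : f ⟶ f')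
    {η η' : f' ⟶ f''} (Γ : η ⟶ η') : HEq (post₃ g (θ ◁ Γ)) (post₂ g θ ◁ post₃ g Γ)
  post₃_whiskerRight {X Y Z : C} (g : Y ⟶ Z) {f f' f'' : X ⟶ Y} {θ θ' : f ⟶ f'}
    (Γ : θ ⟶ θ') (η : f' ⟶ f'') : HEq (post₃ g (Γ ▷ η)) (post₃ g Γ ▷ post₂ g η)
  -- `(-) f` is a strict 2-functor
  pre₂_id {X Y Z : C} (g : Y ⟶ Z) (f : X ⟶ Y) : pre₂ (𝟙 g) f = 𝟙 (g ⊙ f)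
  pre₂_comp {X Y Z : C} {g g' g'' : Y ⟶ Z} (φ : g ⟶ g') (φ' : g' ⟶ g'') (f : X ⟶ Y) :
    pre₂ (φ ≫ φ') f = pre₂ φ f ≫ pre₂ φ' f
  pre₃_id {X Y Z : C} {g g' : Y ⟶ Z} (φ : g ⟶ g') (f : X ⟶ Y) :
    pre₃ (𝟙 φ) f = 𝟙 (pre₂ φ f)
  pre₃_comp {X Y Z : C} {g g' : Y ⟶ Z} {φ φ' φ'' : g ⟶ g'}
    (Ξ : φ ⟶ φ') (Ξ' : φ' ⟶ φ'') (f : X ⟶ Y) : pre₃ (Ξ ≫ Ξ') f = pre₃ Ξ f ≫ pre₃ Ξ' f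
  pre₃_whiskerLeft {X Y Z : C} {g g' g'' : Y ⟶ Z} (φ : g ⟶ g') {ψ ψ' : g' ⟶ g''}
    (Ξ : ψ ⟶ ψ') (f : X ⟶ Y) : HEq (pre₃ (φ ◁ Ξ) f) (pre₂ φ f ◁ pre₃ Ξ f)
  pre₃_whiskerRight {X Y Z : C} {g g' g'' : Y ⟶ Z} {φ φ' : g ⟶ g'} (Ξ : φ ⟶ φ')
    (ψ : g' ⟶ g'') (f : X ⟶ Y) : HEq (pre₃ (Ξ ▷ ψ) f) (pre₃ Ξ f ▷ pre₂ ψ f)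
  -- composition with 1-cells is strictly unital and associative
  post₂_one {X Y : C} {f f' : X ⟶ Y} (θ : f ⟶ f') : HEq (post₂ (𝟙 Y) θ) θ
  post₃_one {X Y : C} {f f' : X ⟶ Y} {θ θ' : f ⟶ f'} (Γ : θ ⟶ θ') : HEq (post₃ (𝟙 Y) Γ) Γ
  pre₂_one {X Y : C} {f f' : X ⟶ Y} (θ : f ⟶ f') : HEq (pre₂ θ (𝟙 X)) θ
  pre₃_one {X Y : C} {f f' : X ⟶ Y} {θ θ' : f ⟶ f'} (Γ : θ ⟶ θ') : HEq (pre₃ Γ (𝟙 X)) Γ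
  post₂_mul {W X Y Z : C} (h : Y ⟶ Z) (g : X ⟶ Y) {f f' : W ⟶ X} (θ : f ⟶ f') :
    HEq (post₂ (h ⊙ g) θ) (post₂ h (post₂ g θ))
  post₃_mul {W X Y Z : C} (h : Y ⟶ Z) (g : X ⟶ Y) {f f' : W ⟶ X} {θ θ' : f ⟶ f'}
    (Γ : θ ⟶ θ') : HEq (post₃ (h ⊙ g) Γ) (post₃ h (post₃ g Γ))
  pre₂_mul {W X Y Z : C} {h h' : Y ⟶ Z} (φ : h ⟶ h') (g : X ⟶ Y) (f : W ⟶ X) :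
    HEq (pre₂ φ (g ⊙ f)) (pre₂ (pre₂ φ g) f)
  pre₃_mul {W X Y Z : C} {h h' : Y ⟶ Z} {φ φ' : h ⟶ h'} (Ξ : φ ⟶ φ') (g : X ⟶ Y)
    (f : W ⟶ X) : HEq (pre₃ Ξ (g ⊙ f)) (pre₃ (pre₃ Ξ g) f)
  post₂_pre₂ {W X Y Z : C} (h : Y ⟶ Z) {g g' : X ⟶ Y} (θ : g ⟶ g') (f : W ⟶ X) :
    HEq (post₂ h (pre₂ θ f)) (pre₂ (post₂ h θ) f)
  post₃_pre₃ {W X Y Z : C} (h : Y ⟶ Z) {g g' : X ⟶ Y} {θ θ' : g ⟶ g'} (Γ : θ ⟶ θ')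
    (f : W ⟶ X) : HEq (post₃ h (pre₃ Γ f)) (pre₃ (post₃ h Γ) f)
  -- the interchange is natural in 3-cells
  interchange_naturality_left {X Y Z : C} {g g' : Y ⟶ Z} {f f' : X ⟶ Y} {φ φ' : g ⟶ g'}
    (Ξ : φ ⟶ φ') (θ : f ⟶ f') :
    (interchange φ θ).hom ≫ post₂ g θ ◁ pre₃ Ξ f' =
      pre₃ Ξ f ▷ post₂ g' θ ≫ (interchange φ' θ).hom
  interchange_naturality_right {X Y Z : C} {g g' : Y ⟶ Z} {f f' : X ⟶ Y} (φ : g ⟶ g')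
    {θ θ' : f ⟶ f'} (Γ : θ ⟶ θ') :
    (interchange φ θ).hom ≫ post₃ g Γ ▷ pre₂ φ f' =
      pre₂ φ f ◁ post₃ g' Γ ≫ (interchange φ θ').hom
  -- the interchange respects identities and composites of 2-cells
  interchange_id_left {X Y Z : C} (g : Y ⟶ Z) {f f' : X ⟶ Y} (θ : f ⟶ f') :
    HEq (interchange (𝟙 g) θ).hom (𝟙 (post₂ g θ))
  interchange_id_right {X Y Z : C} {g g' : Y ⟶ Z} (φ : g ⟶ g') (f : X ⟶ Y) :
    HEq (interchange φ (𝟙 f)).hom (𝟙 (pre₂ φ f))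
  interchange_comp_left {X Y Z : C} {g g' g'' : Y ⟶ Z} {f f' : X ⟶ Y} (φ : g ⟶ g')
    (φ' : g' ⟶ g'') (θ : f ⟶ f') :
    HEq (interchange (φ ≫ φ') θ).hom
      ((α_ _ _ _).hom ≫ pre₂ φ f ◁ (interchange φ' θ).hom ≫ (α_ _ _ _).inv ≫
        (interchange φ θ).hom ▷ pre₂ φ' f' ≫ (α_ _ _ _).hom)
  interchange_comp_right {X Y Z : C} {g g' : Y ⟶ Z} {f f' f'' : X ⟶ Y} (φ : g ⟶ g')
    (θ : f ⟶ f') (θ' : f' ⟶ f'') :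
    HEq (interchange φ (θ ≫ θ')).hom
      ((α_ _ _ _).inv ≫ (interchange φ θ).hom ▷ post₂ g' θ' ≫ (α_ _ _ _).hom ≫
        post₂ g θ ◁ (interchange φ θ').hom ≫ (α_ _ _ _).inv)
  -- the interchange respects composition with 1-cells
  interchange_post {W X Y Z : C} (h : Y ⟶ Z) {g g' : X ⟶ Y} (φ : g ⟶ g') {f f' : W ⟶ X}
    (θ : f ⟶ f') : HEq (interchange (post₂ h φ) θ).hom (post₃ h (interchange φ θ).hom)
  interchange_mid {W X Y Z : C} {h h' : Y ⟶ Z} (φ : h ⟶ h') (g : X ⟶ Y) {f f' : W ⟶ X}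
    (θ : f ⟶ f') : HEq (interchange (pre₂ φ g) θ).hom (interchange φ (post₂ g θ)).hom
  interchange_pre {W X Y Z : C} {h h' : Y ⟶ Z} (φ : h ⟶ h') {g g' : X ⟶ Y} (θ : g ⟶ g')
    (f : W ⟶ X) : HEq (interchange φ (pre₂ θ f)).hom (pre₃ (interchange φ θ).hom f)

attribute [reducible, instance] GrayCategory.homBicategory
attribute [instance] GrayCategory.homStrict

namespace GrayCategory

variable {C : Type u} [GrayCategory.{z, w, v, u} C]

/-- `l θ r`, as a 2-cell between any 1-cells equal to the composites `l f r` and `l g r`. -/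
def wh {W X Y Z : C} (l : Y ⟶ Z) (r : W ⟶ X) {f g : X ⟶ Y} (θ : f ⟶ g) {s t : W ⟶ Z}
    (hs : s = l ⊙ f ⊙ r := by simp) (ht : t = l ⊙ g ⊙ r := by simp) : s ⟶ t :=
  eqToHom hs ≫ post₂ l (pre₂ θ r) ≫ eqToHom ht.symm

/-- `l Γ r` for a 3-cell `Γ`. -/
def wh₃ {W X Y Z : C} (l : Y ⟶ Z) (r : W ⟶ X) {f g : X ⟶ Y} {θ θ' : f ⟶ g} (Γ : θ ⟶ θ')
    {s t : W ⟶ Z} (hs : s = l ⊙ f ⊙ r := by simp) (ht : t = l ⊙ g ⊙ r := by simp) :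
    wh l r θ hs ht ⟶ wh l r θ' hs ht :=
  eqToHom hs ◁ (post₃ l (pre₃ Γ r) ▷ eqToHom ht.symm)

theorem post₂_eqToHom {X Y Z : C} (g : Y ⟶ Z) {f f' : X ⟶ Y} (h : f = f') :
    post₂ g (eqToHom h) = eqToHom (by rw [h]) := by
  subst h; simp [post₂_id]

theorem pre₂_eqToHom {X Y Z : C} {g g' : Y ⟶ Z} (h : g = g') (f : X ⟶ Y) :
    pre₂ (eqToHom h) f = eqToHom (by rw [h]) := by
  subst h; simp [pre₂_id]

theorem wh_heq {W X Y Z : C} (l : Y ⟶ Z) (r : W ⟶ X) {f g : X ⟶ Y} (θ : f ⟶ g) {s t : W ⟶ Z}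
    (hs : s = l ⊙ f ⊙ r) (ht : t = l ⊙ g ⊙ r) : HEq (wh l r θ hs ht) (post₂ l (pre₂ θ r)) := by
  subst hs ht; simp [wh]

theorem heq_post₂ {X Y Z : C} (l : Y ⟶ Z) {f f' g g' : X ⟶ Y} {θ : f ⟶ g} {θ' : f' ⟶ g'}
    (hf : f = f') (hg : g = g') (h : HEq θ θ') : HEq (post₂ l θ) (post₂ l θ') := by
  subst hf hg; cases h; rfl

theorem heq_pre₂ {X Y Z : C} (r : X ⟶ Y) {f f' g g' : Y ⟶ Z} {θ : f ⟶ g} {θ' : f' ⟶ g'}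
    (hf : f = f') (hg : g = g') (h : HEq θ θ') : HEq (pre₂ θ r) (pre₂ θ' r) := by
  subst hf hg; cases h; rfl

theorem post₂_eq_wh {X Y Z : C} (g : Y ⟶ Z) {f f' : X ⟶ Y} (θ : f ⟶ f') :
    post₂ g θ = wh g (𝟙 X) θ :=
  eq_of_heq ((heq_post₂ g (by simp) (by simp) (pre₂_one θ).symm).trans (wh_heq _ _ _ _ _).symm)

theorem pre₂_eq_wh {X Y Z : C} {g g' : Y ⟶ Z} (φ : g ⟶ g') (f : X ⟶ Y) :
    pre₂ φ f = wh (𝟙 Z) f φ :=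
  eq_of_heq ((post₂_one _).symm.trans (wh_heq _ _ _ _ _).symm)

theorem wh_one {X Y : C} {f g : X ⟶ Y} (θ : f ⟶ g) (hs : f = 𝟙 Y ⊙ f ⊙ 𝟙 X)
    (ht : g = 𝟙 Y ⊙ g ⊙ 𝟙 X) : wh (𝟙 Y) (𝟙 X) θ hs ht = θ :=
  eq_of_heq ((wh_heq _ _ _ _ _).trans ((post₂_one _).trans (pre₂_one _)))

theorem wh_id {W X Y Z : C} (l : Y ⟶ Z) (r : W ⟶ X) (f : X ⟶ Y) {s t : W ⟶ Z}
    (hs : s = l ⊙ f ⊙ r) (ht : t = l ⊙ f ⊙ r) :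
    wh l r (𝟙 f) hs ht = eqToHom (hs.trans ht.symm) := by
  subst hs ht; simp [wh, pre₂_id, post₂_id]

theorem wh_comp {W X Y Z : C} (l : Y ⟶ Z) (r : W ⟶ X) {f g h : X ⟶ Y} (θ : f ⟶ g) (φ : g ⟶ h)
    {s t : W ⟶ Z} (hs : s = l ⊙ f ⊙ r) (ht : t = l ⊙ h ⊙ r) :
    wh l r (θ ≫ φ) hs ht = wh l r θ hs rfl ≫ wh l r φ rfl ht := by
  simp [wh, pre₂_comp, post₂_comp]

theorem wh_wh {V W X Y Z A : C} (l' : Z ⟶ A) (r' : V ⟶ W) (l : Y ⟶ Z) (r : W ⟶ X) {f g : X ⟶ Y}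
    (θ : f ⟶ g) {s t : W ⟶ Z} (hs : s = l ⊙ f ⊙ r) (ht : t = l ⊙ g ⊙ r) {s' t' : V ⟶ A}
    (hs' : s' = l' ⊙ s ⊙ r') (ht' : t' = l' ⊙ t ⊙ r') :
    wh l' r' (wh l r θ hs ht) hs' ht' =
      wh (l' ⊙ l) (r ⊙ r') θ (by simp [hs', hs]) (by simp [ht', ht]) := by
  refine eq_of_heq ((wh_heq _ _ _ _ _).trans (HEq.trans ?_ (wh_heq _ _ _ _ _).symm))
  refine (heq_post₂ _ (by rw [hs]) (by rw [ht]) (heq_pre₂ _ hs ht (wh_heq _ _ _ _ _))).trans ?_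
  refine HEq.trans ?_ (post₂_mul _ _ _).symm
  refine heq_post₂ _ (by simp) (by simp) ?_
  refine (post₂_pre₂ _ _ _).symm.trans ?_
  exact heq_post₂ _ (by simp) (by simp) (pre₂_mul _ _ _).symm

theorem heq_comp {X Y : C} {s s₁ m m₁ t t₁ : X ⟶ Y} {a : s ⟶ m} {a₁ : s₁ ⟶ m₁} {b : m ⟶ t}
    {b₁ : m₁ ⟶ t₁} (hs : s = s₁) (hm : m = m₁) (ht : t = t₁) (ha : HEq a a₁) (hb : HEq b b₁) :
    HEq (a ≫ b) (a₁ ≫ b₁) := by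
  subst hs hm ht; cases ha; cases hb; rfl

theorem heq_eqToHom_left {X Y : C} {s m t s' t' : X ⟶ Y} {h : s = m} {b : m ⟶ t} {c : s' ⟶ t'}
    (H : HEq b c) : HEq (eqToHom h ≫ b) c := by
  subst h; simpa using H

theorem heq_eqToHom_right {X Y : C} {s m t s' t' : X ⟶ Y} {h : s = m} {b : m ⟶ t} {c : s' ⟶ t'}
    (H : HEq c b) : HEq c (eqToHom h ≫ b) := by
  subst h; simpa using H

theorem heq_eqToHom {X Y : C} {s t s' t' : X ⟶ Y} {h : s = t} {h' : s' = t'} (H : s = s') :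
    HEq (eqToHom h) (eqToHom h') := by
  subst h H h'; rfl

theorem heq_comp_eqToHom {X Y : C} {s m t s' t' : X ⟶ Y} {h : m = t} {b : s ⟶ m} {c : s' ⟶ t'}
    (H : HEq b c) : HEq (b ≫ eqToHom h) c := by
  subst h; simpa using H

theorem heq_comp_eqToHom' {X Y : C} {s m t s' t' : X ⟶ Y} {h : m = t} {b : s ⟶ m} {c : s' ⟶ t'}
    (H : HEq c b) : HEq c (b ≫ eqToHom h) := by
  subst h; simpa using H

theorem heq_wh {W X Y Z : C} {l l₁ : Y ⟶ Z} {r r₁ : W ⟶ X} {f g : X ⟶ Y}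
    {θ : f ⟶ g} {s t s₁ t₁ : W ⟶ Z} {hs : s = l ⊙ f ⊙ r} {ht : t = l ⊙ g ⊙ r}
    {hs₁ : s₁ = l₁ ⊙ f ⊙ r₁} {ht₁ : t₁ = l₁ ⊙ g ⊙ r₁} (hl : l = l₁) (hr : r = r₁) :
    HEq (wh l r θ hs ht) (wh l₁ r₁ θ hs₁ ht₁) := by
  subst hl hr hs ht hs₁ ht₁; rfl

theorem wh_one_heq {X Y : C} {f g s t : X ⟶ Y} {θ : f ⟶ g} {l : Y ⟶ Y} {r : X ⟶ X}
    {hs : s = l ⊙ f ⊙ r} {ht : t = l ⊙ g ⊙ r} (hl : l = 𝟙 Y) (hr : r = 𝟙 X) :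
    HEq (wh l r θ hs ht) θ := by
  subst hl hr
  exact (wh_heq _ _ _ _ _).trans ((post₂_one _).trans (pre₂_one _))

theorem heq_wh_one {X Y : C} {f g s t : X ⟶ Y} {θ : f ⟶ g} {l : Y ⟶ Y} {r : X ⟶ X}
    {hs : s = l ⊙ f ⊙ r} {ht : t = l ⊙ g ⊙ r} (hl : l = 𝟙 Y) (hr : r = 𝟙 X) :
    HEq θ (wh l r θ hs ht) := (wh_one_heq hl hr).symm

/-- The 3-cell `T (l Γ r) S`, between any 2-cells equal to its source and target. -/
def paste {W X Y Z : C} {a b c d : W ⟶ Z} (S : a ⟶ b) (l : Y ⟶ Z) (r : W ⟶ X) {f g : X ⟶ Y}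
    {θ θ' : f ⟶ g} (Γ : θ ⟶ θ') (T : c ⟶ d) {x y : a ⟶ d}
    (hb : b = l ⊙ f ⊙ r := by simp) (hc : c = l ⊙ g ⊙ r := by simp)
    (hx : x = S ≫ wh l r θ hb hc ≫ T := by
      apply eq_of_heq
      simp only [pre₂_eq_wh, post₂_eq_wh, wh_comp, wh_wh, wh_id, Category.assoc, Category.id_comp,
        Category.comp_id]
      repeat' with_reducible first
        | exact HEq.rfl
        | apply heq_wh_one
        | apply wh_one_heq
        | apply heq_eqToHom_left
        | apply heq_eqToHom_right
        | apply heq_comp_eqToHom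
        | apply heq_comp_eqToHom'
        | apply heq_eqToHom
        | apply heq_comp
        | apply heq_wh
        | simp)
    (hy : y = S ≫ wh l r θ' hb hc ≫ T := by
      apply eq_of_heq
      simp only [pre₂_eq_wh, post₂_eq_wh, wh_comp, wh_wh, wh_id, Category.assoc, Category.id_comp,
        Category.comp_id]
      repeat' with_reducible first
        | exact HEq.rfl
        | apply heq_wh_one
        | apply wh_one_heq
        | apply heq_eqToHom_left
        | apply heq_eqToHom_right
        | apply heq_comp_eqToHom
        | apply heq_comp_eqToHom'
        | apply heq_eqToHom
        | apply heq_comp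
        | apply heq_wh
        | simp) : x ⟶ y :=
  eqToHom hx ≫ S ◁ (wh₃ l r Γ hb hc ▷ T) ≫ eqToHom hy.symm

/-- The data of a skew monad on the endomorphism `B`: multiplication `p`, unit `e`, associator
`α : p(pB) → p(Bp)`, left unitor `lam : p(eB) → 1` and right unitor `rho : 1 → p(Be)`.
(The composite `θ ≫ φ` of 2-cells is `θ` followed by `φ`, that is `φθ`.) -/
structure SkewMonadData {X : C} (B : X ⟶ X) where
  p : B⊙B ⟶ B
  e : 𝟙 X ⟶ B
  α : (wh (𝟙 X) B p : B⊙B⊙B ⟶ B⊙B) ≫ p ⟶ (wh B (𝟙 X) p : B⊙B⊙B ⟶ B⊙B) ≫ p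
  lam : (wh (𝟙 X) B e : B ⟶ B⊙B) ≫ p ⟶ 𝟙 B
  rho : 𝟙 B ⟶ (wh B (𝟙 X) e : B ⟶ B⊙B) ≫ p

/-- A skew monad structure on the endomorphism `B`. -/
structure SkewMonad {X : C} (B : X ⟶ X) extends SkewMonadData B where
  /-- `p(pB)(pBB) → p(pB)(BpB) → p(Bp)(BpB) → p(Bp)(BBp)` equals
  `p(pB)(pBB) → p(Bp)(pBB) ≅ p(pB)(BBp) → p(Bp)(BBp)`. -/
  assoc_assoc :
    (paste (𝟙 _) (𝟙 X) B α p :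
        (wh (𝟙 X) (B⊙B) p : B⊙B⊙B⊙B ⟶ B⊙B⊙B) ≫ (wh (𝟙 X) B p : _ ⟶ B⊙B) ≫ p ⟶
          (wh B B p : B⊙B⊙B⊙B ⟶ B⊙B⊙B) ≫ (wh (𝟙 X) B p : _ ⟶ B⊙B) ≫ p) ≫
      (paste (wh B B p : _ ⟶ B⊙B⊙B) (𝟙 X) (𝟙 X) α (𝟙 _) :
        _ ⟶ (wh B B p : B⊙B⊙B⊙B ⟶ B⊙B⊙B) ≫ (wh B (𝟙 X) p : _ ⟶ B⊙B) ≫ p) ≫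
      (paste (𝟙 _) B (𝟙 X) α p :
        _ ⟶ (wh (B⊙B) (𝟙 X) p : B⊙B⊙B⊙B ⟶ B⊙B⊙B) ≫
          (wh B (𝟙 X) p : _ ⟶ B⊙B) ≫ p)
    = (paste (wh (𝟙 X) (B⊙B) p : _ ⟶ B⊙B⊙B) (𝟙 X) (𝟙 X) α (𝟙 _) :
        (wh (𝟙 X) (B⊙B) p : B⊙B⊙B⊙B ⟶ B⊙B⊙B) ≫ (wh (𝟙 X) B p : _ ⟶ B⊙B) ≫ p ⟶
          (wh (𝟙 X) (B⊙B) p : B⊙B⊙B⊙B ⟶ B⊙B⊙B) ≫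
            (wh B (𝟙 X) p : _ ⟶ B⊙B) ≫ p) ≫
      (paste (𝟙 _) (𝟙 X) (𝟙 X) (interchange p p).hom p :
        _ ⟶ (wh (B⊙B) (𝟙 X) p : B⊙B⊙B⊙B ⟶ B⊙B⊙B) ≫
          (wh (𝟙 X) B p : _ ⟶ B⊙B) ≫ p) ≫
      (paste (wh (B⊙B) (𝟙 X) p : _ ⟶ B⊙B⊙B) (𝟙 X) (𝟙 X) α (𝟙 _) :
        _ ⟶ (wh (B⊙B) (𝟙 X) p : B⊙B⊙B⊙B ⟶ B⊙B⊙B) ≫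
          (wh B (𝟙 X) p : _ ⟶ B⊙B) ≫ p)
  /-- `p → p(pB)(BeB) → p(Bp)(BeB) → p` is the identity. -/
  right_assoc_left :
    (paste (𝟙 _) (𝟙 X) B rho p :
        p ⟶ (wh B B e : B⊙B ⟶ B⊙B⊙B) ≫ (wh (𝟙 X) B p : _ ⟶ B⊙B) ≫ p) ≫
      (paste (wh B B e : _ ⟶ B⊙B⊙B) (𝟙 X) (𝟙 X) α (𝟙 _) :
        _ ⟶ (wh B B e : B⊙B ⟶ B⊙B⊙B) ≫ (wh B (𝟙 X) p : _ ⟶ B⊙B) ≫ p) ≫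
      (paste (𝟙 _) B (𝟙 X) lam p : _ ⟶ p)
    = 𝟙 p
  /-- `p(pB)(eBB) → p(Bp)(eBB) ≅ p(eB)p → p` equals `p(pB)(eBB) → p`. -/
  assoc_left :
    (paste (wh (𝟙 X) (B⊙B) e : _ ⟶ B⊙B⊙B) (𝟙 X) (𝟙 X) α (𝟙 _) :
        (wh (𝟙 X) (B⊙B) e : B⊙B ⟶ B⊙B⊙B) ≫ (wh (𝟙 X) B p : _ ⟶ B⊙B) ≫ p ⟶
          (wh (𝟙 X) (B⊙B) e : B⊙B ⟶ B⊙B⊙B) ≫ (wh B (𝟙 X) p : _ ⟶ B⊙B) ≫ p) ≫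
      (paste (𝟙 _) (𝟙 X) (𝟙 X) (interchange e p).hom p :
        _ ⟶ p ≫ (wh (𝟙 X) B e : _ ⟶ B⊙B) ≫ p) ≫
      (paste p (𝟙 X) (𝟙 X) lam (𝟙 _) : _ ⟶ p)
    = (paste (𝟙 _) (𝟙 X) B lam p :
        (wh (𝟙 X) (B⊙B) e : B⊙B ⟶ B⊙B⊙B) ≫ (wh (𝟙 X) B p : _ ⟶ B⊙B) ≫ p ⟶ p)
  /-- `p → p(Be)p ≅ p(pB)(BBe) → p(Bp)(BBe)` equals `p → p(Bp)(BBe)`. -/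
  right_assoc :
    (paste p (𝟙 X) (𝟙 X) rho (𝟙 _) : p ⟶ p ≫ (wh B (𝟙 X) e : _ ⟶ B⊙B) ≫ p) ≫
      (paste (𝟙 _) (𝟙 X) (𝟙 X) (interchange p e).hom p :
        _ ⟶ (wh (B⊙B) (𝟙 X) e : B⊙B ⟶ B⊙B⊙B) ≫ (wh (𝟙 X) B p : _ ⟶ B⊙B) ≫ p) ≫
      (paste (wh (B⊙B) (𝟙 X) e : _ ⟶ B⊙B⊙B) (𝟙 X) (𝟙 X) α (𝟙 _) :
        _ ⟶ (wh (B⊙B) (𝟙 X) e : B⊙B ⟶ B⊙B⊙B) ≫ (wh B (𝟙 X) p : _ ⟶ B⊙B) ≫ p)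
    = (paste (𝟙 _) B (𝟙 X) rho p :
        p ⟶ (wh (B⊙B) (𝟙 X) e : B⊙B ⟶ B⊙B⊙B) ≫ (wh B (𝟙 X) p : _ ⟶ B⊙B) ≫ p)
  /-- `e → p(Be)e ≅ p(eB)e → e` is the identity. -/
  right_left :
    (paste e (𝟙 X) (𝟙 X) rho (𝟙 _) : e ⟶ e ≫ (wh B (𝟙 X) e : _ ⟶ B⊙B) ≫ p) ≫
      (paste (𝟙 _) (𝟙 X) (𝟙 X) (interchange e e).hom p :
        _ ⟶ e ≫ (wh (𝟙 X) B e : _ ⟶ B⊙B) ≫ p) ≫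
      (paste e (𝟙 X) (𝟙 X) lam (𝟙 _) : _ ⟶ e)
    = 𝟙 e

/-- The data of a skew warping from the skew monad `M` on `B` to the endomorphism `A`:
`ν : t(ApA)(tBA) → (Ap)(tB)(ABt)`, `ν₀ : t(kA) → Ae` and `κ : 1 → (Ap)(tB)(ABk)`. -/
structure SkewWarpingData {X : C} {B : X ⟶ X} (M : SkewMonad B) (A : X ⟶ X) where
  t : A⊙B⊙A ⟶ A⊙B
  k : 𝟙 X ⟶ A⊙B
  ν : (wh (𝟙 X) (B⊙A) t : A⊙B⊙A⊙B⊙A ⟶ A⊙B⊙B⊙A) ≫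
        (wh A A M.p : _ ⟶ A⊙B⊙A) ≫ t ⟶
      (wh (A⊙B) (𝟙 X) t : A⊙B⊙A⊙B⊙A ⟶ A⊙B⊙A⊙B) ≫
        (wh (𝟙 X) B t : _ ⟶ A⊙B⊙B) ≫ (wh A (𝟙 X) M.p : _ ⟶ A⊙B)
  ν₀ : (wh (𝟙 X) A k : A ⟶ A⊙B⊙A) ≫ t ⟶ (wh A (𝟙 X) M.e : A ⟶ A⊙B)
  κ : 𝟙 (A⊙B) ⟶
      (wh (A⊙B) (𝟙 X) k : A⊙B ⟶ A⊙B⊙A⊙B) ≫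
        (wh (𝟙 X) B t : _ ⟶ A⊙B⊙B) ≫ (wh A (𝟙 X) M.p : _ ⟶ A⊙B)

namespace SkewWarpingData

variable {X : C} {B : X ⟶ X} {M : SkewMonad B} {A : X ⟶ X} (D : SkewWarpingData M A)

set_option maxHeartbeats 1000000 in
/-- The axiom: `t(ApA)(tBA)(ApABA)(tBABA) → t(ApA)(ApBA)(tBBA)(ABtBA) → t(ApA)(ABpA)(tBBA)(ABtBA)
≅ t(ApA)(tBA)(ABApA)(ABtBA) → (Ap)(tB)(ABt)(ABApA)(ABtBA) → (Ap)(tB)(ABAp)(ABtB)(ABABt)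
≅ (Ap)(ABp)(tBB)(ABtB)(ABABt)` equals
`t(ApA)(tBA)(ApABA)(tBABA) → (Ap)(tB)(ABt)(ApABA)(tBABA) ≅ (Ap)(tB)(ApAB)(tBAB)(ABABt)
→ (Ap)(ApB)(tBB)(ABtB)(ABABt) → (Ap)(ABp)(tBB)(ABtB)(ABABt)`. -/
def AssocAssoc : Prop :=
  (paste (𝟙 _) (𝟙 X) (B⊙A) D.ν ((wh A A M.p : A⊙B⊙B⊙A ⟶ A⊙B⊙A) ≫ D.t) :
      (wh (𝟙 X) (B⊙A⊙B⊙A) D.t :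
          A⊙B⊙A⊙B⊙A⊙B⊙A ⟶ A⊙B⊙B⊙A⊙B⊙A) ≫
        (wh A (A⊙B⊙A) M.p : _ ⟶ A⊙B⊙A⊙B⊙A) ≫
        (wh (𝟙 X) (B⊙A) D.t : _ ⟶ A⊙B⊙B⊙A) ≫
        (wh A A M.p : _ ⟶ A⊙B⊙A) ≫ D.t ⟶
      (wh (A⊙B) (B⊙A) D.t :
          A⊙B⊙A⊙B⊙A⊙B⊙A ⟶ A⊙B⊙A⊙B⊙B⊙A) ≫
        (wh (𝟙 X) (B⊙B⊙A) D.t : _ ⟶ A⊙B⊙B⊙B⊙A) ≫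
        (wh A (B⊙A) M.p : _ ⟶ A⊙B⊙B⊙A) ≫
        (wh A A M.p : _ ⟶ A⊙B⊙A) ≫ D.t) ≫
    (paste ((wh (A⊙B) (B⊙A) D.t : _ ⟶ A⊙B⊙A⊙B⊙B⊙A) ≫
          (wh (𝟙 X) (B⊙B⊙A) D.t : _ ⟶ A⊙B⊙B⊙B⊙A)) A A M.α D.t :
      _ ⟶ (wh (A⊙B) (B⊙A) D.t :
          A⊙B⊙A⊙B⊙A⊙B⊙A ⟶ A⊙B⊙A⊙B⊙B⊙A) ≫
        (wh (𝟙 X) (B⊙B⊙A) D.t : _ ⟶ A⊙B⊙B⊙B⊙A) ≫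
        (wh (A⊙B) A M.p : _ ⟶ A⊙B⊙B⊙A) ≫
        (wh A A M.p : _ ⟶ A⊙B⊙A) ≫ D.t) ≫
    (paste (wh (A⊙B) (B⊙A) D.t : _ ⟶ A⊙B⊙A⊙B⊙B⊙A) (𝟙 X) A
          (interchange D.t M.p).hom ((wh A A M.p : A⊙B⊙B⊙A ⟶ A⊙B⊙A) ≫ D.t) :
      _ ⟶ (wh (A⊙B) (B⊙A) D.t :
          A⊙B⊙A⊙B⊙A⊙B⊙A ⟶ A⊙B⊙A⊙B⊙B⊙A) ≫
        (wh (A⊙B⊙A) A M.p : _ ⟶ A⊙B⊙A⊙B⊙A) ≫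
        (wh (𝟙 X) (B⊙A) D.t : _ ⟶ A⊙B⊙B⊙A) ≫
        (wh A A M.p : _ ⟶ A⊙B⊙A) ≫ D.t) ≫
    (paste ((wh (A⊙B) (B⊙A) D.t : _ ⟶ A⊙B⊙A⊙B⊙B⊙A) ≫
          (wh (A⊙B⊙A) A M.p : _ ⟶ A⊙B⊙A⊙B⊙A)) (𝟙 X) (𝟙 X) D.ν (𝟙 _) :
      _ ⟶ (wh (A⊙B) (B⊙A) D.t :
          A⊙B⊙A⊙B⊙A⊙B⊙A ⟶ A⊙B⊙A⊙B⊙B⊙A) ≫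
        (wh (A⊙B⊙A) A M.p : _ ⟶ A⊙B⊙A⊙B⊙A) ≫
        (wh (A⊙B) (𝟙 X) D.t : _ ⟶ A⊙B⊙A⊙B) ≫
        (wh (𝟙 X) B D.t : _ ⟶ A⊙B⊙B) ≫ (wh A (𝟙 X) M.p : _ ⟶ A⊙B)) ≫
    (paste (𝟙 _) (A⊙B) (𝟙 X) D.ν
          ((wh (𝟙 X) B D.t : A⊙B⊙A⊙B ⟶ A⊙B⊙B) ≫ (wh A (𝟙 X) M.p : _ ⟶ A⊙B)) :
      _ ⟶ (wh (A⊙B⊙A⊙B) (𝟙 X) D.t :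
          A⊙B⊙A⊙B⊙A⊙B⊙A ⟶ A⊙B⊙A⊙B⊙A⊙B) ≫
        (wh (A⊙B) B D.t : _ ⟶ A⊙B⊙A⊙B⊙B) ≫
        (wh (A⊙B⊙A) (𝟙 X) M.p : _ ⟶ A⊙B⊙A⊙B) ≫
        (wh (𝟙 X) B D.t : _ ⟶ A⊙B⊙B) ≫ (wh A (𝟙 X) M.p : _ ⟶ A⊙B)) ≫
    (paste ((wh (A⊙B⊙A⊙B) (𝟙 X) D.t : _ ⟶ A⊙B⊙A⊙B⊙A⊙B) ≫
          (wh (A⊙B) B D.t : _ ⟶ A⊙B⊙A⊙B⊙B)) (𝟙 X) (𝟙 X)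
          (interchange D.t M.p).inv (wh A (𝟙 X) M.p : A⊙B⊙B ⟶ A⊙B) :
      _ ⟶ (wh (A⊙B⊙A⊙B) (𝟙 X) D.t :
          A⊙B⊙A⊙B⊙A⊙B⊙A ⟶ A⊙B⊙A⊙B⊙A⊙B) ≫
        (wh (A⊙B) B D.t : _ ⟶ A⊙B⊙A⊙B⊙B) ≫
        (wh (𝟙 X) (B⊙B) D.t : _ ⟶ A⊙B⊙B⊙B) ≫
        (wh (A⊙B) (𝟙 X) M.p : _ ⟶ A⊙B⊙B) ≫ (wh A (𝟙 X) M.p : _ ⟶ A⊙B))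
  = (paste ((wh (𝟙 X) (B⊙A⊙B⊙A) D.t : _ ⟶ A⊙B⊙B⊙A⊙B⊙A) ≫
          (wh A (A⊙B⊙A) M.p : _ ⟶ A⊙B⊙A⊙B⊙A)) (𝟙 X) (𝟙 X) D.ν (𝟙 _) :
      (wh (𝟙 X) (B⊙A⊙B⊙A) D.t :
          A⊙B⊙A⊙B⊙A⊙B⊙A ⟶ A⊙B⊙B⊙A⊙B⊙A) ≫
        (wh A (A⊙B⊙A) M.p : _ ⟶ A⊙B⊙A⊙B⊙A) ≫
        (wh (𝟙 X) (B⊙A) D.t : _ ⟶ A⊙B⊙B⊙A) ≫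
        (wh A A M.p : _ ⟶ A⊙B⊙A) ≫ D.t ⟶
      (wh (𝟙 X) (B⊙A⊙B⊙A) D.t :
          A⊙B⊙A⊙B⊙A⊙B⊙A ⟶ A⊙B⊙B⊙A⊙B⊙A) ≫
        (wh A (A⊙B⊙A) M.p : _ ⟶ A⊙B⊙A⊙B⊙A) ≫
        (wh (A⊙B) (𝟙 X) D.t : _ ⟶ A⊙B⊙A⊙B) ≫
        (wh (𝟙 X) B D.t : _ ⟶ A⊙B⊙B) ≫ (wh A (𝟙 X) M.p : _ ⟶ A⊙B)) ≫
    (paste (𝟙 _) (𝟙 X) (𝟙 X)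
          (interchange ((wh (𝟙 X) B D.t : A⊙B⊙A⊙B ⟶ A⊙B⊙B) ≫
            (wh A (𝟙 X) M.p : _ ⟶ A⊙B)) D.t).hom
          ((wh (𝟙 X) B D.t : A⊙B⊙A⊙B ⟶ A⊙B⊙B) ≫ (wh A (𝟙 X) M.p : _ ⟶ A⊙B)) :
      _ ⟶ (wh (A⊙B⊙A⊙B) (𝟙 X) D.t :
          A⊙B⊙A⊙B⊙A⊙B⊙A ⟶ A⊙B⊙A⊙B⊙A⊙B) ≫
        (wh (𝟙 X) (B⊙A⊙B) D.t : _ ⟶ A⊙B⊙B⊙A⊙B) ≫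
        (wh A (A⊙B) M.p : _ ⟶ A⊙B⊙A⊙B) ≫
        (wh (𝟙 X) B D.t : _ ⟶ A⊙B⊙B) ≫ (wh A (𝟙 X) M.p : _ ⟶ A⊙B)) ≫
    (paste (wh (A⊙B⊙A⊙B) (𝟙 X) D.t : _ ⟶ A⊙B⊙A⊙B⊙A⊙B) (𝟙 X) B D.ν
          (wh A (𝟙 X) M.p : A⊙B⊙B ⟶ A⊙B) :
      _ ⟶ (wh (A⊙B⊙A⊙B) (𝟙 X) D.t :
          A⊙B⊙A⊙B⊙A⊙B⊙A ⟶ A⊙B⊙A⊙B⊙A⊙B) ≫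
        (wh (A⊙B) B D.t : _ ⟶ A⊙B⊙A⊙B⊙B) ≫
        (wh (𝟙 X) (B⊙B) D.t : _ ⟶ A⊙B⊙B⊙B) ≫
        (wh A B M.p : _ ⟶ A⊙B⊙B) ≫ (wh A (𝟙 X) M.p : _ ⟶ A⊙B)) ≫
    (paste ((wh (A⊙B⊙A⊙B) (𝟙 X) D.t : _ ⟶ A⊙B⊙A⊙B⊙A⊙B) ≫
          (wh (A⊙B) B D.t : _ ⟶ A⊙B⊙A⊙B⊙B) ≫
          (wh (𝟙 X) (B⊙B) D.t : _ ⟶ A⊙B⊙B⊙B)) A (𝟙 X) M.α (𝟙 _) :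
      _ ⟶ (wh (A⊙B⊙A⊙B) (𝟙 X) D.t :
          A⊙B⊙A⊙B⊙A⊙B⊙A ⟶ A⊙B⊙A⊙B⊙A⊙B) ≫
        (wh (A⊙B) B D.t : _ ⟶ A⊙B⊙A⊙B⊙B) ≫
        (wh (𝟙 X) (B⊙B) D.t : _ ⟶ A⊙B⊙B⊙B) ≫
        (wh (A⊙B) (𝟙 X) M.p : _ ⟶ A⊙B⊙B) ≫ (wh A (𝟙 X) M.p : _ ⟶ A⊙B))

set_option maxHeartbeats 1000000 in
/-- The axiom: `t → t(ApA)(tBA)(ABkA) → (Ap)(tB)(ABt)(ABkA) → (Ap)(tB)(ABAe) ≅ (Ap)(ABe)t` equals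
`t → (Ap)(ABe)t`. -/
def RightAssocLeft : Prop :=
  (paste (𝟙 _) (𝟙 X) A D.κ D.t :
      D.t ⟶ (wh (A⊙B) A D.k : A⊙B⊙A ⟶ A⊙B⊙A⊙B⊙A) ≫
        (wh (𝟙 X) (B⊙A) D.t : _ ⟶ A⊙B⊙B⊙A) ≫ (wh A A M.p : _ ⟶ A⊙B⊙A) ≫ D.t) ≫
    (paste (wh (A⊙B) A D.k : _ ⟶ A⊙B⊙A⊙B⊙A) (𝟙 X) (𝟙 X) D.ν (𝟙 _) :
      _ ⟶ (wh (A⊙B) A D.k : A⊙B⊙A ⟶ A⊙B⊙A⊙B⊙A) ≫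
        (wh (A⊙B) (𝟙 X) D.t : _ ⟶ A⊙B⊙A⊙B) ≫
        (wh (𝟙 X) B D.t : _ ⟶ A⊙B⊙B) ≫ (wh A (𝟙 X) M.p : _ ⟶ A⊙B)) ≫
    (paste (𝟙 _) (A⊙B) (𝟙 X) D.ν₀
          ((wh (𝟙 X) B D.t : A⊙B⊙A⊙B ⟶ A⊙B⊙B) ≫ (wh A (𝟙 X) M.p : _ ⟶ A⊙B)) :
      _ ⟶ (wh (A⊙B⊙A) (𝟙 X) M.e : A⊙B⊙A ⟶ A⊙B⊙A⊙B) ≫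
        (wh (𝟙 X) B D.t : _ ⟶ A⊙B⊙B) ≫ (wh A (𝟙 X) M.p : _ ⟶ A⊙B)) ≫
    (paste (𝟙 _) (𝟙 X) (𝟙 X) (interchange D.t M.e).inv
          (wh A (𝟙 X) M.p : A⊙B⊙B ⟶ A⊙B) :
      _ ⟶ D.t ≫ (wh (A⊙B) (𝟙 X) M.e : _ ⟶ A⊙B⊙B) ≫ (wh A (𝟙 X) M.p : _ ⟶ A⊙B))
  = (paste D.t A (𝟙 X) M.rho (𝟙 _) :
      D.t ⟶ D.t ≫ (wh (A⊙B) (𝟙 X) M.e : _ ⟶ A⊙B⊙B) ≫ (wh A (𝟙 X) M.p : _ ⟶ A⊙B))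

set_option maxHeartbeats 1000000 in
/-- The axiom: `t(ApA)(tBA)(kABA) → (Ap)(tB)(ABt)(kABA) ≅ (Ap)(tB)(kAB)t → (Ap)(AeB)t → t` equals
`t(ApA)(tBA)(kABA) → t(ApA)(AeBA) → t`. -/
def AssocLeft : Prop :=
  (paste (wh (𝟙 X) (A⊙B⊙A) D.k : _ ⟶ A⊙B⊙A⊙B⊙A) (𝟙 X) (𝟙 X) D.ν (𝟙 _) :
      (wh (𝟙 X) (A⊙B⊙A) D.k : A⊙B⊙A ⟶ A⊙B⊙A⊙B⊙A) ≫
        (wh (𝟙 X) (B⊙A) D.t : _ ⟶ A⊙B⊙B⊙A) ≫ (wh A A M.p : _ ⟶ A⊙B⊙A) ≫ D.t ⟶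
      (wh (𝟙 X) (A⊙B⊙A) D.k : A⊙B⊙A ⟶ A⊙B⊙A⊙B⊙A) ≫
        (wh (A⊙B) (𝟙 X) D.t : _ ⟶ A⊙B⊙A⊙B) ≫
        (wh (𝟙 X) B D.t : _ ⟶ A⊙B⊙B) ≫ (wh A (𝟙 X) M.p : _ ⟶ A⊙B)) ≫
    (paste (𝟙 _) (𝟙 X) (𝟙 X) (interchange D.k D.t).hom
          ((wh (𝟙 X) B D.t : A⊙B⊙A⊙B ⟶ A⊙B⊙B) ≫ (wh A (𝟙 X) M.p : _ ⟶ A⊙B)) :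
      _ ⟶ D.t ≫ (wh (𝟙 X) (A⊙B) D.k : _ ⟶ A⊙B⊙A⊙B) ≫
        (wh (𝟙 X) B D.t : _ ⟶ A⊙B⊙B) ≫ (wh A (𝟙 X) M.p : _ ⟶ A⊙B)) ≫
    (paste D.t (𝟙 X) B D.ν₀ (wh A (𝟙 X) M.p : A⊙B⊙B ⟶ A⊙B) :
      _ ⟶ D.t ≫ (wh A B M.e : _ ⟶ A⊙B⊙B) ≫ (wh A (𝟙 X) M.p : _ ⟶ A⊙B)) ≫
    (paste D.t A (𝟙 X) M.lam (𝟙 _) : _ ⟶ D.t)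
  = (paste (𝟙 _) (𝟙 X) (B⊙A) D.ν₀ ((wh A A M.p : A⊙B⊙B⊙A ⟶ A⊙B⊙A) ≫ D.t) :
      (wh (𝟙 X) (A⊙B⊙A) D.k : A⊙B⊙A ⟶ A⊙B⊙A⊙B⊙A) ≫
        (wh (𝟙 X) (B⊙A) D.t : _ ⟶ A⊙B⊙B⊙A) ≫ (wh A A M.p : _ ⟶ A⊙B⊙A) ≫ D.t ⟶
      (wh A (B⊙A) M.e : A⊙B⊙A ⟶ A⊙B⊙B⊙A) ≫
        (wh A A M.p : _ ⟶ A⊙B⊙A) ≫ D.t) ≫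
    (paste (𝟙 _) A A M.lam D.t : _ ⟶ D.t)

set_option maxHeartbeats 1000000 in
/-- The axiom: `(Ap)(tB) → (Ap)(tB)(ABk)(Ap)(tB) ≅ (Ap)(tB)(ApAB)(tBAB)(ABABk)
→ (Ap)(ApB)(tBB)(ABtB)(ABABk) → (Ap)(ABp)(tBB)(ABtB)(ABABk)
≅ (Ap)(tB)(ABAp)(ABtB)(ABABk)` equals `(Ap)(tB) → (Ap)(tB)(ABAp)(ABtB)(ABABk)`. -/
def RightAssoc : Prop :=
  (paste ((wh (𝟙 X) B D.t : A⊙B⊙A⊙B ⟶ A⊙B⊙B) ≫ (wh A (𝟙 X) M.p : _ ⟶ A⊙B))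
          (𝟙 X) (𝟙 X) D.κ (𝟙 _) :
      (wh (𝟙 X) B D.t : A⊙B⊙A⊙B ⟶ A⊙B⊙B) ≫ (wh A (𝟙 X) M.p : _ ⟶ A⊙B) ⟶
      (wh (𝟙 X) B D.t : A⊙B⊙A⊙B ⟶ A⊙B⊙B) ≫ (wh A (𝟙 X) M.p : _ ⟶ A⊙B) ≫
        (wh (A⊙B) (𝟙 X) D.k : _ ⟶ A⊙B⊙A⊙B) ≫
        (wh (𝟙 X) B D.t : _ ⟶ A⊙B⊙B) ≫ (wh A (𝟙 X) M.p : _ ⟶ A⊙B)) ≫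
    (paste (𝟙 _) (𝟙 X) (𝟙 X)
          (interchange ((wh (𝟙 X) B D.t : A⊙B⊙A⊙B ⟶ A⊙B⊙B) ≫
            (wh A (𝟙 X) M.p : _ ⟶ A⊙B)) D.k).hom
          ((wh (𝟙 X) B D.t : A⊙B⊙A⊙B ⟶ A⊙B⊙B) ≫ (wh A (𝟙 X) M.p : _ ⟶ A⊙B)) :
      _ ⟶ (wh (A⊙B⊙A⊙B) (𝟙 X) D.k : A⊙B⊙A⊙B ⟶ A⊙B⊙A⊙B⊙A⊙B) ≫
        (wh (𝟙 X) (B⊙A⊙B) D.t : _ ⟶ A⊙B⊙B⊙A⊙B) ≫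
        (wh A (A⊙B) M.p : _ ⟶ A⊙B⊙A⊙B) ≫
        (wh (𝟙 X) B D.t : _ ⟶ A⊙B⊙B) ≫ (wh A (𝟙 X) M.p : _ ⟶ A⊙B)) ≫
    (paste (wh (A⊙B⊙A⊙B) (𝟙 X) D.k : _ ⟶ A⊙B⊙A⊙B⊙A⊙B) (𝟙 X) B D.ν
          (wh A (𝟙 X) M.p : A⊙B⊙B ⟶ A⊙B) :
      _ ⟶ (wh (A⊙B⊙A⊙B) (𝟙 X) D.k : A⊙B⊙A⊙B ⟶ A⊙B⊙A⊙B⊙A⊙B) ≫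
        (wh (A⊙B) B D.t : _ ⟶ A⊙B⊙A⊙B⊙B) ≫
        (wh (𝟙 X) (B⊙B) D.t : _ ⟶ A⊙B⊙B⊙B) ≫
        (wh A B M.p : _ ⟶ A⊙B⊙B) ≫ (wh A (𝟙 X) M.p : _ ⟶ A⊙B)) ≫
    (paste ((wh (A⊙B⊙A⊙B) (𝟙 X) D.k : _ ⟶ A⊙B⊙A⊙B⊙A⊙B) ≫
          (wh (A⊙B) B D.t : _ ⟶ A⊙B⊙A⊙B⊙B) ≫
          (wh (𝟙 X) (B⊙B) D.t : _ ⟶ A⊙B⊙B⊙B)) A (𝟙 X) M.α (𝟙 _) :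
      _ ⟶ (wh (A⊙B⊙A⊙B) (𝟙 X) D.k : A⊙B⊙A⊙B ⟶ A⊙B⊙A⊙B⊙A⊙B) ≫
        (wh (A⊙B) B D.t : _ ⟶ A⊙B⊙A⊙B⊙B) ≫
        (wh (𝟙 X) (B⊙B) D.t : _ ⟶ A⊙B⊙B⊙B) ≫
        (wh (A⊙B) (𝟙 X) M.p : _ ⟶ A⊙B⊙B) ≫ (wh A (𝟙 X) M.p : _ ⟶ A⊙B)) ≫
    (paste ((wh (A⊙B⊙A⊙B) (𝟙 X) D.k : _ ⟶ A⊙B⊙A⊙B⊙A⊙B) ≫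
          (wh (A⊙B) B D.t : _ ⟶ A⊙B⊙A⊙B⊙B)) (𝟙 X) (𝟙 X)
          (interchange D.t M.p).hom (wh A (𝟙 X) M.p : A⊙B⊙B ⟶ A⊙B) :
      _ ⟶ (wh (A⊙B⊙A⊙B) (𝟙 X) D.k : A⊙B⊙A⊙B ⟶ A⊙B⊙A⊙B⊙A⊙B) ≫
        (wh (A⊙B) B D.t : _ ⟶ A⊙B⊙A⊙B⊙B) ≫
        (wh (A⊙B⊙A) (𝟙 X) M.p : _ ⟶ A⊙B⊙A⊙B) ≫
        (wh (𝟙 X) B D.t : _ ⟶ A⊙B⊙B) ≫ (wh A (𝟙 X) M.p : _ ⟶ A⊙B))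
  = (paste (𝟙 _) (A⊙B) (𝟙 X) D.κ
          ((wh (𝟙 X) B D.t : A⊙B⊙A⊙B ⟶ A⊙B⊙B) ≫ (wh A (𝟙 X) M.p : _ ⟶ A⊙B)) :
      (wh (𝟙 X) B D.t : A⊙B⊙A⊙B ⟶ A⊙B⊙B) ≫ (wh A (𝟙 X) M.p : _ ⟶ A⊙B) ⟶
      (wh (A⊙B⊙A⊙B) (𝟙 X) D.k : A⊙B⊙A⊙B ⟶ A⊙B⊙A⊙B⊙A⊙B) ≫
        (wh (A⊙B) B D.t : _ ⟶ A⊙B⊙A⊙B⊙B) ≫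
        (wh (A⊙B⊙A) (𝟙 X) M.p : _ ⟶ A⊙B⊙A⊙B) ≫
        (wh (𝟙 X) B D.t : _ ⟶ A⊙B⊙B) ≫ (wh A (𝟙 X) M.p : _ ⟶ A⊙B))

set_option maxHeartbeats 1000000 in
/-- The axiom: `k → (Ap)(tB)(ABk)k ≅ (Ap)(tB)(kAB)k → (Ap)(AeB)k → k` is the identity. -/
def RightLeft : Prop :=
  (paste D.k (𝟙 X) (𝟙 X) D.κ (𝟙 _) :
      D.k ⟶ D.k ≫ (wh (A⊙B) (𝟙 X) D.k : _ ⟶ A⊙B⊙A⊙B) ≫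
        (wh (𝟙 X) B D.t : _ ⟶ A⊙B⊙B) ≫ (wh A (𝟙 X) M.p : _ ⟶ A⊙B)) ≫
    (paste (𝟙 _) (𝟙 X) (𝟙 X) (interchange D.k D.k).hom
          ((wh (𝟙 X) B D.t : A⊙B⊙A⊙B ⟶ A⊙B⊙B) ≫ (wh A (𝟙 X) M.p : _ ⟶ A⊙B)) :
      _ ⟶ D.k ≫ (wh (𝟙 X) (A⊙B) D.k : _ ⟶ A⊙B⊙A⊙B) ≫
        (wh (𝟙 X) B D.t : _ ⟶ A⊙B⊙B) ≫ (wh A (𝟙 X) M.p : _ ⟶ A⊙B)) ≫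
    (paste D.k (𝟙 X) B D.ν₀ (wh A (𝟙 X) M.p : A⊙B⊙B ⟶ A⊙B) :
      _ ⟶ D.k ≫ (wh A B M.e : _ ⟶ A⊙B⊙B) ≫ (wh A (𝟙 X) M.p : _ ⟶ A⊙B)) ≫
    (paste D.k A (𝟙 X) M.lam (𝟙 _) : _ ⟶ D.k)
  = 𝟙 D.k

end SkewWarpingData

/-- A skew warping from the skew monad `M` on `B` to the endomorphism `A`. -/
structure SkewWarping {X : C} {B : X ⟶ X} (M : SkewMonad B) (A : X ⟶ X) extends
    SkewWarpingData M A where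
  assoc_assoc : toSkewWarpingData.AssocAssoc
  right_assoc_left : toSkewWarpingData.RightAssocLeft
  assoc_left : toSkewWarpingData.AssocLeft
  right_assoc : toSkewWarpingData.RightAssoc
  right_left : toSkewWarpingData.RightLeft

set_option maxHeartbeats 1000000 in
/-- The skew monad data on `A B` determined by the data of a skew warping. -/
def SkewWarpingData.comp {X : C} {B : X ⟶ X} {M : SkewMonad B} {A : X ⟶ X}
    (D : SkewWarpingData M A) : SkewMonadData (A⊙B) where
  /- `(Ap)(tB)` -/
  p := (wh (𝟙 X) B D.t : (A⊙B)⊙(A⊙B) ⟶ A⊙B⊙B) ≫ (wh A (𝟙 X) M.p : _ ⟶ A⊙B)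
  e := D.k
  /- `(Ap)(tB)(ApAB)(tBAB) → (Ap)(ApB)(tBB)(ABtB) → (Ap)(ABp)(tBB)(ABtB)
  ≅ (Ap)(tB)(ABAp)(ABtB)` -/
  α :=
    (paste (𝟙 _) (𝟙 X) B D.ν (wh A (𝟙 X) M.p : A⊙B⊙B ⟶ A⊙B) :
        _ ⟶ (wh (A⊙B) B D.t : (A⊙B)⊙(A⊙B)⊙(A⊙B) ⟶ A⊙B⊙A⊙B⊙B) ≫
          (wh (𝟙 X) (B⊙B) D.t : _ ⟶ A⊙B⊙B⊙B) ≫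
          (wh A B M.p : _ ⟶ A⊙B⊙B) ≫ (wh A (𝟙 X) M.p : _ ⟶ A⊙B)) ≫
      (paste ((wh (A⊙B) B D.t : _ ⟶ A⊙B⊙A⊙B⊙B) ≫
            (wh (𝟙 X) (B⊙B) D.t : _ ⟶ A⊙B⊙B⊙B)) A (𝟙 X) M.α (𝟙 _) :
        _ ⟶ (wh (A⊙B) B D.t : (A⊙B)⊙(A⊙B)⊙(A⊙B) ⟶ A⊙B⊙A⊙B⊙B) ≫
          (wh (𝟙 X) (B⊙B) D.t : _ ⟶ A⊙B⊙B⊙B) ≫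
          (wh (A⊙B) (𝟙 X) M.p : _ ⟶ A⊙B⊙B) ≫ (wh A (𝟙 X) M.p : _ ⟶ A⊙B)) ≫
      paste (wh (A⊙B) B D.t : _ ⟶ A⊙B⊙A⊙B⊙B) (𝟙 X) (𝟙 X)
        (interchange D.t M.p).hom (wh A (𝟙 X) M.p : A⊙B⊙B ⟶ A⊙B)
  /- `(Ap)(tB)(kAB) → (Ap)(AeB) → 1` -/
  lam :=
    (paste (𝟙 _) (𝟙 X) B D.ν₀ (wh A (𝟙 X) M.p : A⊙B⊙B ⟶ A⊙B) :
        _ ⟶ (wh A B M.e : A⊙B ⟶ A⊙B⊙B) ≫ (wh A (𝟙 X) M.p : _ ⟶ A⊙B)) ≫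
      paste (𝟙 _) A (𝟙 X) M.lam (𝟙 _)
  /- `1 → (Ap)(tB)(ABk)` -/
  rho := paste (𝟙 _) (𝟙 X) (𝟙 X) D.κ (𝟙 _)

end GrayCategory

/-! Every 2-cell in the theorem is a path of whiskered generators `p`, `e`, `t`, `k`, and every
3-cell is a sequence of local rewrites of such paths, each a whiskered `α`, `lam`, `rho`, `ν`, `ν₀`,
`κ` or an interchange. An axiom for `AB` is therefore an equality between two rewriting sequences.
Besides the given axioms, four facts are needed: rewrites at disjoint places commute; the
interchange is natural in both variables; it is invertible; and it respects composites, so that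
passing `(Ap)(tB)` across a cell means passing `p` and then `t`.

Axioms 4 and 5 for `AB` are the warping axioms 4 and 5, with the interchanges expanded. For axiom 2,
`ν₀` is brought next to `ν` and the `t`–`e` interchange is inserted together with its inverse.
Warping axiom 2 then turns `κ`, `ν`, `ν₀` and the inverse into `rho`, naturality carries `lam` back
past `t`, and what remains is axiom 2 of `B`. For axiom 3, naturality against `ν₀` exposes axiom 3
of `B`, after which warping axiom 3 applies. For axiom 1 both sides are brought to one common
sequence: the left side by warping axiom 1, naturality against `α` and axiom 1 of `B`; the right
side by naturality against `ν` and commutation of disjoint rewrites alone.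

Composites of 1-cells agree only up to propositional equality, so the argument is run on syntax:
words for 1-cells, paths for 2-cells, lists of moves for 3-cells, with decidable well-formedness.
`Rep₂` and `Rep₃` link actual cells to syntax up to `HEq`, and `Eqv` says that two lists of moves
denote the same 3-cell. The weight is carried by `ev₃_ctx` (whiskering is functorial on syntax),
`Rep₃.interchange` (interchange of composites), `Eqv.exchange`, `Eqv.naturality_left`,
`Eqv.naturality_right`, and the rewriting rule `Eqv.subst`. -/

namespace GrayCategory

variable {C : Type u} [GrayCategory.{z, w, v, u} C]

/-! ### Whiskering in strict 2-categories, up to heterogeneous equality -/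

section Strict

variable {K : Type u} [Bicategory.{z, w} K] [Bicategory.Strict K]

/-- In a strict 2-category the unitors and associators are `eqToIso`s, so the coherence cells in the
bicategorical whiskering laws disappear under `HEq`. The next four lemmas rest on the same remark.
-/
theorem id_whiskerLeft_heq {a b : K} {x y : a ⟶ b} (Γ : x ⟶ y) : HEq (𝟙 a ◁ Γ) Γ := by
  rw [id_whiskerLeft, Strict.leftUnitor_eqToIso, Strict.leftUnitor_eqToIso]
  simp

theorem whiskerRight_id_heq {a b : K} {x y : a ⟶ b} (Γ : x ⟶ y) : HEq (Γ ▷ 𝟙 b) Γ := by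
  rw [whiskerRight_id, Strict.rightUnitor_eqToIso, Strict.rightUnitor_eqToIso]
  simp

theorem comp_whiskerLeft_heq {a b c d : K} (S : a ⟶ b) (S' : b ⟶ c) {x y : c ⟶ d} (Γ : x ⟶ y) :
    HEq ((S ≫ S') ◁ Γ) (S ◁ S' ◁ Γ) := by
  rw [comp_whiskerLeft, Strict.associator_eqToIso, Strict.associator_eqToIso]
  simp

theorem whiskerRight_comp_heq {a b c d : K} {x y : a ⟶ b} (Γ : x ⟶ y) (T : b ⟶ c) (T' : c ⟶ d) :
    HEq (Γ ▷ (T ≫ T')) (Γ ▷ T ▷ T') := by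
  rw [whiskerRight_comp, Strict.associator_eqToIso, Strict.associator_eqToIso]
  simp

theorem whisker_assoc_heq {a b c d : K} (S : a ⟶ b) {x y : b ⟶ c} (Γ : x ⟶ y) (T : c ⟶ d) :
    HEq ((S ◁ Γ) ▷ T) (S ◁ (Γ ▷ T)) := by
  rw [whisker_assoc, Strict.associator_eqToIso, Strict.associator_eqToIso]
  simp

theorem heq_whiskerLeft {a b c a' b' c' : K} {S : a ⟶ b} {S' : a' ⟶ b'} {x y : b ⟶ c}
    {x' y' : b' ⟶ c'} {Γ : x ⟶ y} {Γ' : x' ⟶ y'} (ha : a = a') (hb : b = b') (hc : c = c')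
    (hS : HEq S S') (hx : HEq x x') (hy : HEq y y') (h : HEq Γ Γ') : HEq (S ◁ Γ) (S' ◁ Γ') := by
  subst ha hb hc; cases hS; cases hx; cases hy; cases h; rfl

theorem heq_whiskerRight {a b c a' b' c' : K} {T : b ⟶ c} {T' : b' ⟶ c'} {x y : a ⟶ b}
    {x' y' : a' ⟶ b'} {Γ : x ⟶ y} {Γ' : x' ⟶ y'} (ha : a = a') (hb : b = b') (hc : c = c')
    (hT : HEq T T') (hx : HEq x x') (hy : HEq y y') (h : HEq Γ Γ') : HEq (Γ ▷ T) (Γ' ▷ T') := by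
  subst ha hb hc; cases hT; cases hx; cases hy; cases h; rfl

theorem heq_comp₃ {a b a' b' : K} {x y z : a ⟶ b} {x' y' z' : a' ⟶ b'} {Γ : x ⟶ y} {Ξ : y ⟶ z}
    {Γ' : x' ⟶ y'} {Ξ' : y' ⟶ z'} (ha : a = a') (hb : b = b') (hx : HEq x x') (hy : HEq y y')
    (hz : HEq z z') (h : HEq Γ Γ') (h' : HEq Ξ Ξ') : HEq (Γ ≫ Ξ) (Γ' ≫ Ξ') := by
  subst ha hb; cases hx; cases hy; cases hz; cases h; cases h'; rfl

end Strict

/-! ### Whiskering and pasting of 3-cells in a Gray category -/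

theorem heq_post₃ {X Y Z : C} (l : Y ⟶ Z) {f f' g g' : X ⟶ Y} {θ φ : f ⟶ g} {θ' φ' : f' ⟶ g'}
    {Γ : θ ⟶ φ} {Γ' : θ' ⟶ φ'} (hf : f = f') (hg : g = g') (hθ : HEq θ θ') (hφ : HEq φ φ')
    (h : HEq Γ Γ') : HEq (post₃ l Γ) (post₃ l Γ') := by
  subst hf hg; cases hθ; cases hφ; cases h; rfl

theorem heq_pre₃ {X Y Z : C} (r : X ⟶ Y) {f f' g g' : Y ⟶ Z} {θ φ : f ⟶ g} {θ' φ' : f' ⟶ g'}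
    {Γ : θ ⟶ φ} {Γ' : θ' ⟶ φ'} (hf : f = f') (hg : g = g') (hθ : HEq θ θ') (hφ : HEq φ φ')
    (h : HEq Γ Γ') : HEq (pre₃ Γ r) (pre₃ Γ' r) := by
  subst hf hg; cases hθ; cases hφ; cases h; rfl

/-- The casts in `wh₃` become identities once the boundary equations are substituted, so laws for
`wh₃` reduce to those for `post₃` and `pre₃`. -/
theorem wh₃_heq {W X Y Z : C} (l : Y ⟶ Z) (r : W ⟶ X) {f g : X ⟶ Y} {θ θ' : f ⟶ g} (Γ : θ ⟶ θ')
    {s t : W ⟶ Z} (hs : s = l ⊙ f ⊙ r) (ht : t = l ⊙ g ⊙ r) :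
    HEq (wh₃ l r Γ hs ht) (post₃ l (pre₃ Γ r)) := by
  subst hs ht
  exact (id_whiskerLeft_heq _).trans (whiskerRight_id_heq _)

theorem wh₃_wh₃ {V W X Y Z A : C} (l' : Z ⟶ A) (r' : V ⟶ W) (l : Y ⟶ Z) (r : W ⟶ X) {f g : X ⟶ Y}
    {θ θ' : f ⟶ g} (Γ : θ ⟶ θ') {s t : W ⟶ Z} (hs : s = l ⊙ f ⊙ r) (ht : t = l ⊙ g ⊙ r)
    {s' t' : V ⟶ A} (hs' : s' = l' ⊙ s ⊙ r') (ht' : t' = l' ⊙ t ⊙ r') :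
    HEq (wh₃ l' r' (wh₃ l r Γ hs ht) hs' ht')
      (wh₃ (l' ⊙ l) (r ⊙ r') Γ (by simp [hs', hs]) (by simp [ht', ht]) : _ ⟶ (_ : s' ⟶ t')) := by
  refine (wh₃_heq _ _ _ _ _).trans (HEq.trans ?_ (wh₃_heq _ _ _ _ _).symm)
  refine (heq_post₃ _ (by rw [hs]) (by rw [ht]) (heq_pre₂ _ hs ht (wh_heq _ _ _ _ _))
    (heq_pre₂ _ hs ht (wh_heq _ _ _ _ _))
    (heq_pre₃ _ hs ht (wh_heq _ _ _ _ _) (wh_heq _ _ _ _ _) (wh₃_heq _ _ _ _ _))).trans ?_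
  refine HEq.trans ?_ (post₃_mul _ _ _).symm
  -- The 3-cells can be compared only after their 2-cell boundaries have been regrouped in the same
  -- way.
  have key : ∀ ψ : f ⟶ g, HEq (pre₂ (post₂ l (pre₂ ψ r)) r') (post₂ l (pre₂ ψ (r ⊙ r'))) :=
    fun ψ => (post₂_pre₂ _ _ _).symm.trans
      (heq_post₂ _ (by simp) (by simp) (pre₂_mul _ _ _).symm)
  refine heq_post₃ _ (by simp) (by simp) (key _) (key _) ?_
  refine (post₃_pre₃ _ _ _).symm.trans ?_
  exact heq_post₃ _ (by simp) (by simp) (pre₂_mul _ _ _).symm (pre₂_mul _ _ _).symm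
    (pre₃_mul _ _ _).symm

theorem wh₃_id {W X Y Z : C} (l : Y ⟶ Z) (r : W ⟶ X) {f g : X ⟶ Y} (θ : f ⟶ g)
    {s t : W ⟶ Z} (hs : s = l ⊙ f ⊙ r) (ht : t = l ⊙ g ⊙ r) :
    wh₃ l r (𝟙 θ) hs ht = 𝟙 _ := by
  simp [wh₃, wh, pre₃_id, post₃_id]

theorem wh₃_comp {W X Y Z : C} (l : Y ⟶ Z) (r : W ⟶ X) {f g : X ⟶ Y} {θ φ ψ : f ⟶ g} (Γ : θ ⟶ φ)
    (Ξ : φ ⟶ ψ) {s t : W ⟶ Z} (hs : s = l ⊙ f ⊙ r) (ht : t = l ⊙ g ⊙ r) :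
    wh₃ l r (Γ ≫ Ξ) hs ht = wh₃ l r Γ hs ht ≫ wh₃ l r Ξ hs ht := by
  simp only [wh₃, pre₃_comp, post₃_comp, comp_whiskerRight, whiskerLeft_comp]
  rfl

theorem wh₃_whiskerLeft {W X Y Z : C} (l : Y ⟶ Z) (r : W ⟶ X) {f g h : X ⟶ Y} (S : f ⟶ g)
    {θ φ : g ⟶ h} (Γ : θ ⟶ φ) {s m t : W ⟶ Z} (hs : s = l ⊙ f ⊙ r) (hm : m = l ⊙ g ⊙ r)
    (ht : t = l ⊙ h ⊙ r) :
    HEq (wh₃ l r (S ◁ Γ) hs ht) (wh l r S hs hm ◁ wh₃ l r Γ hm ht) := by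
  subst hs hm ht
  refine (wh₃_heq _ _ _ _ _).trans (HEq.trans ?_ (heq_whiskerLeft rfl rfl rfl
    (wh_heq _ _ _ _ _) (wh_heq _ _ _ _ _) (wh_heq _ _ _ _ _) (wh₃_heq _ _ _ _ _)).symm)
  refine (heq_post₃ _ rfl rfl (heq_of_eq (pre₂_comp _ _ _)) (heq_of_eq (pre₂_comp _ _ _))
    (pre₃_whiskerLeft _ _ _)).trans (post₃_whiskerLeft _ _ _)

theorem wh₃_whiskerRight {W X Y Z : C} (l : Y ⟶ Z) (r : W ⟶ X) {f g h : X ⟶ Y} {θ φ : f ⟶ g}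
    (Γ : θ ⟶ φ) (T : g ⟶ h) {s m t : W ⟶ Z} (hs : s = l ⊙ f ⊙ r) (hm : m = l ⊙ g ⊙ r)
    (ht : t = l ⊙ h ⊙ r) :
    HEq (wh₃ l r (Γ ▷ T) hs ht) (wh₃ l r Γ hs hm ▷ wh l r T hm ht) := by
  subst hs hm ht
  refine (wh₃_heq _ _ _ _ _).trans (HEq.trans ?_ (heq_whiskerRight rfl rfl rfl
    (wh_heq _ _ _ _ _) (wh_heq _ _ _ _ _) (wh_heq _ _ _ _ _) (wh₃_heq _ _ _ _ _)).symm)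
  refine (heq_post₃ _ rfl rfl (heq_of_eq (pre₂_comp _ _ _)) (heq_of_eq (pre₂_comp _ _ _))
    (pre₃_whiskerRight _ _ _)).trans (post₃_whiskerRight _ _ _)

theorem paste_heq {W X Y Z : C} {a b c d : W ⟶ Z} (S : a ⟶ b) (l : Y ⟶ Z) (r : W ⟶ X) {f g : X ⟶ Y}
    {θ θ' : f ⟶ g} (Γ : θ ⟶ θ') (T : c ⟶ d) {x y : a ⟶ d} (hb : b = l ⊙ f ⊙ r)
    (hc : c = l ⊙ g ⊙ r) (hx : x = S ≫ wh l r θ hb hc ≫ T) (hy : y = S ≫ wh l r θ' hb hc ≫ T) :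
    HEq (paste S l r Γ T hb hc hx hy) (S ◁ (wh₃ l r Γ hb hc ▷ T)) := by
  subst hx hy; simp [paste]

theorem paste_one_heq {Y Z : C} {a b c d f g : Y ⟶ Z} {S : a ⟶ b} {T : c ⟶ d} {θ θ' : f ⟶ g}
    (Γ : θ ⟶ θ') {x y : a ⟶ d} (hb : b = 𝟙 Z ⊙ f ⊙ 𝟙 Y) (hc : c = 𝟙 Z ⊙ g ⊙ 𝟙 Y)
    (hx : x = S ≫ wh (𝟙 Z) (𝟙 Y) θ hb hc ≫ T) (hy : y = S ≫ wh (𝟙 Z) (𝟙 Y) θ' hb hc ≫ T)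
    (hab : a = b) (hcd : c = d) (hS : HEq S (𝟙 a)) (hT : HEq T (𝟙 d)) :
    HEq (paste S (𝟙 Z) (𝟙 Y) Γ T hb hc hx hy) Γ := by
  subst hab hcd; cases hS; cases hT
  exact (paste_heq _ _ _ _ _ _ _ _ _).trans ((id_whiskerLeft_heq _).trans
    ((whiskerRight_id_heq _).trans ((wh₃_heq _ _ _ _ _).trans
      ((post₃_one _).trans (pre₃_one _)))))

theorem heq_paste {W X Y Z : C} {a b c d a' b' c' d' : W ⟶ Z} {S : a ⟶ b} {S' : a' ⟶ b'}
    {l l' : Y ⟶ Z} {r r' : W ⟶ X} {f g f' g' : X ⟶ Y} {θ φ : f ⟶ g} {θ' φ' : f' ⟶ g'}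
    {Γ : θ ⟶ φ} {Γ' : θ' ⟶ φ'} {T : c ⟶ d} {T' : c' ⟶ d'} {x y : a ⟶ d} {x' y' : a' ⟶ d'}
    {hb : b = l ⊙ f ⊙ r} {hc : c = l ⊙ g ⊙ r} {hx : x = S ≫ wh l r θ hb hc ≫ T}
    {hy : y = S ≫ wh l r φ hb hc ≫ T} {hb' : b' = l' ⊙ f' ⊙ r'} {hc' : c' = l' ⊙ g' ⊙ r'}
    {hx' : x' = S' ≫ wh l' r' θ' hb' hc' ≫ T'} {hy' : y' = S' ≫ wh l' r' φ' hb' hc' ≫ T'}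
    (ha : a = a') (hd : d = d') (hf : f = f') (hg : g = g') (hl : l = l') (hr : r = r')
    (hS : HEq S S') (hT : HEq T T') (hθ : HEq θ θ') (hφ : HEq φ φ') (hΓ : HEq Γ Γ') :
    HEq (paste S l r Γ T hb hc hx hy) (paste S' l' r' Γ' T' hb' hc' hx' hy') := by
  subst ha hd hf hg hl hr hb hc hb' hc'
  cases hS; cases hT; cases hθ; cases hφ; cases hΓ; subst hx hy hx' hy'; rfl

theorem paste_id {W X Y Z : C} {a b c d : W ⟶ Z} (S : a ⟶ b) (l : Y ⟶ Z) (r : W ⟶ X) {f g : X ⟶ Y}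
    (θ : f ⟶ g) (T : c ⟶ d) {x y : a ⟶ d} (hb : b = l ⊙ f ⊙ r)
    (hc : c = l ⊙ g ⊙ r) (hx : x = S ≫ wh l r θ hb hc ≫ T) (hy : y = S ≫ wh l r θ hb hc ≫ T) :
    paste S l r (𝟙 θ) T hb hc hx hy = eqToHom (hx.trans hy.symm) := by
  subst hx hy; simp [paste, wh₃_id]

theorem paste_comp {W X Y Z : C} {a b c d : W ⟶ Z} (S : a ⟶ b) (l : Y ⟶ Z) (r : W ⟶ X)
    {f g : X ⟶ Y} {θ φ ψ : f ⟶ g} (Γ : θ ⟶ φ) (Ξ : φ ⟶ ψ) (T : c ⟶ d) {x y m : a ⟶ d}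
    (hb : b = l ⊙ f ⊙ r) (hc : c = l ⊙ g ⊙ r) (hx : x = S ≫ wh l r θ hb hc ≫ T)
    (hm : m = S ≫ wh l r φ hb hc ≫ T) (hy : y = S ≫ wh l r ψ hb hc ≫ T) :
    paste S l r (Γ ≫ Ξ) T hb hc hx hy =
      paste S l r Γ T hb hc hx hm ≫ paste S l r Ξ T hb hc hm hy := by
  subst hx hm hy; simp [paste, wh₃_comp]

theorem paste_boundary {V W X Y Z A : C} {a' b' c' d' : V ⟶ A} {a b c d : W ⟶ Z} {S' : a' ⟶ b'}
    {l' : Z ⟶ A} {r' : V ⟶ W} {S : a ⟶ b} {l : Y ⟶ Z} {r : W ⟶ X} {f g : X ⟶ Y} {θ : f ⟶ g}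
    {T : c ⟶ d} {T' : c' ⟶ d'} {x : a ⟶ d} {x' : a' ⟶ d'} {m n : V ⟶ A}
    {hb : b = l ⊙ f ⊙ r} {hc : c = l ⊙ g ⊙ r} (hx : x = S ≫ wh l r θ hb hc ≫ T)
    {hb' : b' = l' ⊙ a ⊙ r'} {hc' : c' = l' ⊙ d ⊙ r'} (hx' : x' = S' ≫ wh l' r' x hb' hc' ≫ T')
    (hm : m = l' ⊙ b ⊙ r') (hn : n = l' ⊙ c ⊙ r') (hm' : m = (l' ⊙ l) ⊙ f ⊙ (r ⊙ r'))
    (hn' : n = (l' ⊙ l) ⊙ g ⊙ (r ⊙ r')) :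
    x' = (S' ≫ wh l' r' S hb' hm) ≫ wh (l' ⊙ l) (r ⊙ r') θ hm' hn' ≫ (wh l' r' T hn hc' ≫ T') := by
  subst hx hx' hm hn
  rw [wh_comp, wh_comp, wh_wh]
  simp

/-- The outer whiskering distributes over the three factors of the inner pasting and merges with its
whiskering, so a context inside a context is again a context. The 1-cells `m` and `n` are left free
so that they can be values of words, which equal the whiskered composites only propositionally. -/
theorem paste_paste {V W X Y Z A : C} {a' b' c' d' : V ⟶ A} {a b c d : W ⟶ Z} (S' : a' ⟶ b')
    (l' : Z ⟶ A) (r' : V ⟶ W) (S : a ⟶ b) (l : Y ⟶ Z) (r : W ⟶ X) {f g : X ⟶ Y} {θ φ : f ⟶ g}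
    (Γ : θ ⟶ φ) (T : c ⟶ d) (T' : c' ⟶ d') {x y : a ⟶ d} {x' y' : a' ⟶ d'} {m n : V ⟶ A}
    (hb : b = l ⊙ f ⊙ r) (hc : c = l ⊙ g ⊙ r) (hx : x = S ≫ wh l r θ hb hc ≫ T)
    (hy : y = S ≫ wh l r φ hb hc ≫ T) (hb' : b' = l' ⊙ a ⊙ r') (hc' : c' = l' ⊙ d ⊙ r')
    (hx' : x' = S' ≫ wh l' r' x hb' hc' ≫ T') (hy' : y' = S' ≫ wh l' r' y hb' hc' ≫ T')
    (hm : m = l' ⊙ b ⊙ r') (hn : n = l' ⊙ c ⊙ r') (hm' : m = (l' ⊙ l) ⊙ f ⊙ (r ⊙ r'))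
    (hn' : n = (l' ⊙ l) ⊙ g ⊙ (r ⊙ r'))
    (hx'' : x' = (S' ≫ wh l' r' S hb' hm) ≫ wh (l' ⊙ l) (r ⊙ r') θ hm' hn' ≫
      (wh l' r' T hn hc' ≫ T'))
    (hy'' : y' = (S' ≫ wh l' r' S hb' hm) ≫ wh (l' ⊙ l) (r ⊙ r') φ hm' hn' ≫
      (wh l' r' T hn hc' ≫ T')) :
    paste S' l' r' (paste S l r Γ T hb hc hx hy) T' hb' hc' hx' hy' =
      paste (S' ≫ wh l' r' S hb' hm) (l' ⊙ l) (r ⊙ r') Γ (wh l' r' T hn hc' ≫ T') hm' hn'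
        hx'' hy'' := by
  apply eq_of_heq
  refine (paste_heq _ _ _ _ _ _ _ _ _).trans (HEq.trans ?_ (paste_heq _ _ _ _ _ _ _ _ _).symm)
  subst hx hy hx' hy'
  have e : ∀ ψ : f ⟶ g, wh l' r' (S ≫ wh l r ψ hb hc ≫ T) hb' hc' =
      wh l' r' S hb' hm ≫ wh (l' ⊙ l) (r ⊙ r') ψ hm' hn' ≫ wh l' r' T hn hc' := by
    intro ψ
    subst hm hn
    rw [wh_comp, wh_comp, wh_wh]
  have key : HEq (wh₃ l' r' (paste S l r Γ T hb hc rfl rfl) hb' hc')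
      (wh l' r' S hb' hm ◁ (wh₃ (l' ⊙ l) (r ⊙ r') Γ hm' hn' ▷ wh l' r' T hn hc')) := by
    have : paste S l r Γ T hb hc rfl rfl = S ◁ (wh₃ l r Γ hb hc ▷ T) :=
      eq_of_heq (paste_heq _ _ _ _ _ _ _ _ _)
    rw [this]
    refine (wh₃_whiskerLeft _ _ _ _ _ hm _).trans ?_
    refine heq_whiskerLeft rfl rfl rfl HEq.rfl ?_ ?_ ?_
    · subst hn; rw [wh_comp, wh_wh]
    · subst hn; rw [wh_comp, wh_wh]
    · refine (wh₃_whiskerRight _ _ _ _ _ hn _).trans ?_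
      refine heq_whiskerRight rfl rfl rfl HEq.rfl ?_ ?_ (wh₃_wh₃ _ _ _ _ _ _ _ _ _)
      · rw [wh_wh]
      · rw [wh_wh]
  refine HEq.trans ?_ (comp_whiskerLeft_heq _ _ _).symm
  refine heq_whiskerLeft rfl rfl rfl HEq.rfl ?_ ?_ ?_
  · rw [e]; simp
  · rw [e]; simp
  · refine (heq_whiskerRight rfl rfl rfl HEq.rfl (heq_of_eq (e _)) (heq_of_eq (e _)) key).trans ?_
    refine (whisker_assoc_heq _ _ _).trans ?_
    refine heq_whiskerLeft rfl rfl rfl HEq.rfl ?_ ?_ (whiskerRight_comp_heq _ _ _).symm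
    · simp
    · simp

/-- 3-cells in disjoint parts of a composite 2-cell commute. -/
theorem paste_exchange {W X Y Z X' Y' : C} {a b c b' c' d : W ⟶ Z} (S : a ⟶ b) (l : Y ⟶ Z)
    (r : W ⟶ X) {f g : X ⟶ Y} {θ φ : f ⟶ g} (Γ : θ ⟶ φ) (R : c ⟶ b') (l' : Y' ⟶ Z) (r' : W ⟶ X')
    {f' g' : X' ⟶ Y'} {θ' φ' : f' ⟶ g'} (Γ' : θ' ⟶ φ') (T : c' ⟶ d) {x y z y' : a ⟶ d}
    (hb : b = l ⊙ f ⊙ r) (hc : c = l ⊙ g ⊙ r) (hb' : b' = l' ⊙ f' ⊙ r') (hc' : c' = l' ⊙ g' ⊙ r')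
    (h₁ : x = S ≫ wh l r θ hb hc ≫ R ≫ wh l' r' θ' hb' hc' ≫ T)
    (h₂ : y = S ≫ wh l r φ hb hc ≫ R ≫ wh l' r' θ' hb' hc' ≫ T)
    (h₃ : y = (S ≫ wh l r φ hb hc ≫ R) ≫ wh l' r' θ' hb' hc' ≫ T)
    (h₄ : z = (S ≫ wh l r φ hb hc ≫ R) ≫ wh l' r' φ' hb' hc' ≫ T)
    (h₅ : x = (S ≫ wh l r θ hb hc ≫ R) ≫ wh l' r' θ' hb' hc' ≫ T)
    (h₆ : y' = (S ≫ wh l r θ hb hc ≫ R) ≫ wh l' r' φ' hb' hc' ≫ T)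
    (h₇ : y' = S ≫ wh l r θ hb hc ≫ R ≫ wh l' r' φ' hb' hc' ≫ T)
    (h₈ : z = S ≫ wh l r φ hb hc ≫ R ≫ wh l' r' φ' hb' hc' ≫ T) :
    paste S l r Γ (R ≫ wh l' r' θ' hb' hc' ≫ T) hb hc h₁ h₂ ≫
        paste (S ≫ wh l r φ hb hc ≫ R) l' r' Γ' T hb' hc' h₃ h₄ =
      paste (S ≫ wh l r θ hb hc ≫ R) l' r' Γ' T hb' hc' h₅ h₆ ≫
        paste S l r Γ (R ≫ wh l' r' φ' hb' hc' ≫ T) hb hc h₇ h₈ := by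
  have key : ∀ (ψ : f ⟶ g) {x y : a ⟶ d}
      (hx : x = (S ≫ wh l r ψ hb hc ≫ R) ≫ wh l' r' θ' hb' hc' ≫ T)
      (hy : y = (S ≫ wh l r ψ hb hc ≫ R) ≫ wh l' r' φ' hb' hc' ≫ T),
      HEq (paste (S ≫ wh l r ψ hb hc ≫ R) l' r' Γ' T hb' hc' hx hy)
        (S ◁ wh l r ψ hb hc ◁ R ◁ (wh₃ l' r' Γ' hb' hc' ▷ T)) := fun ψ _ _ hx hy =>
    (paste_heq _ _ _ _ _ _ _ _ _).trans ((comp_whiskerLeft_heq _ _ _).trans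
      (heq_whiskerLeft rfl rfl rfl HEq.rfl (by simp) (by simp) (comp_whiskerLeft_heq _ _ _)))
  apply eq_of_heq
  refine (heq_comp₃ rfl rfl (heq_of_eq h₁) (heq_of_eq h₂) (heq_of_eq h₈)
    (paste_heq _ _ _ _ _ _ _ _ _) (key _ _ _)).trans (HEq.trans ?_ (heq_comp₃ rfl rfl
      (heq_of_eq h₁) (heq_of_eq h₇) (heq_of_eq h₈) (key _ _ _)
      (paste_heq _ _ _ _ _ _ _ _ _)).symm)
  -- With the common prefix `S` factored out, the two orders differ by the exchange law of the hom
  -- 2-category; no Gray interchange is involved.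
  rw [← whiskerLeft_comp, ← whiskerLeft_comp, whisker_exchange]

/-! ### Formal composites of the cells of a skew warping -/

namespace Diagram

/-- The generating 1-cells. -/
inductive Letter
  | A
  | B
  deriving DecidableEq

/-- Formal composites of 1-cells. -/
abbrev Word := List Letter

/-- The generating 2-cells. -/
inductive Gen₂
  | p
  | e
  | t
  | k
  deriving DecidableEq

open Letter

def Gen₂.src : Gen₂ → Word
  | p => [B, B]
  | e => []
  | t => [A, B, A]
  | k => []

def Gen₂.tgt : Gen₂ → Word
  | p => [B]
  | e => [B]
  | t => [A, B]
  | k => [A, B]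

/-- The formal whiskering `l g r` of a generating 2-cell. -/
structure Step where
  l : Word
  g : Gen₂
  r : Word
  deriving DecidableEq

def Step.whisk (l r : Word) (σ : Step) : Step := ⟨l ++ σ.l, σ.g, σ.r ++ r⟩

/-- Formal composites of 2-cells; the head is applied first. -/
abbrev Path := List Step

def whisk (l r : Word) (u : Path) : Path := u.map (Step.whisk l r)

/-- `u` is a formal 2-cell from `s` to `t`. -/
def Valid₂ (s t : Word) : Path → Prop
  | [] => s = t
  | σ :: u => s = σ.l ++ (σ.g.src ++ σ.r) ∧ Valid₂ (σ.l ++ (σ.g.tgt ++ σ.r)) t u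

/-- Together with the corresponding instance for `Valid₃`, this lets `decide` check all boundaries
of concrete diagrams. -/
instance (s t : Word) (u : Path) : Decidable (Valid₂ s t u) := by
  induction u generalizing s with
  | nil => exact inferInstanceAs (Decidable (s = t))
  | cons σ u ih =>
    have := ih (σ.l ++ (σ.g.tgt ++ σ.r))
    exact inferInstanceAs (Decidable (s = σ.l ++ (σ.g.src ++ σ.r) ∧ Valid₂ _ t u))

theorem Valid₂.head {s t : Word} {σ : Step} {u : Path} (h : Valid₂ s t (σ :: u)) :
    s = σ.l ++ (σ.g.src ++ σ.r) := h.1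

theorem Valid₂.tail {s t : Word} {σ : Step} {u : Path} (h : Valid₂ s t (σ :: u)) :
    Valid₂ (σ.l ++ (σ.g.tgt ++ σ.r)) t u := h.2

theorem Valid₂.append {s m t : Word} {u v : Path} (hu : Valid₂ s m u) (hv : Valid₂ m t v) :
    Valid₂ s t (u ++ v) := by
  induction u generalizing s with
  | nil => cases hu; exact hv
  | cons σ u ih => exact ⟨hu.head, ih hu.tail⟩

theorem Valid₂.whisk (l r : Word) {s t : Word} {u : Path} (hu : Valid₂ s t u) :
    Valid₂ (l ++ (s ++ r)) (l ++ (t ++ r)) (whisk l r u) := by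
  induction u generalizing s with
  | nil => cases hu; exact rfl
  | cons σ u ih =>
    refine ⟨by simp [Step.whisk, hu.head], ?_⟩
    simpa [Step.whisk, Diagram.whisk] using ih hu.tail

theorem whisk_append (l r : Word) (u v : Path) : whisk l r (u ++ v) = whisk l r u ++ whisk l r v :=
  List.map_append

theorem whisk_whisk (l r l' r' : Word) (u : Path) :
    whisk l r (whisk l' r' u) = whisk (l ++ l') (r' ++ r) u := by
  simp [whisk, Step.whisk, Function.comp_def]

theorem whisk_nil (u : Path) : whisk [] [] u = u := by
  simp [whisk, show Step.whisk [] [] = id from funext fun _ => by simp [Step.whisk]]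

/-- The generating 3-cells, including the interchange of `φ m` and `θ` and its inverse. -/
inductive Gen₃
  | α
  | lam
  | rho
  | ν
  | ν₀
  | κ
  -- The word `m` separates the two generators. Words outside them belong to the enclosing move, so
  -- this one parameter covers every interchange of two whiskered generators.
  | swap (φ : Gen₂) (m : Word) (θ : Gen₂)
  | unswap (φ : Gen₂) (m : Word) (θ : Gen₂)

def Gen₃.src : Gen₃ → Word
  | α => [B, B, B]
  | lam => [B]
  | rho => [B]
  | ν => [A, B, A, B, A]
  | ν₀ => [A]
  | κ => [A, B]
  | swap φ m θ => φ.src ++ (m ++ θ.src)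
  | unswap φ m θ => φ.src ++ (m ++ θ.src)

def Gen₃.tgt : Gen₃ → Word
  | α => [B]
  | lam => [B]
  | rho => [B]
  | ν => [A, B]
  | ν₀ => [A, B]
  | κ => [A, B]
  | swap φ m θ => φ.tgt ++ (m ++ θ.tgt)
  | unswap φ m θ => φ.tgt ++ (m ++ θ.tgt)

def Gen₃.dom : Gen₃ → Path
  | α => [⟨[], .p, [B]⟩, ⟨[], .p, []⟩]
  | lam => [⟨[], .e, [B]⟩, ⟨[], .p, []⟩]
  | rho => []
  | ν => [⟨[], .t, [B, A]⟩, ⟨[A], .p, [A]⟩, ⟨[], .t, []⟩]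
  | ν₀ => [⟨[], .k, [A]⟩, ⟨[], .t, []⟩]
  | κ => []
  | swap φ m θ => [⟨[], φ, m ++ θ.src⟩, ⟨φ.tgt ++ m, θ, []⟩]
  | unswap φ m θ => [⟨φ.src ++ m, θ, []⟩, ⟨[], φ, m ++ θ.tgt⟩]

def Gen₃.cod : Gen₃ → Path
  | α => [⟨[B], .p, []⟩, ⟨[], .p, []⟩]
  | lam => []
  | rho => [⟨[B], .e, []⟩, ⟨[], .p, []⟩]
  | ν => [⟨[A, B], .t, []⟩, ⟨[], .t, [B]⟩, ⟨[A], .p, []⟩]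
  | ν₀ => [⟨[A], .e, []⟩]
  | κ => [⟨[A, B], .k, []⟩, ⟨[], .t, [B]⟩, ⟨[A], .p, []⟩]
  | swap φ m θ => [⟨φ.src ++ m, θ, []⟩, ⟨[], φ, m ++ θ.tgt⟩]
  | unswap φ m θ => [⟨[], φ, m ++ θ.src⟩, ⟨φ.tgt ++ m, θ, []⟩]

theorem Gen₃.dom_valid (Γ : Gen₃) : Valid₂ Γ.src Γ.tgt Γ.dom := by
  cases Γ <;> simp [Valid₂, src, tgt, dom, Gen₂.src, Gen₂.tgt]

theorem Gen₃.cod_valid (Γ : Gen₃) : Valid₂ Γ.src Γ.tgt Γ.cod := by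
  cases Γ <;> simp [Valid₂, src, tgt, cod, Gen₂.src, Gen₂.tgt]

/-- The formal 3-cell `T (l Γ r) S`. -/
structure Move where
  S : Path
  l : Word
  Γ : Gen₃
  r : Word
  T : Path

def Move.dom (m : Move) : Path := m.S ++ (whisk m.l m.r m.Γ.dom ++ m.T)

def Move.cod (m : Move) : Path := m.S ++ (whisk m.l m.r m.Γ.cod ++ m.T)

structure Move.Valid (s t : Word) (m : Move) : Prop where
  left : Valid₂ s (m.l ++ (m.Γ.src ++ m.r)) m.S
  right : Valid₂ (m.l ++ (m.Γ.tgt ++ m.r)) t m.T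

theorem Move.Valid.cod {s t : Word} {m : Move} (h : m.Valid s t) : Valid₂ s t m.cod :=
  h.left.append ((m.Γ.cod_valid.whisk _ _).append h.right)

/-- `c` is a formal 3-cell from `x` to `y`, where `x` and `y` are formal 2-cells from `s` to `t`. -/
def Valid₃ (s t : Word) (x y : Path) : List Move → Prop
  | [] => x = y
  | m :: c => m.Valid s t ∧ x = m.dom ∧ Valid₃ s t m.cod y c

instance (s t : Word) (m : Move) : Decidable (m.Valid s t) :=
  decidable_of_iff _ ⟨fun h => ⟨h.1, h.2⟩, fun h => And.intro h.left h.right⟩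

instance (s t : Word) (x y : Path) (c : List Move) : Decidable (Valid₃ s t x y c) := by
  induction c generalizing x with
  | nil => exact inferInstanceAs (Decidable (x = y))
  | cons m c ih =>
    have := ih m.cod
    exact inferInstanceAs (Decidable (m.Valid s t ∧ x = m.dom ∧ Valid₃ s t m.cod y c))

theorem Valid₃.head {s t : Word} {x y : Path} {m : Move} {c : List Move}
    (h : Valid₃ s t x y (m :: c)) : m.Valid s t := h.1

theorem Valid₃.head_dom {s t : Word} {x y : Path} {m : Move} {c : List Move}
    (h : Valid₃ s t x y (m :: c)) : x = m.dom := h.2.1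

theorem Valid₃.tail {s t : Word} {x y : Path} {m : Move} {c : List Move}
    (h : Valid₃ s t x y (m :: c)) : Valid₃ s t m.cod y c := h.2.2

theorem Valid₃.append {s t : Word} {x y z : Path} {c d : List Move} (hc : Valid₃ s t x y c)
    (hd : Valid₃ s t y z d) : Valid₃ s t x z (c ++ d) := by
  induction c generalizing x with
  | nil => cases hc; exact hd
  | cons m c ih => exact ⟨hc.head, hc.head_dom, ih hc.tail⟩

theorem Valid₃.cod_valid {s t : Word} {x y : Path} {c : List Move} (hx : Valid₂ s t x)
    (hc : Valid₃ s t x y c) : Valid₂ s t y := by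
  induction c generalizing x with
  | nil => cases hc; exact hx
  | cons m c ih => exact ih hc.head.cod hc.tail

def Move.ctx (S : Path) (l r : Word) (T : Path) (m : Move) : Move :=
  ⟨S ++ whisk l r m.S, l ++ m.l, m.Γ, m.r ++ r, whisk l r m.T ++ T⟩

/-- The formal 3-cell `T (l c r) S`. -/
def ctx (S : Path) (l r : Word) (T : Path) (c : List Move) : List Move := c.map (Move.ctx S l r T)

theorem Move.Valid.ctx {s t s' t' : Word} {S T : Path} {l r : Word} {m : Move}
    (h : m.Valid s t) (hS : Valid₂ s' (l ++ (s ++ r)) S) (hT : Valid₂ (l ++ (t ++ r)) t' T) :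
    (m.ctx S l r T).Valid s' t' := by
  constructor
  · have := hS.append (h.left.whisk l r)
    simp only [List.append_assoc] at this
    simpa [Move.ctx] using this
  · have := (h.right.whisk l r).append hT
    simp only [List.append_assoc] at this
    simpa [Move.ctx] using this

theorem Move.dom_ctx (S : Path) (l r : Word) (T : Path) (m : Move) :
    (m.ctx S l r T).dom = S ++ (whisk l r m.dom ++ T) := by
  simp [Move.dom, Move.ctx, whisk_append, whisk_whisk]

theorem Move.cod_ctx (S : Path) (l r : Word) (T : Path) (m : Move) :
    (m.ctx S l r T).cod = S ++ (whisk l r m.cod ++ T) := by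
  simp [Move.cod, Move.ctx, whisk_append, whisk_whisk]

theorem Valid₃.ctx {s t s' t' : Word} {x y S T : Path} {l r : Word} {c : List Move}
    (hc : Valid₃ s t x y c) (hS : Valid₂ s' (l ++ (s ++ r)) S)
    (hT : Valid₂ (l ++ (t ++ r)) t' T) :
    Valid₃ s' t' (S ++ (whisk l r x ++ T)) (S ++ (whisk l r y ++ T)) (ctx S l r T c) := by
  induction c generalizing x with
  | nil => cases hc; rfl
  | cons m c ih =>
    refine ⟨hc.head.ctx hS hT, ?_, ?_⟩
    · rw [Move.dom_ctx, hc.head_dom]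
    · rw [Move.cod_ctx]; exact ih hc.tail

/-! ### Interpretation -/

variable {X : C} {B : X ⟶ X} {M : SkewMonad B} {A : X ⟶ X} (D : SkewWarpingData M A)

/-- The 1-cell denoted by a word. -/
def ev (A B : X ⟶ X) : Word → (X ⟶ X)
  | [] => 𝟙 X
  -- Singletons are separate cases so that no trailing `𝟙 X` appears: the value of `[.A, .B]` is `A
  -- ⊙ B` by definition, which makes many later boundary checks `rfl`.
  | [.A] => A
  | [.B] => B
  | .A :: b :: w => A ⊙ ev A B (b :: w)
  | .B :: b :: w => B ⊙ ev A B (b :: w)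

theorem ev_append (A B : X ⟶ X) (w w' : Word) : ev A B (w ++ w') = ev A B w ⊙ ev A B w' := by
  have cons : ∀ (a : Letter) (w : Word), ev A B (a :: w) = ev A B [a] ⊙ ev A B w := by
    rintro (_ | _) (_ | _) <;> simp [ev]
  induction w with
  | nil => simp [ev]
  | cons a w ih => rw [List.cons_append, cons, ih, cons a w, Category.assoc]

theorem ev_append₃ (A B : X ⟶ X) (l w r : Word) :
    ev A B (l ++ (w ++ r)) = ev A B l ⊙ ev A B w ⊙ ev A B r := by
  rw [ev_append, ev_append]

/-- The 2-cell denoted by a generator. -/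
def gen₂ : (g : Gen₂) → (ev A B g.src ⟶ ev A B g.tgt)
  | .p => M.p
  | .e => M.e
  | .t => D.t
  | .k => D.k

/-- The 2-cell denoted by a formal composite. -/
def ev₂ {t : Word} : (u : Path) → {s : Word} → Valid₂ s t u → (ev A B s ⟶ ev A B t)
  | [], _, h => eqToHom (congrArg (ev A B) h)
  | σ :: u, _, h =>
    wh (ev A B σ.l) (ev A B σ.r) (gen₂ D σ.g) ((congrArg (ev A B) h.head).trans (ev_append₃ _ _ _ _ _))
      (ev_append₃ _ _ _ _ _) ≫ ev₂ u h.tail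

theorem ev₂_heq {s t s' t' : Word} {u : Path} (h : Valid₂ s t u) (h' : Valid₂ s' t' u)
    (hs : s = s') (ht : t = t') : HEq (ev₂ D u h) (ev₂ D u h') := by
  subst hs ht; rfl

theorem ev₂_cons {s m t : Word} (σ : Step) (u : Path) (h : Valid₂ s t (σ :: u))
    (hm : m = σ.l ++ (σ.g.tgt ++ σ.r)) (hu : Valid₂ m t u) (h₁ h₂) :
    ev₂ D (σ :: u) h = wh (t := ev A B m) (ev A B σ.l) (ev A B σ.r) (gen₂ D σ.g) h₁ h₂ ≫ ev₂ D u hu := by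
  subst hm; rfl

theorem ev₂_append {s m t : Word} {u v : Path} (hu : Valid₂ s m u) (hv : Valid₂ m t v)
    (huv : Valid₂ s t (u ++ v)) : ev₂ D (u ++ v) huv = ev₂ D u hu ≫ ev₂ D v hv := by
  induction u generalizing s with
  | nil => cases hu; simp [ev₂]
  | cons σ u ih =>
    refine (ev₂_cons D σ (u ++ v) huv rfl (hu.tail.append hv) (by rw [hu.head, ev_append₃])
      (ev_append₃ _ _ _ _ _)).trans ?_
    rw [ih hu.tail]
    exact (Category.assoc _ _ _).symm

theorem wh_congr {W X Y Z : C} {l l₁ : Y ⟶ Z} {r r₁ : W ⟶ X} {f g : X ⟶ Y}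
    {θ θ' : f ⟶ g} {s t : W ⟶ Z} {hs : s = l ⊙ f ⊙ r} {ht : t = l ⊙ g ⊙ r}
    {hs₁ : s = l₁ ⊙ f ⊙ r₁} {ht₁ : t = l₁ ⊙ g ⊙ r₁} (hl : l = l₁) (hr : r = r₁) (hθ : θ = θ') :
    wh l r θ hs ht = wh l₁ r₁ θ' hs₁ ht₁ := by
  subst hl hr hθ; rfl

theorem wh_comp' {W X Y Z : C} (l : Y ⟶ Z) (r : W ⟶ X) {f g h : X ⟶ Y} (θ : f ⟶ g) (φ : g ⟶ h)
    {s m t : W ⟶ Z} (hs : s = l ⊙ f ⊙ r) (hm : m = l ⊙ g ⊙ r) (ht : t = l ⊙ h ⊙ r) :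
    wh l r (θ ≫ φ) hs ht = wh l r θ hs hm ≫ wh l r φ hm ht := by
  subst hm; exact wh_comp _ _ _ _ _ _

/-- Whiskering by 1-cells is strictly functorial on 2-cells, so it may be performed on each step of
a path separately. -/
theorem ev₂_whisk (l r : Word) {s t : Word} {u : Path} (hu : Valid₂ s t u)
    (hu' : Valid₂ (l ++ (s ++ r)) (l ++ (t ++ r)) (whisk l r u)) (hs ht) :
    ev₂ D (whisk l r u) hu' = wh (ev A B l) (ev A B r) (ev₂ D u hu) hs ht := by
  induction u generalizing s with
  | nil =>
    cases hu
    simp only [ev₂, eqToHom_refl, wh_id]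
    exact rfl
  | cons σ u ih =>
    have h₂ := hu.tail.whisk l r
    refine (ev₂_cons D (σ.whisk l r) (whisk l r u) hu' (by simp [Step.whisk]) h₂
      (by rw [hu.head]; simp [Step.whisk, ev_append])
      (by simp only [Step.whisk, ev_append, Category.assoc])).trans ?_
    rw [ev₂, wh_comp' _ _ _ _ _ (ev_append₃ _ _ _ _ _), wh_wh,
      ih hu.tail h₂ (ev_append₃ _ _ _ _ _)]
    congr 1
    exact wh_congr (ev_append _ _ _ _) (ev_append _ _ _ _) rfl

theorem comp_wh_one {X Y : C} {f g h : X ⟶ Y} (φ : f ⟶ g) (θ : g ⟶ h) (hs : g = 𝟙 Y ⊙ g ⊙ 𝟙 X)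
    (ht : h = 𝟙 Y ⊙ h ⊙ 𝟙 X) : φ ≫ wh (𝟙 Y) (𝟙 X) θ hs ht ≫ 𝟙 h = φ ≫ θ := by
  rw [wh_one, Category.comp_id]

/-- The two composites related by the interchange, as composites of whiskered 2-cells. -/
theorem pre₂_comp_post₂_eq {X Y Z W : C} {g g' : Y ⟶ Z} {f f' : W ⟶ X} (φ : g ⟶ g') (m : X ⟶ Y)
    (θ : f ⟶ f') {l₁ r₁ l₂ r₂} {s n t t' : W ⟶ Z} {hs hn hn' ht} (h₁ : l₁ = 𝟙 Z) (h₂ : r₁ = m ⊙ f)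
    (h₃ : l₂ = g' ⊙ m) (h₄ : r₂ = 𝟙 W)
    (h : t = t') (hs' ht') :
    (wh l₁ r₁ φ hs hn : s ⟶ n) ≫ (wh l₂ r₂ θ hn' ht : n ⟶ t) ≫ eqToHom h =
      𝟙 s ≫ wh (𝟙 Z) (𝟙 W) (pre₂ φ (m ⊙ f) ≫ post₂ g' (post₂ m θ)) hs' ht' ≫ 𝟙 t' := by
  subst h₁ h₂ h₃ h₄ h
  rw [eqToHom_refl, Category.id_comp, Category.comp_id, Category.comp_id,
    wh_comp' _ _ _ _ _ (show n = 𝟙 Z ⊙ (g' ⊙ m ⊙ f) ⊙ 𝟙 W by rw [hn]; simp), pre₂_eq_wh, post₂_eq_wh,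
    post₂_eq_wh, wh_wh, wh_wh, wh_wh]
  congr 1 <;> exact wh_congr (by simp) (by simp) rfl

theorem post₂_comp_pre₂_eq {X Y Z W : C} {g g' : Y ⟶ Z} {f f' : W ⟶ X} (φ : g ⟶ g') (m : X ⟶ Y)
    (θ : f ⟶ f') {l₁ r₁ l₂ r₂} {s n t t' : W ⟶ Z} {hs hn hn' ht} (h₁ : l₁ = 𝟙 Z) (h₂ : r₁ = m ⊙ f')
    (h₃ : l₂ = g ⊙ m) (h₄ : r₂ = 𝟙 W)
    (h : t = t') (hs' ht') :
    (wh l₂ r₂ θ hs hn : s ⟶ n) ≫ (wh l₁ r₁ φ hn' ht : n ⟶ t) ≫ eqToHom h =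
      𝟙 s ≫ wh (𝟙 Z) (𝟙 W) (post₂ g (post₂ m θ) ≫ pre₂ φ (m ⊙ f')) hs' ht' ≫ 𝟙 t' := by
  subst h₁ h₂ h₃ h₄ h
  rw [eqToHom_refl, Category.id_comp, Category.comp_id, Category.comp_id,
    wh_comp' _ _ _ _ _ (show n = 𝟙 Z ⊙ (g ⊙ m ⊙ f') ⊙ 𝟙 W by rw [hn]; simp), pre₂_eq_wh, post₂_eq_wh,
    post₂_eq_wh, wh_wh, wh_wh, wh_wh]
  congr 1 <;> exact wh_congr (by simp) (by simp) rfl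

/-- The 3-cell denoted by a generator. -/
def gen₃ : (Γ : Gen₃) → (ev₂ D Γ.dom Γ.dom_valid ⟶ ev₂ D Γ.cod Γ.cod_valid)
  -- The casts absorb the identity with which `ev₂` ends every nonempty path and the trivial
  -- whiskering of a generator that stands alone.
  | .α => eqToHom (comp_wh_one (wh (𝟙 X) B M.p : B⊙B⊙B ⟶ B⊙B) M.p _ _) ≫ M.α ≫
      eqToHom (comp_wh_one (wh B (𝟙 X) M.p : B⊙B⊙B ⟶ B⊙B) M.p _ _).symm
  | .lam => eqToHom (comp_wh_one (wh (𝟙 X) B M.e : B ⟶ B⊙B) M.p _ _) ≫ M.lam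
  | .rho => M.rho ≫ eqToHom (comp_wh_one (wh B (𝟙 X) M.e : B ⟶ B⊙B) M.p _ _).symm
  | .ν => eqToHom (congrArg ((wh (𝟙 X) (B⊙A) D.t : A⊙B⊙A⊙B⊙A ⟶ A⊙B⊙B⊙A) ≫ ·)
        (comp_wh_one (wh A A M.p : A⊙B⊙B⊙A ⟶ A⊙B⊙A) D.t _ _)) ≫ D.ν ≫
      eqToHom (congrArg (fun f => (wh (A⊙B) (𝟙 X) D.t : A⊙B⊙A⊙B⊙A ⟶ A⊙B⊙A⊙B) ≫
        (wh (𝟙 X) B D.t : _ ⟶ A⊙B⊙B) ≫ f)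
        (Category.comp_id (wh A (𝟙 X) M.p : A⊙B⊙B ⟶ A⊙B)).symm)
  | .ν₀ => eqToHom (comp_wh_one (wh (𝟙 X) A D.k : A ⟶ A⊙B⊙A) D.t _ _) ≫ D.ν₀ ≫
      eqToHom (Category.comp_id (wh A (𝟙 X) M.e : A ⟶ A⊙B)).symm
  | .κ => D.κ ≫ eqToHom (congrArg (fun f => (wh (A⊙B) (𝟙 X) D.k : A⊙B ⟶ A⊙B⊙A⊙B) ≫
        (wh (𝟙 X) B D.t : _ ⟶ A⊙B⊙B) ≫ f)
        (Category.comp_id (wh A (𝟙 X) M.p : A⊙B⊙B ⟶ A⊙B)).symm)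
  | .swap φ m θ => paste (𝟙 _) (𝟙 X) (𝟙 X)
      (interchange (gen₂ D φ) (post₂ (ev A B m) (gen₂ D θ))).hom (𝟙 _)
      (by simp [Gen₃.src, ev_append]) (by simp [Gen₃.tgt, ev_append])
      (pre₂_comp_post₂_eq _ _ _ rfl (ev_append _ _ _ _) (ev_append _ _ _ _) rfl
        (congrArg _ (by simp [Gen₃.tgt])) _ _)
      (post₂_comp_pre₂_eq _ _ _ rfl (ev_append _ _ _ _) (ev_append _ _ _ _) rfl
        (congrArg _ (by simp [Gen₃.tgt])) _ _)
  | .unswap φ m θ => paste (𝟙 _) (𝟙 X) (𝟙 X)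
      (interchange (gen₂ D φ) (post₂ (ev A B m) (gen₂ D θ))).inv (𝟙 _)
      (by simp [Gen₃.src, ev_append]) (by simp [Gen₃.tgt, ev_append])
      (post₂_comp_pre₂_eq (gen₂ D φ) (ev A B m) (gen₂ D θ) rfl (ev_append _ _ _ _)
        (ev_append _ _ _ _) rfl (congrArg _ (by simp [Gen₃.tgt])) _ _)
      (pre₂_comp_post₂_eq (gen₂ D φ) (ev A B m) (gen₂ D θ) rfl (ev_append _ _ _ _)
        (ev_append _ _ _ _) rfl (congrArg _ (by simp [Gen₃.tgt])) _ _)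

theorem ev₂_dom {s t : Word} (m : Move) (h : m.Valid s t) {x : Path} (hx : Valid₂ s t x)
    (hm : x = m.dom) (hs ht) : ev₂ D x hx = ev₂ D m.S h.left ≫
      wh (ev A B m.l) (ev A B m.r) (ev₂ D m.Γ.dom m.Γ.dom_valid) hs ht ≫ ev₂ D m.T h.right := by
  subst hm
  have h' := m.Γ.dom_valid.whisk m.l m.r
  refine (ev₂_append D h.left (h'.append h.right) _).trans ?_
  rw [ev₂_append D h' h.right, ev₂_whisk]

theorem ev₂_cod {s t : Word} (m : Move) (h : m.Valid s t) {x : Path} (hx : Valid₂ s t x)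
    (hm : x = m.cod) (hs ht) : ev₂ D x hx = ev₂ D m.S h.left ≫
      wh (ev A B m.l) (ev A B m.r) (ev₂ D m.Γ.cod m.Γ.cod_valid) hs ht ≫ ev₂ D m.T h.right := by
  subst hm
  have h' := m.Γ.cod_valid.whisk m.l m.r
  refine (ev₂_append D h.left (h'.append h.right) _).trans ?_
  rw [ev₂_append D h' h.right, ev₂_whisk]

/-- The 3-cell denoted by a move. -/
def Move.ev₃ {s t : Word} (m : Move) (h : m.Valid s t) {x y : Path} (hx : Valid₂ s t x)
    (hy : Valid₂ s t y) (hxm : x = m.dom) (hym : y = m.cod) : ev₂ D x hx ⟶ ev₂ D y hy :=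
  paste (ev₂ D m.S h.left) (ev A B m.l) (ev A B m.r) (gen₃ D m.Γ) (ev₂ D m.T h.right)
    (ev_append₃ _ _ _ _ _) (ev_append₃ _ _ _ _ _) (ev₂_dom D m h hx hxm _ _)
    (ev₂_cod D m h hy hym _ _)

/-- The 3-cell denoted by a formal composite. -/
def ev₃ {s t : Word} {y : Path} : (c : List Move) → {x : Path} → (hx : Valid₂ s t x) →
    (hy : Valid₂ s t y) → Valid₃ s t x y c → (ev₂ D x hx ⟶ ev₂ D y hy)
  | [], _, _, _, h => eqToHom (by cases h; rfl)
  | m :: c, _, hx, hy, h => m.ev₃ D h.head hx h.head.cod h.head_dom rfl ≫ ev₃ c h.head.cod hy h.tail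

theorem ev₃_append {s t : Word} {x y z : Path} (c d : List Move) (hx : Valid₂ s t x)
    (hy : Valid₂ s t y) (hz : Valid₂ s t z) (hc : Valid₃ s t x y c) (hd : Valid₃ s t y z d)
    (hcd : Valid₃ s t x z (c ++ d)) :
    ev₃ D (c ++ d) hx hz hcd = ev₃ D c hx hy hc ≫ ev₃ D d hy hz hd := by
  induction c generalizing x with
  | nil => cases hc; simp [ev₃]
  | cons m c ih =>
    rw [ev₃, Category.assoc, ← ih _ hc.tail (hc.tail.append hd)]
    rfl

theorem ev₃_cons {s t : Word} {x x' y : Path} (m : Move) (c : List Move) (hx : Valid₂ s t x)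
    (hx' : Valid₂ s t x') (hy : Valid₂ s t y) (h : Valid₃ s t x y (m :: c)) (hd : x = m.dom)
    (hm : x' = m.cod) (hc : Valid₃ s t x' y c) :
    ev₃ D (m :: c) hx hy h = m.ev₃ D h.head hx hx' hd hm ≫ ev₃ D c hx' hy hc := by
  subst hm; rfl

/-- `paste_comp` splits off the first move, and `paste_paste` merges the context of that move with
the outer one. This is what allows an equality of formal 3-cells to be used inside a larger diagram.
-/
theorem ev₃_ctx {s t s' t' : Word} {x y S T : Path} {l r : Word} (c : List Move)
    (hx : Valid₂ s t x) (hy : Valid₂ s t y) (hc : Valid₃ s t x y c)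
    (hS : Valid₂ s' (l ++ (s ++ r)) S) (hT : Valid₂ (l ++ (t ++ r)) t' T)
    (hx' : Valid₂ s' t' (S ++ (whisk l r x ++ T))) (hy' : Valid₂ s' t' (S ++ (whisk l r y ++ T)))
    (hc' : Valid₃ s' t' (S ++ (whisk l r x ++ T)) (S ++ (whisk l r y ++ T)) (ctx S l r T c))
    (h₁ h₂ h₃ h₄) :
    ev₃ D (ctx S l r T c) hx' hy' hc' =
      paste (ev₂ D S hS) (ev A B l) (ev A B r) (ev₃ D c hx hy hc) (ev₂ D T hT) h₁ h₂ h₃ h₄ := by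
  induction c generalizing x with
  | nil =>
    cases hc
    simp only [ev₃, eqToHom_refl]
    rw [paste_id]
    rfl
  | cons m c ih =>
    have hm' : Valid₂ s' t' (S ++ (whisk l r m.cod ++ T)) :=
      hS.append ((hc.head.cod.whisk l r).append hT)
    have h₅ : ev₂ D _ hm' = ev₂ D S hS ≫ wh (ev A B l) (ev A B r) (ev₂ D _ hc.head.cod)
        (ev_append₃ _ _ _ _ _) (ev_append₃ _ _ _ _ _) ≫ ev₂ D T hT := by
      rw [ev₂_append D hS ((hc.head.cod.whisk l r).append hT),
        ev₂_append D (hc.head.cod.whisk l r) hT, ev₂_whisk]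
    refine (ev₃_cons D (m.ctx S l r T) (ctx S l r T c) hx' hm' hy' hc'
      (by rw [Move.dom_ctx, hc.head_dom]) (by rw [Move.cod_ctx])
      (hc.tail.ctx hS hT)).trans ?_
    refine Eq.trans ?_ (paste_comp _ _ _ (m.ev₃ D hc.head hx hc.head.cod hc.head_dom rfl)
      (ev₃ D c hc.head.cod hy hc.tail) _ h₁ h₂ h₃ h₅ h₄).symm
    rw [ih hc.head.cod hc.tail hm' (hc.tail.ctx hS hT) h₅]
    refine congrArg (· ≫ _) (eq_of_heq ?_)
    unfold Move.ev₃
    have e₁ := hc.head.left.whisk l r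
    have e₂ := hc.head.right.whisk l r
    have k : ∀ w : Word, ev A B (l ++ ((m.l ++ (w ++ m.r)) ++ r)) =
      (ev A B l ⊙ ev A B m.l) ⊙ ev A B w ⊙ ev A B m.r ⊙ ev A B r := fun w => by simp [ev_append]
    have hm := hc.head
    refine HEq.trans ?_ (heq_of_eq (paste_paste _ _ _ _ _ _ _ _ _ _ _ _ _ _ _ _ _
      (ev_append₃ _ _ _ _ _) (ev_append₃ _ _ _ _ _) (k _) (k _)
      (paste_boundary (ev₂_dom D m hm hx hc.head_dom (ev_append₃ _ _ _ _ _) (ev_append₃ _ _ _ _ _))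
        h₃ _ _ _ _)
      (paste_boundary (ev₂_cod D m hm hm.cod rfl (ev_append₃ _ _ _ _ _) (ev_append₃ _ _ _ _ _))
        h₅ _ _ _ _)).symm)
    refine heq_paste rfl rfl rfl rfl (ev_append _ _ _ _) (ev_append _ _ _ _) ?_ ?_
      HEq.rfl HEq.rfl HEq.rfl
    · refine (ev₂_heq D _ (hS.append e₁) rfl (by simp [Move.ctx])).trans (heq_of_eq ?_)
      rw [ev₂_append D hS e₁, ev₂_whisk]
    · refine (ev₂_heq D _ (e₂.append hT) (by simp [Move.ctx]) rfl).trans (heq_of_eq ?_)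
      rw [ev₂_append D e₂ hT, ev₂_whisk]

/-! ### Cells denoted by formal composites, up to equality of boundaries -/

/-- The 2-cell `θ` is denoted by the formal composite `x` from `s` to `t`. -/
structure Rep₂ {a b : X ⟶ X} (θ : a ⟶ b) (s t : Word) (x : Path) : Prop where
  valid : Valid₂ s t x
  src : a = ev A B s
  tgt : b = ev A B t
  heq : HEq θ (ev₂ D x valid)

/-- The 3-cell `Γ` is denoted by the formal composite `c`. -/
structure Rep₃ {a b : X ⟶ X} {θ φ : a ⟶ b} (Γ : θ ⟶ φ) (s t : Word) (x y : Path)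
    (c : List Move) : Prop where
  dom : Rep₂ D θ s t x
  cod : Rep₂ D φ s t y
  valid : Valid₃ s t x y c
  heq : HEq Γ (ev₃ D c dom.valid cod.valid valid)

/-- The formal 3-cells `c` and `c'` denote the same 3-cell. -/
structure Eqv (s t : Word) (x y : Path) (c c' : List Move) : Prop where
  dom : Valid₂ s t x
  cod : Valid₂ s t y
  left : Valid₃ s t x y c
  right : Valid₃ s t x y c'
  eq : ev₃ D c dom cod left = ev₃ D c' dom cod right

variable {D} {s t s' t' m : Word} {x y z S T : Path} {c d c' d' : List Move}

section Rep₂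

variable {a b b' : X ⟶ X} {θ : a ⟶ b} {φ : b ⟶ b'}

theorem Rep₂.ev₂ (h : Valid₂ s t x) : Rep₂ D (ev₂ D x h) s t x := ⟨h, rfl, rfl, HEq.rfl⟩

theorem Rep₂.cast (h : Rep₂ D θ s t x) (hs : s = s') (ht : t = t') (hx : x = y) :
    Rep₂ D θ s' t' y := by
  subst hs ht hx; exact h

theorem Rep₂.heq_of {a' b' : X ⟶ X} {θ' : a' ⟶ b'} (h : Rep₂ D θ s t x) (h' : Rep₂ D θ' s t x) :
    HEq θ θ' := h.heq.trans h'.heq.symm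

theorem Rep₂.eqToHom (h : a = b) (ha : a = ev A B s) : Rep₂ D (eqToHom h) s s [] := by
  subst h ha; exact ⟨rfl, rfl, rfl, by simp [Diagram.ev₂]⟩

theorem Rep₂.id (ha : a = ev A B s) : Rep₂ D (𝟙 a) s s [] := Rep₂.eqToHom rfl ha

theorem Rep₂.comp (h : Rep₂ D θ s m x) (h' : Rep₂ D φ m t y) : Rep₂ D (θ ≫ φ) s t (x ++ y) := by
  refine ⟨h.valid.append h'.valid, h.src, h'.tgt, ?_⟩
  rw [ev₂_append D h.valid h'.valid]
  exact heq_comp h.src h.tgt h'.tgt h.heq h'.heq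

theorem Rep₂.wh {l r a' b' : X ⟶ X} {l' r' : Word} (h : Rep₂ D θ s t x) (hl : l = ev A B l')
    (hr : r = ev A B r') (hs : a' = l ⊙ a ⊙ r) (ht : b' = l ⊙ b ⊙ r) :
    Rep₂ D (wh l r θ hs ht) (l' ++ (s ++ r')) (l' ++ (t ++ r')) (whisk l' r' x) := by
  obtain ⟨hx, ha, hb, hθ⟩ := h
  subst hl hr ha hb hs ht
  cases hθ
  refine ⟨hx.whisk _ _, (ev_append₃ _ _ _ _ _).symm, (ev_append₃ _ _ _ _ _).symm, ?_⟩
  rw [ev₂_whisk D l' r' hx (hx.whisk _ _) (ev_append₃ _ _ _ _ _) (ev_append₃ _ _ _ _ _)]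
  exact (wh_heq _ _ _ _ _).trans (wh_heq _ _ _ _ _).symm

theorem Rep₂.post₂ {l : X ⟶ X} {l' : Word} (h : Rep₂ D θ s t x) (hl : l = ev A B l') :
    Rep₂ D (post₂ l θ) (l' ++ s) (l' ++ t) (whisk l' [] x) := by
  rw [post₂_eq_wh]
  exact (h.wh (r' := []) hl rfl _ _).cast (by simp) (by simp) rfl

theorem Rep₂.pre₂ {r : X ⟶ X} {r' : Word} (h : Rep₂ D θ s t x) (hr : r = ev A B r') :
    Rep₂ D (pre₂ θ r) (s ++ r') (t ++ r') (whisk [] r' x) := by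
  rw [pre₂_eq_wh]
  exact h.wh (l' := []) rfl hr _ _

theorem Rep₂.gen (g : Gen₂) : Rep₂ D (gen₂ D g) g.src g.tgt [⟨[], g, []⟩] := by
  have h : Valid₂ g.src g.tgt [⟨[], g, []⟩] := ⟨by simp, show _ = _ by simp⟩
  refine ⟨h, rfl, rfl, ?_⟩
  exact (heq_comp_eqToHom (wh_one_heq rfl rfl)).symm

end Rep₂

section Rep₃

variable {a b b' : X ⟶ X} {θ φ ψ : a ⟶ b} {Γ : θ ⟶ φ} {Ξ : φ ⟶ ψ}

theorem Rep₃.cast (h : Rep₃ D Γ s t x y c) (hs : s = s') (ht : t = t') {x' y' : Path} (hx : x = x')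
    (hy : y = y') (hc : c = c') : Rep₃ D Γ s' t' x' y' c' := by
  subst hs ht hx hy hc; exact h

theorem Rep₃.ev₃ (hx : Valid₂ s t x) (hy : Valid₂ s t y) (hc : Valid₃ s t x y c) :
    Rep₃ D (ev₃ D c hx hy hc) s t x y c := ⟨.ev₂ hx, .ev₂ hy, hc, HEq.rfl⟩

theorem Rep₃.congr {a' b' : X ⟶ X} {θ' φ' : a' ⟶ b'} {Γ' : θ' ⟶ φ'} (h : Rep₃ D Γ s t x y c)
    (hθ : Rep₂ D θ' s t x) (hφ : Rep₂ D φ' s t y) (hΓ : HEq Γ' Γ) : Rep₃ D Γ' s t x y c :=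
  ⟨hθ, hφ, h.valid, hΓ.trans h.heq⟩

theorem Rep₃.eqToHom (h : θ = φ) (hθ : Rep₂ D θ s t x) : Rep₃ D (eqToHom h) s t x x [] := by
  subst h
  obtain ⟨hx, ha, hb, hθ⟩ := hθ
  subst ha hb; cases hθ
  exact ⟨.ev₂ hx, .ev₂ hx, rfl, by simp [Diagram.ev₃]⟩

theorem Rep₃.comp (h : Rep₃ D Γ s t x y c) (h' : Rep₃ D Ξ s t y z d) :
    Rep₃ D (Γ ≫ Ξ) s t x z (c ++ d) := by
  refine ⟨h.dom, h'.cod, h.valid.append h'.valid, ?_⟩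
  rw [ev₃_append D c d h.dom.valid h.cod.valid h'.cod.valid h.valid h'.valid]
  exact heq_comp₃ h.dom.src h.dom.tgt h.dom.heq h.cod.heq h'.cod.heq h.heq h'.heq

theorem Rep₃.paste {s₀ t₀ l' r' : Word} {a₁ a₂ b₁ b₂ l r : X ⟶ X} {S₁ : a₁ ⟶ a₂} {T₁ : b₁ ⟶ b₂}
    {θ' φ' : a₁ ⟶ b₂} (h : Rep₃ D Γ s₀ t₀ x y c) (hS : Rep₂ D S₁ s (l' ++ (s₀ ++ r')) S)
    (hl : l = ev A B l') (hr : r = ev A B r') (hT : Rep₂ D T₁ (l' ++ (t₀ ++ r')) t T)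
    (h₁ : a₂ = l ⊙ a ⊙ r) (h₂ : b₁ = l ⊙ b ⊙ r) (h₃ : θ' = S₁ ≫ GrayCategory.wh l r θ h₁ h₂ ≫ T₁)
    (h₄ : φ' = S₁ ≫ GrayCategory.wh l r φ h₁ h₂ ≫ T₁) :
    Rep₃ D (paste S₁ l r Γ T₁ h₁ h₂ h₃ h₄) s t (S ++ (whisk l' r' x ++ T))
      (S ++ (whisk l' r' y ++ T)) (ctx S l' r' T c) := by
  have hθ : Rep₂ D θ' s t (S ++ (whisk l' r' x ++ T)) := by
    rw [h₃]; exact hS.comp ((h.dom.wh hl hr _ _).comp hT)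
  have hφ : Rep₂ D φ' s t (S ++ (whisk l' r' y ++ T)) := by
    rw [h₄]; exact hS.comp ((h.cod.wh hl hr _ _).comp hT)
  refine ⟨hθ, hφ, h.valid.ctx hS.valid hT.valid, ?_⟩
  have e : ∀ {u : Path} (hu : Valid₂ s₀ t₀ u) (hv : Valid₂ s t (S ++ (whisk l' r' u ++ T))),
      Diagram.ev₂ D _ hv = Diagram.ev₂ D S hS.valid ≫ GrayCategory.wh (ev A B l') (ev A B r')
        (Diagram.ev₂ D u hu) (ev_append₃ _ _ _ _ _) (ev_append₃ _ _ _ _ _) ≫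
          Diagram.ev₂ D T hT.valid := by
    intro u hu hv
    rw [ev₂_append D hS.valid ((hu.whisk _ _).append hT.valid),
      ev₂_append D (hu.whisk _ _) hT.valid, ev₂_whisk]
  rw [ev₃_ctx D c h.dom.valid h.cod.valid h.valid hS.valid hT.valid _ _ _ _ _ (e _ _) (e _ _)]
  have := hS.src
  have := hT.tgt
  subst a₁ b₂
  exact heq_paste rfl rfl h.dom.src h.dom.tgt hl hr hS.heq hT.heq h.dom.heq h.cod.heq h.heq

/-- A whiskering is a pasting whose remaining context is trivial, so `Rep₃.paste` provides the
denotation. The next three lemmas follow the same pattern. -/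
theorem Rep₃.whiskerLeft {S₁ : b' ⟶ a} (h : Rep₃ D Γ m t x y c) (hS : Rep₂ D S₁ s m S) :
    Rep₃ D (S₁ ◁ Γ) s t (S ++ x) (S ++ y) (ctx S [] [] [] c) := by
  have := h.paste (l' := []) (r' := []) (l := 𝟙 X) (r := 𝟙 X) (hS.cast rfl (by simp) rfl) rfl rfl
    ((Rep₂.id h.dom.tgt).cast (s' := [] ++ (t ++ [])) (by simp) rfl rfl) (by simp) (by simp) rfl rfl
  refine (this.cast rfl rfl (by simp [whisk_nil]) (by simp [whisk_nil]) rfl).congr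
    (hS.comp h.dom) (hS.comp h.cod) (HEq.symm ?_)
  refine (paste_heq _ _ _ _ _ _ _ _ _).trans ?_
  refine heq_whiskerLeft rfl rfl rfl HEq.rfl ?_ ?_ ((whiskerRight_id_heq _).trans ?_)
  · rw [wh_one]; simp
  · rw [wh_one]; simp
  · exact (wh₃_heq _ _ _ _ _).trans ((post₃_one _).trans (pre₃_one _))

theorem Rep₃.whiskerRight {T₁ : b ⟶ b'} (h : Rep₃ D Γ s m x y c) (hT : Rep₂ D T₁ m t T) :
    Rep₃ D (Γ ▷ T₁) s t (x ++ T) (y ++ T) (ctx [] [] [] T c) := by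
  have := h.paste (l' := []) (r' := []) (l := 𝟙 X) (r := 𝟙 X)
    ((Rep₂.id h.dom.src).cast (t' := [] ++ (s ++ [])) rfl (by simp) rfl) rfl rfl
    (hT.cast (by simp) rfl rfl) (by simp) (by simp) rfl rfl
  refine (this.cast rfl rfl (by simp [whisk_nil]) (by simp [whisk_nil]) rfl).congr
    (h.dom.comp hT) (h.cod.comp hT) (HEq.symm ?_)
  refine (paste_heq _ _ _ _ _ _ _ _ _).trans ((id_whiskerLeft_heq _).trans ?_)
  refine heq_whiskerRight rfl rfl rfl HEq.rfl ?_ ?_ ?_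
  · rw [wh_one]
  · rw [wh_one]
  · exact (wh₃_heq _ _ _ _ _).trans ((post₃_one _).trans (pre₃_one _))

theorem Rep₃.post₃ {l : X ⟶ X} {l' : Word} (h : Rep₃ D Γ s t x y c) (hl : l = ev A B l') :
    Rep₃ D (post₃ l Γ) (l' ++ s) (l' ++ t) (whisk l' [] x) (whisk l' [] y) (ctx [] l' [] [] c) := by
  have := h.paste (l' := l') (r' := []) (l := l) (r := 𝟙 X)
    ((Rep₂.id (a := l ⊙ a) (by rw [ev_append, h.dom.src, hl])).cast rfl (by simp) rfl) hl rfl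
    ((Rep₂.id (a := l ⊙ b) (by rw [ev_append, h.dom.tgt, hl])).cast (by simp) rfl rfl)
    (by simp) (by simp) rfl rfl
  refine (this.cast rfl rfl (by simp) (by simp) rfl).congr (h.dom.post₂ hl) (h.cod.post₂ hl)
    (HEq.symm ?_)
  refine (paste_heq _ _ _ _ _ _ _ _ _).trans ((id_whiskerLeft_heq _).trans
    ((whiskerRight_id_heq _).trans ((wh₃_heq _ _ _ _ _).trans ?_)))
  exact heq_post₃ _ (by simp) (by simp) (pre₂_one _) (pre₂_one _) (pre₃_one _)

theorem Rep₃.pre₃ {r : X ⟶ X} {r' : Word} (h : Rep₃ D Γ s t x y c) (hr : r = ev A B r') :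
    Rep₃ D (pre₃ Γ r) (s ++ r') (t ++ r') (whisk [] r' x) (whisk [] r' y) (ctx [] [] r' [] c) := by
  have := h.paste (l' := []) (r' := r') (l := 𝟙 X) (r := r)
    ((Rep₂.id (a := a ⊙ r) (by rw [ev_append, h.dom.src, hr])).cast rfl (by simp) rfl) rfl hr
    ((Rep₂.id (a := b ⊙ r) (by rw [ev_append, h.dom.tgt, hr])).cast (by simp) rfl rfl)
    (by simp) (by simp) rfl rfl
  refine (this.cast rfl rfl (by simp) (by simp) rfl).congr (h.dom.pre₂ hr) (h.cod.pre₂ hr)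
    (HEq.symm ?_)
  exact (paste_heq _ _ _ _ _ _ _ _ _).trans ((id_whiskerLeft_heq _).trans
    ((whiskerRight_id_heq _).trans ((wh₃_heq _ _ _ _ _).trans (post₃_one _))))

theorem Rep₃.gen (Γ : Gen₃) :
    Rep₃ D (gen₃ D Γ) Γ.src Γ.tgt Γ.dom Γ.cod [⟨[], [], Γ, [], []⟩] := by
  have hm : Move.Valid Γ.src Γ.tgt ⟨[], [], Γ, [], []⟩ := ⟨show _ = _ by simp, show _ = _ by simp⟩
  have hd : Γ.dom = Move.dom ⟨[], [], Γ, [], []⟩ := by simp [Move.dom, whisk_nil]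
  have hc : Γ.cod = Move.cod ⟨[], [], Γ, [], []⟩ := by simp [Move.cod, whisk_nil]
  refine ⟨.ev₂ Γ.dom_valid, .ev₂ Γ.cod_valid, ⟨hm, hd, hc.symm⟩, ?_⟩
  rw [ev₃_cons D _ [] Γ.dom_valid Γ.cod_valid Γ.cod_valid ⟨hm, hd, hc.symm⟩ hd hc rfl]
  simp only [Diagram.ev₃, eqToHom_refl, Category.comp_id, Move.ev₃]
  refine HEq.symm ((heq_paste (S' := 𝟙 _) (T' := 𝟙 _) (l' := 𝟙 X) (r' := 𝟙 X) (hb' := by simp)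
    (hc' := by simp) (hx' := rfl) (hy' := rfl) rfl rfl rfl rfl rfl rfl ?_ ?_ HEq.rfl HEq.rfl
      HEq.rfl).trans ?_)
  · exact heq_eqToHom (h' := rfl) rfl
  · exact heq_eqToHom (h' := rfl) (show ev A B ([] ++ (Γ.tgt ++ [])) = ev A B Γ.tgt by simp)
  · exact (paste_heq _ _ _ _ _ _ _ _ _).trans ((id_whiskerLeft_heq _).trans
      ((whiskerRight_id_heq _).trans ((wh₃_heq _ _ _ _ _).trans
        ((post₃_one _).trans (pre₃_one _)))))

end Rep₃

/-- Equations enter the calculus here: one 3-cell denoted in two ways gives an equivalence of formal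
3-cells. `Eqv.eq_of_rep` is the way back to cells. -/
theorem Rep₃.eqv {a b : X ⟶ X} {θ φ : a ⟶ b} {Γ : θ ⟶ φ} (h : Rep₃ D Γ s t x y c)
    (h' : Rep₃ D Γ s t x y c') : Eqv D s t x y c c' :=
  ⟨h.dom.valid, h.cod.valid, h.valid, h'.valid, eq_of_heq (h.heq.symm.trans h'.heq)⟩

namespace Eqv

theorem eq_of_rep {a b : X ⟶ X} {θ φ : a ⟶ b} {Γ Γ' : θ ⟶ φ} (h : Eqv D s t x y c c')
    (hc : Rep₃ D Γ s t x y c) (hc' : Rep₃ D Γ' s t x y c') : Γ = Γ' :=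
  eq_of_heq (hc.heq.trans ((heq_of_eq h.eq).trans hc'.heq.symm))

theorem refl (hx : Valid₂ s t x) (hc : Valid₃ s t x y c) : Eqv D s t x y c c :=
  ⟨hx, hc.cod_valid hx, hc, hc, rfl⟩

theorem symm (h : Eqv D s t x y c d) : Eqv D s t x y d c :=
  ⟨h.dom, h.cod, h.right, h.left, h.eq.symm⟩

theorem trans (h : Eqv D s t x y c d) (h' : Eqv D s t x y d c') : Eqv D s t x y c c' :=
  ⟨h.dom, h.cod, h.left, h'.right, h.eq.trans h'.eq⟩

theorem append (h : Eqv D s t x y c c') (h' : Eqv D s t y z d d') :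
    Eqv D s t x z (c ++ d) (c' ++ d') :=
  ⟨h.dom, h'.cod, h.left.append h'.left, h.right.append h'.right, by
    rw [ev₃_append D c d h.dom h.cod h'.cod h.left h'.left,
      ev₃_append D c' d' h.dom h.cod h'.cod h.right h'.right, h.eq, h'.eq]⟩

theorem ctx {l r : Word} (h : Eqv D s t x y c c') (hS : Valid₂ s' (l ++ (s ++ r)) S)
    (hT : Valid₂ (l ++ (t ++ r)) t' T) :
    Eqv D s' t' (S ++ (whisk l r x ++ T)) (S ++ (whisk l r y ++ T)) (ctx S l r T c)
      (ctx S l r T c') := by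
  have key := (Rep₃.ev₃ (D := D) h.dom h.cod h.left).paste (.ev₂ hS) rfl rfl (.ev₂ hT)
    (ev_append₃ _ _ _ _ _) (ev_append₃ _ _ _ _ _) rfl rfl
  have key' := (Rep₃.ev₃ (D := D) h.dom h.cod h.right).paste (.ev₂ hS) rfl rfl (.ev₂ hT)
    (ev_append₃ _ _ _ _ _) (ev_append₃ _ _ _ _ _) rfl rfl
  rw [← h.eq] at key'
  exact key.eqv key'

end Eqv

/-! ### Interchange of composites -/

/-- The interchange of `u`, on the left, with the single step `σ` on the right. -/
def swapStep (σ : Step) : Path → List Move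
  | [] => []
  | ⟨l, g, r⟩ :: u =>
    ctx [⟨l, g, r ++ (σ.l ++ (σ.g.src ++ σ.r))⟩] [] [] [] (swapStep σ u) ++
      [⟨[], l, .swap g (r ++ σ.l) σ.g, σ.r, whisk [] (σ.l ++ (σ.g.tgt ++ σ.r)) u⟩]

/-- The interchange of `u`, from `s` to `t`, on the left, with `v` on the right. -/
def swaps (s t : Word) (u : Path) : Path → List Move
  | [] => []
  | σ :: v => ctx [] [] [] (whisk t [] v) (swapStep σ u) ++
      ctx [σ.whisk s []] [] [] [] (swaps s t u v)

theorem heq_interchange {X Y Z : C} {g₁ g₂ g₁' g₂' : Y ⟶ Z} {f₁ f₂ f₁' f₂' : X ⟶ Y} {φ : g₁ ⟶ g₂}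
    {φ' : g₁' ⟶ g₂'} {θ : f₁ ⟶ f₂} {θ' : f₁' ⟶ f₂'} (hg₁ : g₁ = g₁') (hg₂ : g₂ = g₂')
    (hf₁ : f₁ = f₁') (hf₂ : f₂ = f₂') (hφ : HEq φ φ') (hθ : HEq θ θ') :
    HEq (interchange φ θ).hom (interchange φ' θ').hom ∧
      HEq (interchange φ θ).inv (interchange φ' θ').inv := by
  subst hg₁ hg₂ hf₁ hf₂; cases hφ; cases hθ; exact ⟨HEq.rfl, HEq.rfl⟩

/-- The outer 1-cells come out by `interchange_post` and `interchange_pre`, while the inner ones `r`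
and `l'` are gathered between the two cells by `interchange_mid`. Hence a generator `swap` with
middle word suffices. -/
theorem interchange_wh {V W X Y Z U : C} (l : Z ⟶ U) (r : X ⟶ Y) (l' : W ⟶ X) {V' : C}
    (r' : V ⟶ V') {f g : Y ⟶ Z} {f' g' : V' ⟶ W} (φ : f ⟶ g) (θ : f' ⟶ g') {s t : X ⟶ U}
    {s' t' : V ⟶ X} (hs : s = l ⊙ f ⊙ r) (ht : t = l ⊙ g ⊙ r) (hs' : s' = l' ⊙ f' ⊙ r')
    (ht' : t' = l' ⊙ g' ⊙ r') :
    HEq (interchange (wh l r φ hs ht) (wh l' r' θ hs' ht')).hom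
      (post₃ l (pre₃ (interchange φ (post₂ (r ⊙ l') θ)).hom r')) := by
  have e : HEq (post₂ r (post₂ l' (pre₂ θ r'))) (pre₂ (post₂ (r ⊙ l') θ) r') :=
    (post₂_mul _ _ _).symm.trans (post₂_pre₂ _ _ _)
  refine (heq_interchange hs ht hs' ht' (wh_heq _ _ _ _ _) (wh_heq _ _ _ _ _)).1.trans ?_
  refine (interchange_post _ _ _).trans ?_
  have e₁ : HEq (interchange (pre₂ φ r) (post₂ l' (pre₂ θ r'))).hom
      (pre₃ (interchange φ (post₂ (r ⊙ l') θ)).hom r') := by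
    refine (interchange_mid _ _ _).trans (HEq.trans ?_ (interchange_pre _ _ _))
    exact (heq_interchange rfl rfl (by simp) (by simp) HEq.rfl e).1
  have p₁ : ∀ k : Y ⟶ Z, HEq (post₂ (k ⊙ r) (post₂ l' (pre₂ θ r')))
      (pre₂ (post₂ k (post₂ (r ⊙ l') θ)) r') := fun k =>
    (post₂_mul _ _ _).trans ((heq_post₂ _ (by simp) (by simp) e).trans (post₂_pre₂ _ _ _))
  have p₂ : ∀ k : V' ⟶ W, HEq (pre₂ (pre₂ φ r) (l' ⊙ k ⊙ r'))
      (pre₂ (pre₂ φ ((r ⊙ l') ⊙ k)) r') := fun k =>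
    (pre₂_mul _ _ _).symm.trans ((congr_arg_heq (pre₂ φ) (by simp)).trans (pre₂_mul _ _ _))
  refine heq_post₃ _ (by simp) (by simp) ?_ ?_ e₁
  · rw [pre₂_comp]
    exact heq_comp (by simp) (by simp) (by simp) (p₂ _) (p₁ _)
  · rw [pre₂_comp]
    exact heq_comp (by simp) (by simp) (by simp) (p₁ _) (p₂ _)

theorem Rep₃.interchange_gen (φ θ : Gen₂) {m : Word} {n : X ⟶ X} (hn : n = ev A B m) :
    Rep₃ D (interchange (gen₂ D φ) (GrayCategory.post₂ n (gen₂ D θ))).hom (φ.src ++ (m ++ θ.src))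
      (φ.tgt ++ (m ++ θ.tgt)) (Gen₃.swap φ m θ).dom (Gen₃.swap φ m θ).cod
      [⟨[], [], .swap φ m θ, [], []⟩] := by
  subst hn
  refine (Rep₃.gen (.swap φ m θ)).congr ?_ ?_ ?_
  · exact (((Rep₂.gen φ).pre₂ (r' := m ++ θ.src) (ev_append _ _ _ _).symm).comp
      (((Rep₂.gen θ).post₂ (l' := m) rfl).post₂ (l' := φ.tgt) rfl)).cast rfl rfl
        (by simp [Gen₃.dom, whisk, Step.whisk])
  · exact ((((Rep₂.gen θ).post₂ (l' := m) rfl).post₂ (l' := φ.src) rfl).comp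
      ((Rep₂.gen φ).pre₂ (r' := m ++ θ.tgt) (ev_append _ _ _ _).symm)).cast rfl rfl
        (by simp [Gen₃.cod, whisk, Step.whisk])
  · simp only [gen₃]
    exact (paste_one_heq _ _ _ _ _ rfl rfl HEq.rfl HEq.rfl).symm

/-- The empty middle word is enough: the inverse interchanges in the warping axioms are those of `t`
with `p` and of `t` with `e`, with nothing in between. -/
theorem Rep₃.interchange_inv_gen (φ θ : Gen₂) :
    Rep₃ D (interchange (gen₂ D φ) (gen₂ D θ)).inv (φ.src ++ θ.src)
      (φ.tgt ++ θ.tgt) (Gen₃.unswap φ [] θ).dom (Gen₃.unswap φ [] θ).cod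
      [⟨[], [], .unswap φ [] θ, [], []⟩] := by
  refine (Rep₃.gen (.unswap φ [] θ)).congr ?_ ?_ ?_
  · exact (((Rep₂.gen θ).post₂ (l' := φ.src) rfl).comp
      ((Rep₂.gen φ).pre₂ (r' := θ.tgt) rfl)).cast rfl rfl
        (by simp [Gen₃.dom, whisk, Step.whisk])
  · exact (((Rep₂.gen φ).pre₂ (r' := θ.src) rfl).comp
      ((Rep₂.gen θ).post₂ (l' := φ.tgt) rfl)).cast rfl rfl
        (by simp [Gen₃.cod, whisk, Step.whisk])
  · simp only [gen₃]
    refine HEq.trans ?_ (paste_one_heq _ _ _ _ _ rfl rfl HEq.rfl HEq.rfl).symm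
    exact (heq_interchange rfl rfl (by simp) (by simp) HEq.rfl (post₂_one _).symm).2

section

variable {a b a' b' : X ⟶ X} {φ : a ⟶ b} {θ : a' ⟶ b'}

theorem Rep₃.associator {a b c d : X ⟶ X} {θ : a ⟶ b} {φ : b ⟶ c} {ψ : c ⟶ d}
    (h : Rep₂ D ((θ ≫ φ) ≫ ψ) s t x) : Rep₃ D (α_ θ φ ψ).hom s t x x [] := by
  rw [Strict.associator_eqToIso]
  exact Rep₃.eqToHom (Category.assoc _ _ _) h

theorem Rep₃.associator_inv {a b c d : X ⟶ X} {θ : a ⟶ b} {φ : b ⟶ c} {ψ : c ⟶ d}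
    (h : Rep₂ D (θ ≫ φ ≫ ψ) s t x) : Rep₃ D (α_ θ φ ψ).inv s t x x [] := by
  rw [Strict.associator_eqToIso]
  exact Rep₃.eqToHom (Category.assoc _ _ _).symm h

theorem Rep₂.interchange_dom {u v : Path} (hφ : Rep₂ D φ s t u) (hθ : Rep₂ D θ s' t' v) :
    Rep₂ D (GrayCategory.pre₂ φ a' ≫ GrayCategory.post₂ b θ) (s ++ s') (t ++ t')
      (whisk [] s' u ++ whisk t [] v) :=
  (hφ.pre₂ hθ.src).comp (hθ.post₂ hφ.tgt)

theorem Rep₂.interchange_cod {u v : Path} (hφ : Rep₂ D φ s t u) (hθ : Rep₂ D θ s' t' v) :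
    Rep₂ D (GrayCategory.post₂ a θ ≫ GrayCategory.pre₂ φ b') (s ++ s') (t ++ t')
      (whisk s [] v ++ whisk [] t' u) :=
  (hθ.post₂ hφ.src).comp (hφ.pre₂ hθ.tgt)

theorem Rep₃.interchange_step {σ τ : Step} (hφ : Rep₂ D φ s t [σ]) (hθ : Rep₂ D θ s' t' [τ]) :
    Rep₃ D (interchange φ θ).hom (s ++ s') (t ++ t')
      (whisk [] s' [σ] ++ whisk t [] [τ]) (whisk s [] [τ] ++ whisk [] t' [σ])
      [⟨[], σ.l, .swap σ.g (σ.r ++ τ.l) τ.g, τ.r, []⟩] := by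
  have hs := hφ.valid.head
  have hs' := hθ.valid.head
  have ht : σ.l ++ (σ.g.tgt ++ σ.r) = t := hφ.valid.tail
  have ht' : τ.l ++ (τ.g.tgt ++ τ.r) = t' := hθ.valid.tail
  have key := ((Rep₃.interchange_gen (D := D) σ.g τ.g (m := σ.r ++ τ.l)
    (n := ev A B σ.r ⊙ ev A B τ.l) (ev_append _ _ _ _).symm).pre₃ (r' := τ.r) rfl).post₃ (l' := σ.l) rfl
  subst hs hs' ht ht'
  refine (key.cast (by simp) (by simp) (by simp [Gen₃.dom, whisk, Step.whisk])
    (by simp [Gen₃.cod, whisk, Step.whisk]) (by simp [Diagram.ctx, Move.ctx, whisk])).congr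
    (hφ.interchange_dom hθ) (hφ.interchange_cod hθ) ?_
  refine HEq.trans (heq_interchange hφ.src hφ.tgt hθ.src hθ.tgt (hφ.heq.trans ?_)
    (hθ.heq.trans ?_)).1 (interchange_wh _ _ _ _ _ _ (ev_append₃ _ _ _ _ _) (ev_append₃ _ _ _ _ _)
      (ev_append₃ _ _ _ _ _) (ev_append₃ _ _ _ _ _))
  · exact heq_of_eq (Category.comp_id _)
  · exact heq_of_eq (Category.comp_id _)

/-- By `interchange_comp_left` the last step of `u` is the first to pass `τ`; an identity passes by
an identity, hence by no move. -/
theorem Rep₃.swapStep {u : Path} {τ : Step} (hφ : Rep₂ D φ s t u) (hθ : Rep₂ D θ s' t' [τ]) :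
    Rep₃ D (interchange φ θ).hom (s ++ s') (t ++ t')
      (whisk [] s' u ++ whisk t [] [τ]) (whisk s [] [τ] ++ whisk [] t' u) (swapStep τ u) := by
  induction u generalizing a s with
  | nil =>
    have e : s = t := hφ.valid
    subst e
    have e := hφ.src.trans hφ.tgt.symm
    subst e
    have : φ = 𝟙 a := eq_of_heq (hφ.heq_of (Rep₂.id hφ.src))
    subst this
    refine (Rep₃.eqToHom rfl (hθ.post₂ hφ.src)).congr
      ((hφ.interchange_dom hθ).cast rfl rfl (by simp [whisk]))
      ((hφ.interchange_cod hθ).cast rfl rfl (by simp [whisk]))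
      (interchange_id_left _ _)
  | cons σ u ih =>
    have v₁ := hφ.valid.head
    have v₂ := hφ.valid.tail
    have h₁ := Rep₂.ev₂ (D := D) (x := [σ]) (s := s) (t := σ.l ++ (σ.g.tgt ++ σ.r))
      ⟨v₁, rfl⟩
    have h₂ := Rep₂.ev₂ (D := D) v₂
    have ha := hφ.src
    have hb := hφ.tgt
    subst ha hb
    -- Since `φ` is known only through its path, it is replaced by the composite of the first step
    -- and the rest, to which `interchange_comp_left` applies.
    have e := eq_of_heq (hφ.heq_of (h₁.comp h₂))
    subst e
    -- The associators in `interchange_comp_left` are casts, denoted by the empty list of moves.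
    have A₁ := Rep₃.associator (((h₁.pre₂ hθ.src).comp (h₂.pre₂ hθ.src)).comp
      (hθ.post₂ (l := ev A B t) rfl))
    have A₂ := (ih h₂).whiskerLeft (h₁.pre₂ hθ.src)
    have A₃ := Rep₃.associator_inv ((h₁.pre₂ hθ.src).comp
      ((hθ.post₂ h₁.tgt).comp (h₂.pre₂ hθ.tgt)))
    have A₄ := (Rep₃.interchange_step h₁ hθ).whiskerRight (h₂.pre₂ hθ.tgt)
    have A₅ := Rep₃.associator (((hθ.post₂ h₁.src).comp (h₁.pre₂ hθ.tgt)).comp (h₂.pre₂ hθ.tgt))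
    have key := A₁.comp (A₂.comp (A₃.comp (A₄.comp A₅)))
    refine (key.cast rfl rfl rfl (by simp [whisk]) ?_).congr
      (hφ.interchange_dom hθ) (hφ.interchange_cod hθ) (interchange_comp_left _ _ _)
    have e' := hθ.valid.head
    have e'' : τ.l ++ (τ.g.tgt ++ τ.r) = t' := hθ.valid.tail
    subst e' e''
    simp [Diagram.swapStep, Diagram.ctx, Move.ctx, whisk, Step.whisk]

/-- By `interchange_comp_right` the steps of `v` pass all of `u` one after another. Interchanges
with the composite multiplication `(Ap)(tB)` are thereby reduced to interchanges of generators. -/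
theorem Rep₃.interchange {u v : Path} (hφ : Rep₂ D φ s t u) (hθ : Rep₂ D θ s' t' v) :
    Rep₃ D (interchange φ θ).hom (s ++ s') (t ++ t')
      (whisk [] s' u ++ whisk t [] v) (whisk s [] v ++ whisk [] t' u) (swaps s t u v) := by
  induction v generalizing a' s' with
  | nil =>
    have e : s' = t' := hθ.valid
    subst e
    have e := hθ.src.trans hθ.tgt.symm
    subst e
    have : θ = 𝟙 a' := eq_of_heq (hθ.heq_of (Rep₂.id hθ.src))
    subst this
    exact ((Rep₃.eqToHom rfl (hφ.pre₂ hθ.src)).congr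
      ((hφ.interchange_dom hθ).cast rfl rfl (by simp [whisk]))
      ((hφ.interchange_cod hθ).cast rfl rfl (by simp [whisk]))
      (interchange_id_right _ _)).cast rfl rfl (by simp [whisk]) rfl rfl
  | cons τ v ih =>
    have v₁ := hθ.valid.head
    have v₂ := hθ.valid.tail
    have h₁ := Rep₂.ev₂ (D := D) (x := [τ]) (s := s') (t := τ.l ++ (τ.g.tgt ++ τ.r))
      ⟨v₁, rfl⟩
    have h₂ := Rep₂.ev₂ (D := D) v₂
    have ha := hθ.src
    have hb := hθ.tgt
    subst ha hb
    have e := eq_of_heq (hθ.heq_of (h₁.comp h₂))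
    subst e
    have A₁ := Rep₃.associator_inv ((hφ.pre₂ h₁.src).comp ((h₁.post₂ hφ.tgt).comp
      (h₂.post₂ hφ.tgt)))
    have A₂ := (Rep₃.swapStep hφ h₁).whiskerRight (h₂.post₂ hφ.tgt)
    have A₃ := Rep₃.associator (((h₁.post₂ hφ.src).comp (hφ.pre₂ h₁.tgt)).comp (h₂.post₂ hφ.tgt))
    have A₄ := (ih h₂).whiskerLeft (h₁.post₂ hφ.src)
    have A₅ := Rep₃.associator_inv ((h₁.post₂ hφ.src).comp
      ((h₂.post₂ hφ.src).comp (hφ.pre₂ (r := ev A B t') rfl)))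
    have key := A₁.comp ((A₂.cast rfl rfl (by simp) rfl rfl).comp (A₃.comp ((A₄.cast rfl rfl (by simp) rfl rfl).comp A₅)))
    refine (key.cast rfl rfl (by simp [whisk]) (by simp [whisk]) ?_).congr
      (hφ.interchange_dom hθ) (hφ.interchange_cod hθ) (interchange_comp_right _ _ _)
    simp [Diagram.swaps, Diagram.ctx, whisk, Step.whisk]

end

/-! ### Calculus of formal 3-cells -/

theorem Valid₂.of_append {u v : Path} (h : Valid₂ s t (u ++ v)) (hu : Valid₂ s m u) :
    Valid₂ m t v := by
  induction u generalizing s with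
  | nil => cases hu; exact h
  | cons σ u ih => exact ih h.tail hu.tail

theorem Valid₃.of_append (h : Valid₃ s t x y (c ++ d)) :
    ∃ z, Valid₃ s t x z c ∧ Valid₃ s t z y d := by
  induction c generalizing x with
  | nil => exact ⟨x, rfl, h⟩
  | cons m c ih =>
    obtain ⟨z, hc, hd⟩ := ih h.tail
    exact ⟨z, ⟨h.head, h.head_dom, hc⟩, hd⟩

theorem Valid₃.eq_of_valid (h : Valid₃ s t x y c) (h' : Valid₃ s t x z c) : y = z := by
  induction c generalizing x with
  | nil => exact h.symm.trans h'
  | cons m c ih => exact ih h.tail h'.tail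

/-- A move records its whole codomain, so the fold ignores its accumulator and returns the codomain
of the last move, or `x` if there is none. The endpoint of a concrete list is thus found by
computation. -/
theorem Valid₃.eq_foldl (h : Valid₃ s t x y c) : y = c.foldl (fun _ m => m.cod) x := by
  induction c generalizing x with
  | nil => exact h.symm
  | cons m c ih => exact ih h.tail

theorem whisk_empty (l r : Word) : whisk l r [] = [] := rfl

theorem ctx_ctx (S' : Path) (l r : Word) (T' : Path) (l' r' : Word) :
    ctx S' l' r' T' (ctx S l r T c) =
      ctx (S' ++ whisk l' r' S) (l' ++ l) (r ++ r') (whisk l' r' T ++ T') c := by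
  simp [ctx, Move.ctx, Function.comp_def, whisk_append, whisk_whisk]

/-- The result of interchanging two consecutive moves, when they act on disjoint parts. -/
def commute (m₁ m₂ : Move) : List Move :=
  -- The length of `S` is the position at which a move acts. The first test asks that `m₂` act after
  -- everything `m₁` has produced, the second that it act before the place where `m₁` acted.
  if m₁.S.length + m₁.Γ.cod.length ≤ m₂.S.length then
    [⟨m₁.S ++ (whisk m₁.l m₁.r m₁.Γ.dom ++ m₂.S.drop (m₁.S.length + m₁.Γ.cod.length)),
        m₂.l, m₂.Γ, m₂.r, m₂.T⟩,
      ⟨m₁.S, m₁.l, m₁.Γ, m₁.r, m₂.S.drop (m₁.S.length + m₁.Γ.cod.length) ++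
        (whisk m₂.l m₂.r m₂.Γ.cod ++ m₂.T)⟩]
  else if m₂.S.length + m₂.Γ.dom.length ≤ m₁.S.length then
    [⟨m₂.S, m₂.l, m₂.Γ, m₂.r, m₁.S.drop (m₂.S.length + m₂.Γ.dom.length) ++
        (whisk m₁.l m₁.r m₁.Γ.dom ++ m₁.T)⟩,
      ⟨m₂.S ++ (whisk m₂.l m₂.r m₂.Γ.cod ++ m₁.S.drop (m₂.S.length + m₂.Γ.dom.length)),
        m₁.l, m₁.Γ, m₁.r, m₁.T⟩]
  -- Overlapping moves are left alone, so that the denoted 3-cell is preserved without any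
  -- hypothesis.
  else [m₁, m₂]

/-- Two factorisations of one path around non-overlapping segments determine the stretch between the
segments; it is the `R` required by `Eqv.exchange`. -/
theorem eq_append_drop {S₁ p T₁ S₂ T₂ : Path}
    (h : S₁ ++ (p ++ T₁) = S₂ ++ T₂) (hl : S₁.length + p.length ≤ S₂.length) :
    S₂ = S₁ ++ (p ++ S₂.drop (S₁.length + p.length)) ∧
      T₁ = S₂.drop (S₁.length + p.length) ++ T₂ := by
  rw [← List.append_assoc] at h
  obtain ⟨R, hR, hR'⟩ | ⟨R, hR, hR'⟩ := List.append_eq_append_iff.1 h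
  · subst hR hR'
    simp
  · have := congrArg List.length hR
    simp only [List.length_append] at this
    have : R = [] := List.eq_nil_of_length_eq_zero (by omega)
    subst this
    simp only [List.append_nil, List.nil_append] at hR hR'
    subst hR hR'
    simp

/-- Interchange the moves in positions `n` and `n + 1`. -/
def commAt : ℕ → List Move → List Move
  | 0, m₁ :: m₂ :: c => commute m₁ m₂ ++ c
  | n + 1, m :: c => m :: commAt n c
  | _, c => c

namespace Eqv

/-- Naturality of the interchange in its left variable. -/
theorem naturality_left {u u' v : Path} (hu : Valid₂ s t u) (hc : Valid₃ s t u u' c)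
    (hv : Valid₂ s' t' v) :
    Eqv D (s ++ s') (t ++ t') (whisk [] s' u ++ whisk t [] v) (whisk s [] v ++ whisk [] t' u')
      (swaps s t u v ++ Diagram.ctx (whisk s [] v) [] t' [] c)
      (Diagram.ctx [] [] s' (whisk t [] v) c ++ swaps s t u' v) := by
  have hc' := Rep₃.ev₃ (D := D) hu (hc.cod_valid hu) hc
  have hv' := Rep₂.ev₂ (D := D) hv
  have h₁ := (Rep₃.interchange hc'.dom hv').comp
    ((hc'.pre₃ (r := ev A B t') rfl).whiskerLeft (hv'.post₂ (l := ev A B s) rfl))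
  have h₂ := ((hc'.pre₃ (r := ev A B s') rfl).whiskerRight (hv'.post₂ (l := ev A B t) rfl)).comp
    (Rep₃.interchange hc'.cod hv')
  -- After this rewriting `h₁` and `h₂` give two denotations of the same 3-cell.
  rw [interchange_naturality_left] at h₁
  have key := h₁.eqv h₂
  simpa [ctx_ctx, whisk_nil, whisk_empty] using key

/-- Naturality of the interchange in its right variable. -/
theorem naturality_right {u v v' : Path} (hv : Valid₂ s' t' v) (hc : Valid₃ s' t' v v' c)
    (hu : Valid₂ s t u) :
    Eqv D (s ++ s') (t ++ t') (whisk [] s' u ++ whisk t [] v) (whisk s [] v' ++ whisk [] t' u)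
      (swaps s t u v ++ Diagram.ctx [] s [] (whisk [] t' u) c)
      (Diagram.ctx (whisk [] s' u) t [] [] c ++ swaps s t u v') := by
  have hc' := Rep₃.ev₃ (D := D) hv (hc.cod_valid hv) hc
  have hu' := Rep₂.ev₂ (D := D) hu
  have h₁ := (Rep₃.interchange hu' hc'.dom).comp
    ((hc'.post₃ (l := ev A B s) rfl).whiskerRight (hu'.pre₂ (r := ev A B t') rfl))
  have h₂ := ((hc'.post₃ (l := ev A B t) rfl).whiskerLeft (hu'.pre₂ (r := ev A B s') rfl)).comp
    (Rep₃.interchange hu' hc'.cod)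
  rw [interchange_naturality_right] at h₁
  have key := h₁.eqv h₂
  simpa [ctx_ctx, whisk_nil, whisk_empty] using key

/-- Read backwards, this inserts a cancelling pair, which supplies the inverse interchange needed to
apply warping axioms 1 and 2. -/
theorem unswap_swap (φ θ : Gen₂) :
    Eqv D (φ.src ++ θ.src) (φ.tgt ++ θ.tgt) (Gen₃.unswap φ [] θ).dom (Gen₃.unswap φ [] θ).dom
      [⟨[], [], .unswap φ [] θ, [], []⟩, ⟨[], [], .swap φ [] θ, [], []⟩] [] := by
  have h := Rep₃.interchange_inv_gen (D := D) φ θ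
  have h' := Rep₃.interchange (Rep₂.gen (D := D) φ) (Rep₂.gen (D := D) θ)
  have := h.comp (h'.cast rfl rfl (by simp [Gen₃.cod, whisk, Step.whisk]) rfl rfl)
  rw [Iso.inv_hom_id] at this
  have key := (this.cast rfl rfl rfl (by simp [whisk, Step.whisk, Gen₃.dom]) rfl).eqv
    (Rep₃.eqToHom rfl h.dom)
  simpa [swaps, swapStep, Diagram.ctx, Move.ctx, whisk] using key

/-- Moves in disjoint parts of a path commute. -/
theorem exchange {l r l' r' : Word} {Γ Γ' : Gen₃} {R : Path}
    (hS : Valid₂ s (l ++ (Γ.src ++ r)) S)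
    (hR : Valid₂ (l ++ (Γ.tgt ++ r)) (l' ++ (Γ'.src ++ r')) R)
    (hT : Valid₂ (l' ++ (Γ'.tgt ++ r')) t T) :
    Eqv D s t (S ++ (whisk l r Γ.dom ++ (R ++ (whisk l' r' Γ'.dom ++ T))))
      (S ++ (whisk l r Γ.cod ++ (R ++ (whisk l' r' Γ'.cod ++ T))))
      [⟨S, l, Γ, r, R ++ (whisk l' r' Γ'.dom ++ T)⟩, ⟨S ++ (whisk l r Γ.cod ++ R), l', Γ', r', T⟩]
      [⟨S ++ (whisk l r Γ.dom ++ R), l', Γ', r', T⟩,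
        ⟨S, l, Γ, r, R ++ (whisk l' r' Γ'.cod ++ T)⟩] := by
  have w : ∀ {l r a b : Word} {p : Path} (h : Valid₂ a b p), Rep₂ D
      (wh (ev A B l) (ev A B r) (ev₂ D p h) (ev_append₃ _ _ l a r) (ev_append₃ _ _ l b r))
      (l ++ (a ++ r)) (l ++ (b ++ r)) (whisk l r p) :=
    fun h => (Rep₂.ev₂ h).wh rfl rfl _ _
  have first : ∀ {p : Path} (hp : Valid₂ Γ'.src Γ'.tgt p), _ := fun hp =>
    (Rep₃.gen (D := D) Γ).paste (.ev₂ hS) (l' := l) (r' := r) rfl rfl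
      ((Rep₂.ev₂ hR).comp ((w hp).comp (.ev₂ hT)))
      (ev_append₃ _ _ _ _ _) (ev_append₃ _ _ _ _ _) rfl rfl
  have second : ∀ {p : Path} (hp : Valid₂ Γ.src Γ.tgt p), _ := fun hp =>
    (Rep₃.gen (D := D) Γ').paste ((Rep₂.ev₂ hS).comp ((w hp).comp (.ev₂ hR))) (l' := l') (r' := r')
      rfl rfl (.ev₂ hT) (ev_append₃ _ _ _ _ _) (ev_append₃ _ _ _ _ _)
      (θ' := ev₂ D S hS ≫ wh (ev A B l) (ev A B r) (ev₂ D _ hp) (ev_append₃ _ _ _ _ _)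
        (ev_append₃ _ _ _ _ _) ≫ ev₂ D R hR ≫ wh (ev A B l') (ev A B r') (ev₂ D _ Γ'.dom_valid)
          (ev_append₃ _ _ _ _ _) (ev_append₃ _ _ _ _ _) ≫ ev₂ D T hT)
      (φ' := ev₂ D S hS ≫ wh (ev A B l) (ev A B r) (ev₂ D _ hp) (ev_append₃ _ _ _ _ _)
        (ev_append₃ _ _ _ _ _) ≫ ev₂ D R hR ≫ wh (ev A B l') (ev A B r') (ev₂ D _ Γ'.cod_valid)
          (ev_append₃ _ _ _ _ _) (ev_append₃ _ _ _ _ _) ≫ ev₂ D T hT)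
      (by simp only [Category.assoc]) (by simp only [Category.assoc])
  have assoc : ∀ {p q : Path}, S ++ (p ++ R) ++ (q ++ T) = S ++ (p ++ (R ++ (q ++ T))) := by simp
  have h₁ := (first Γ'.dom_valid).comp ((second Γ.cod_valid).cast rfl rfl assoc assoc rfl)
  have h₂ := ((second Γ.dom_valid).cast rfl rfl assoc assoc rfl).comp (first Γ'.cod_valid)
  rw [paste_exchange] at h₁
  · have key := h₁.eqv h₂
    simpa [Diagram.ctx, Move.ctx, whisk_empty] using key
  all_goals simp only [Category.assoc]

theorem congr {x' y' : Path} (h : Eqv D s t x y c d) (hx : x' = x) (hy : y' = y) (hc : c' = c)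
    (hd : d' = d) : Eqv D s t x' y' c' d' := by
  subst hx hy hc hd; exact h

theorem commute {m₁ m₂ : Move} (hx : Valid₂ s t x) (h : Valid₃ s t x y [m₁, m₂]) :
    Eqv D s t x y [m₁, m₂] (Diagram.commute m₁ m₂) := by
  obtain ⟨S₁, l₁, Γ₁, r₁, T₁⟩ := m₁
  obtain ⟨S₂, l₂, Γ₂, r₂, T₂⟩ := m₂
  have hS₁ : Valid₂ s _ S₁ := h.head.left
  have hT₁ : Valid₂ _ t T₁ := h.head.right
  have hS₂ : Valid₂ s _ S₂ := h.tail.head.left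
  have hT₂ : Valid₂ _ t T₂ := h.tail.head.right
  have hx' : x = _ := h.head_dom
  have hy : _ = y := h.tail.tail
  have e : S₁ ++ (whisk l₁ r₁ Γ₁.cod ++ T₁) = S₂ ++ (whisk l₂ r₂ Γ₂.dom ++ T₂) :=
    h.tail.head_dom
  subst hx' hy
  unfold Diagram.commute
  simp only
  split_ifs with h₁ h₂
  · obtain ⟨e₁, e₂⟩ := eq_append_drop e (by simpa [whisk] using h₁)
    simp only [whisk, List.length_map] at e₁ e₂
    generalize List.drop _ S₂ = R at *
    subst e₁ e₂
    have hR := (hS₂.of_append hS₁).of_append (Γ₁.cod_valid.whisk l₁ r₁)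
    refine (exchange (D := D) hS₁ hR hT₂).congr ?_ ?_ ?_ ?_
    all_goals simp [Move.dom, Move.cod, whisk]
  · obtain ⟨e₁, e₂⟩ := eq_append_drop e.symm (by simpa [whisk] using h₂)
    simp only [whisk, List.length_map] at e₁ e₂
    generalize List.drop _ S₁ = R at *
    subst e₁ e₂
    have hR := (hS₁.of_append hS₂).of_append (Γ₂.dom_valid.whisk l₂ r₂)
    refine (exchange (D := D) hS₂ hR hT₁).symm.congr ?_ ?_ ?_ ?_
    all_goals simp [Move.dom, Move.cod, whisk]
  · exact refl hx h

/-- No disjointness hypothesis is needed, since `commAt` and `Diagram.commute` change nothing when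
they do not apply. -/
theorem comm (h : Eqv D s t x y c c') (n : ℕ) : Eqv D s t x y c (commAt n c') := by
  refine h.trans ?_
  have hx := h.dom
  have hc := h.right
  clear h
  induction n generalizing c' x with
  | zero =>
    obtain _ | ⟨m₁, _ | ⟨m₂, c'⟩⟩ := c'
    · exact refl hx hc
    · exact refl hx hc
    · obtain ⟨z, h₁, h₂⟩ := Valid₃.of_append (c := [m₁, m₂]) hc
      exact (commute hx h₁).append (refl (h₁.cod_valid hx) h₂)
  | succ n ih =>
    obtain _ | ⟨m, c'⟩ := c'
    · exact refl hx hc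
    · have hm : Valid₃ s t x m.cod [m] := ⟨hc.head, hc.head_dom, rfl⟩
      exact (refl hx hm).append (ih (hm.cod_valid hx) hc.tail)

/-- Starts a forward derivation: `c` is first equivalent to itself, and each later step rewrites
only the second list. -/
theorem chain (hx : Valid₂ s t x) (hc : Valid₃ s t x y c)
    (h : Eqv D s t x y c c → Eqv D s t x y c c') : Eqv D s t x y c c' := h (refl hx hc)

/-- Replace the moves in positions `n, n + 1, …` by an equivalent list of moves. -/
theorem subst {s₀ t₀ : Word} {u v : Path} {a b : List Move} (h : Eqv D s t x y c c') (n : ℕ)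
    (E : Eqv D s₀ t₀ u v a b) (S : Path) (l r : Word) (T : Path)
    (hc : c' = c'.take n ++ (Diagram.ctx S l r T a ++ c'.drop (n + a.length)))
    (hS : Valid₂ s (l ++ (s₀ ++ r)) S) (hT : Valid₂ (l ++ (t₀ ++ r)) t T)
    (hd : (c'.take n).foldl (fun _ m => m.cod) x = S ++ (whisk l r u ++ T)) :
    Eqv D s t x y c (c'.take n ++ (Diagram.ctx S l r T b ++ c'.drop (n + a.length))) := by
  refine h.trans ?_
  have hc' := h.right
  rw [hc] at hc'
  obtain ⟨z, h₁, h₂⟩ := hc'.of_append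
  obtain ⟨z', h₃, h₄⟩ := h₂.of_append
  -- The moves before position `n` determine the path reached there, which by `hd` is the domain of
  -- `E` in its context.
  cases h₁.eq_foldl.trans hd
  have E' := E.ctx hS hT
  cases h₃.eq_of_valid E'.left
  have := (refl (D := D) h.dom h₁).append (E'.append (refl E'.cod h₄))
  rwa [← hc] at this

end Eqv

/-! ### The axioms of skew monads and skew warpings -/

section

variable {a b b' : X ⟶ X}

theorem Rep₂.gen_cons {g : Gen₂} {f f' : X ⟶ X} {θ : f ⟶ f'} {l r : X ⟶ X} {l' r' : Word}
    {φ : b ⟶ b'} {hs : a = l ⊙ f ⊙ r} {ht : b = l ⊙ f' ⊙ r}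
    (h : Rep₂ D θ g.src g.tgt [⟨[], g, []⟩]) (hl : l = ev A B l') (hr : r = ev A B r')
    (hs' : s = l' ++ (g.src ++ r')) (hφ : Rep₂ D φ (l' ++ (g.tgt ++ r')) t x) :
    Rep₂ D (GrayCategory.wh l r θ hs ht ≫ φ) s t (⟨l', g, r'⟩ :: x) := by
  subst hs'
  exact ((h.wh hl hr _ _).comp hφ).cast rfl rfl (by simp [whisk, Step.whisk])

theorem Rep₂.gen_wh {g : Gen₂} {f f' : X ⟶ X} {θ : f ⟶ f'} {l r : X ⟶ X} {l' r' : Word}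
    {hs : a = l ⊙ f ⊙ r} {ht : b = l ⊙ f' ⊙ r}
    (h : Rep₂ D θ g.src g.tgt [⟨[], g, []⟩]) (hl : l = ev A B l') (hr : r = ev A B r')
    (hs' : s = l' ++ (g.src ++ r')) (hm : t = l' ++ (g.tgt ++ r')) :
    Rep₂ D (GrayCategory.wh l r θ hs ht) s t [⟨l', g, r'⟩] := by
  subst hs' hm
  exact (h.wh hl hr _ _).cast rfl rfl (by simp [whisk, Step.whisk])

theorem Rep₂.of_eq_id (hs : a = ev A B s) (h : s = t) : Rep₂ D (𝟙 a) s t [] := by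
  subst h; exact Rep₂.id hs

theorem Rep₃.cons {θ φ ψ : a ⟶ b} {Γ : θ ⟶ φ} {Ξ : φ ⟶ ψ} {m : Move}
    (h : Rep₃ D Γ s t x m.cod [m]) (h' : Rep₃ D Ξ s t m.cod z c) :
    Rep₃ D (Γ ≫ Ξ) s t x z (m :: c) := h.comp h'

theorem Rep₂.mul {hs : a = 𝟙 X ⊙ (A⊙B⊙A) ⊙ B} {hm : b = 𝟙 X ⊙ (A⊙B) ⊙ B}
    {hm' : b = A ⊙ (B⊙B) ⊙ 𝟙 X} {ht : b' = A ⊙ B ⊙ 𝟙 X} :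
    Rep₂ D (GrayCategory.wh (𝟙 X) B D.t hs hm ≫ GrayCategory.wh A (𝟙 X) M.p hm' ht)
      [.A, .B, .A, .B] [.A, .B] [⟨[], .t, [.B]⟩, ⟨[.A], .p, []⟩] :=
  .gen_cons (.gen .t) rfl rfl rfl (.gen_wh (.gen .p) rfl rfl rfl rfl)

theorem Rep₃.id {θ : a ⟶ b} (h : Rep₂ D θ s t x) : Rep₃ D (𝟙 θ) s t x x [] := Rep₃.eqToHom rfl h

/-- Serves the interchanges of `(Ap)(tB)` with `t` and with `k`, each of which expands to two moves.
-/
theorem Rep₃.cons₂ {θ φ ψ : a ⟶ b} {Γ : θ ⟶ φ} {Ξ : φ ⟶ ψ} {m m' : Move}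
    (h : Rep₃ D Γ s t x m'.cod [m, m']) (h' : Rep₃ D Ξ s t m'.cod z c) :
    Rep₃ D (Γ ≫ Ξ) s t x z (m :: m' :: c) := h.comp h'

theorem Rep₃.paste_of {θ φ : a ⟶ b} {Γ : θ ⟶ φ} {s₀ t₀ l' r' : Word} {x₀ y₀ : Path}
    {c₀ : List Move} {a₁ a₂ b₁ b₂ l r : X ⟶ X} {S₁ : a₁ ⟶ a₂} {T₁ : b₁ ⟶ b₂} {θ' φ' : a₁ ⟶ b₂}
    {h₁ : a₂ = l ⊙ a ⊙ r} {h₂ : b₁ = l ⊙ b ⊙ r} {h₃ : θ' = S₁ ≫ GrayCategory.wh l r θ h₁ h₂ ≫ T₁}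
    {h₄ : φ' = S₁ ≫ GrayCategory.wh l r φ h₁ h₂ ≫ T₁}
    (h : Rep₃ D Γ s₀ t₀ x₀ y₀ c₀)
    (hS : Rep₂ D S₁ s (l' ++ (s₀ ++ r')) S) (hl : l = ev A B l') (hr : r = ev A B r')
    (hT : Rep₂ D T₁ (l' ++ (t₀ ++ r')) t T) (hx : x = S ++ (whisk l' r' x₀ ++ T))
    (hy : y = S ++ (whisk l' r' y₀ ++ T)) (hc : c = ctx S l' r' T c₀) :
    Rep₃ D (GrayCategory.paste S₁ l r Γ T₁ h₁ h₂ h₃ h₄) s t x y c :=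
  (h.paste hS hl hr hT h₁ h₂ h₃ h₄).cast rfl rfl hx.symm hy.symm hc.symm

/-- The 3-cell `Γ` is denoted by the generator `Γ'`. -/
abbrev RepGen (D : SkewWarpingData M A) {a b : X ⟶ X} {θ φ : a ⟶ b} (Γ : θ ⟶ φ) (Γ' : Gen₃) :
    Prop :=
  Rep₃ D Γ Γ'.src Γ'.tgt Γ'.dom Γ'.cod [⟨[], [], Γ', [], []⟩]

theorem Rep₃.paste_move {Γ' : Gen₃} {θ φ : a ⟶ b} {Γ : θ ⟶ φ} {l' r' : Word}
    {a₁ a₂ b₁ b₂ l r : X ⟶ X} {S₁ : a₁ ⟶ a₂} {T₁ : b₁ ⟶ b₂} {θ' φ' : a₁ ⟶ b₂}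
    {h₁ : a₂ = l ⊙ a ⊙ r} {h₂ : b₁ = l ⊙ b ⊙ r} {h₃ : θ' = S₁ ≫ GrayCategory.wh l r θ h₁ h₂ ≫ T₁}
    {h₄ : φ' = S₁ ≫ GrayCategory.wh l r φ h₁ h₂ ≫ T₁}
    (h : RepGen D Γ Γ')
    (hS : Rep₂ D S₁ s (l' ++ (Γ'.src ++ r')) S) (hl : l = ev A B l') (hr : r = ev A B r')
    (hT : Rep₂ D T₁ (l' ++ (Γ'.tgt ++ r')) t T) (hx : x = S ++ (whisk l' r' Γ'.dom ++ T))
    (hy : y = S ++ (whisk l' r' Γ'.cod ++ T)) :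
    Rep₃ D (GrayCategory.paste S₁ l r Γ T₁ h₁ h₂ h₃ h₄) s t x y [⟨S, l', Γ', r', T⟩] :=
  (h.paste hS hl hr hT h₁ h₂ h₃ h₄).cast rfl rfl hx.symm hy.symm
    (by simp [ctx, Move.ctx, whisk_empty])

end

theorem RepGen.α : RepGen D M.α .α :=
  (Rep₃.gen .α).congr (.gen_cons (.gen .p) rfl rfl rfl (.gen .p))
    (.gen_cons (.gen .p) rfl rfl rfl (.gen .p))
    ((eqToHom_comp_heq _ _).trans (comp_eqToHom_heq _ _)).symm

theorem RepGen.lam : RepGen D M.lam .lam :=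
  (Rep₃.gen .lam).congr (.gen_cons (.gen .e) rfl rfl rfl (.gen .p)) (.of_eq_id rfl rfl)
    (eqToHom_comp_heq _ _).symm

theorem RepGen.rho : RepGen D M.rho .rho :=
  (Rep₃.gen .rho).congr (.of_eq_id rfl rfl) (.gen_cons (.gen .e) rfl rfl rfl (.gen .p))
    (comp_eqToHom_heq _ _).symm

theorem RepGen.ν : RepGen D D.ν .ν :=
  (Rep₃.gen .ν).congr
    (.gen_cons (.gen .t) rfl rfl rfl (.gen_cons (.gen .p) rfl rfl rfl (.gen .t)))
    (.gen_cons (.gen .t) rfl rfl rfl (.gen_cons (.gen .t) rfl rfl rfl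
      (.gen_wh (.gen .p) rfl rfl rfl rfl)))
    ((eqToHom_comp_heq _ _).trans (comp_eqToHom_heq _ _)).symm

theorem RepGen.ν₀ : RepGen D D.ν₀ .ν₀ :=
  (Rep₃.gen .ν₀).congr (.gen_cons (.gen .k) rfl rfl rfl (.gen .t))
    (.gen_wh (.gen .e) rfl rfl rfl rfl)
    ((eqToHom_comp_heq _ _).trans (comp_eqToHom_heq _ _)).symm

theorem RepGen.κ : RepGen D D.κ .κ :=
  (Rep₃.gen .κ).congr (.of_eq_id rfl rfl)
    (.gen_cons (.gen .k) rfl rfl rfl (.gen_cons (.gen .t) rfl rfl rfl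
      (.gen_wh (.gen .p) rfl rfl rfl rfl)))
    (comp_eqToHom_heq _ _).symm

theorem RepGen.swap {φ θ : Gen₂} : RepGen D (interchange (gen₂ D φ) (gen₂ D θ)).hom (.swap φ [] θ) :=
  (Rep₃.interchange (.gen φ) (.gen θ)).cast rfl rfl (by simp [Gen₃.dom, whisk, Step.whisk])
    (by simp [Gen₃.cod, whisk, Step.whisk]) (by simp [swaps, swapStep, Diagram.ctx, Move.ctx, whisk])

theorem RepGen.unswap {φ θ : Gen₂} :
    RepGen D (interchange (gen₂ D φ) (gen₂ D θ)).inv (.unswap φ [] θ) :=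
  Rep₃.interchange_inv_gen φ θ

theorem Eqv.of_eq {a b : X ⟶ X} {θ φ : a ⟶ b} {Γ Γ' : θ ⟶ φ} (h : Γ = Γ')
    (hc : Rep₃ D Γ s t x y c) (hc' : Rep₃ D Γ' s t x y c') : Eqv D s t x y c c' :=
  hc.eqv (h ▸ hc')

-- Kept opaque so that unification matches pastings by their arguments instead of unfolding the
-- casts inside them.
attribute [local irreducible] GrayCategory.paste GrayCategory.wh

theorem Eqv.assoc_assoc :
    Eqv D [.B, .B, .B, .B] [.B]
      [⟨[], .p, [.B, .B]⟩, ⟨[], .p, [.B]⟩, ⟨[], .p, []⟩]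
      [⟨[.B, .B], .p, []⟩, ⟨[.B], .p, []⟩, ⟨[], .p, []⟩]
      [⟨[], [], .α, [.B], [⟨[], .p, []⟩]⟩,
        ⟨[⟨[.B], .p, [.B]⟩], [], .α, [], []⟩,
        ⟨[], [.B], .α, [], [⟨[], .p, []⟩]⟩]
      [⟨[⟨[], .p, [.B, .B]⟩], [], .α, [], []⟩,
        ⟨[], [], .swap .p [] .p, [], [⟨[], .p, []⟩]⟩,
        ⟨[⟨[.B, .B], .p, []⟩], [], .α, [], []⟩] := by
  refine Eqv.of_eq M.assoc_assoc ?_ ?_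
  · refine .cons (.paste_move .α ?_ rfl rfl ?_ rfl rfl) <|
      .cons (.paste_move .α ?_ rfl rfl ?_ rfl rfl) <|
      .paste_move .α ?_ rfl rfl ?_ rfl rfl
    -- It remains to match the 2-cells before and after each generator with the displayed paths:
    -- generators are peeled off one at a time, and the equations between words hold by computation.
    all_goals repeat' first
      | rfl
      | exact Rep₂.of_eq_id rfl rfl
      | exact Rep₂.gen .t
      | exact Rep₂.gen .p
      | exact Rep₂.gen .k
      | exact Rep₂.gen .e
      | refine Rep₂.gen_cons ?_ ?_ ?_ ?_ ?_
      | refine Rep₂.gen_wh ?_ ?_ ?_ ?_ ?_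
  · refine .cons (.paste_move .α ?_ rfl rfl ?_ rfl rfl) <|
      .cons (.paste_move (.swap (φ := .p) (θ := .p)) ?_ rfl rfl ?_ rfl rfl) <|
      .paste_move .α ?_ rfl rfl ?_ rfl rfl
    all_goals repeat' first
      | rfl
      | exact Rep₂.of_eq_id rfl rfl
      | exact Rep₂.gen .t
      | exact Rep₂.gen .p
      | exact Rep₂.gen .k
      | exact Rep₂.gen .e
      | refine Rep₂.gen_cons ?_ ?_ ?_ ?_ ?_
      | refine Rep₂.gen_wh ?_ ?_ ?_ ?_ ?_

theorem Eqv.right_assoc_left :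
    Eqv D [.B, .B] [.B]
      [⟨[], .p, []⟩]
      [⟨[], .p, []⟩]
      [⟨[], [], .rho, [.B], [⟨[], .p, []⟩]⟩,
        ⟨[⟨[.B], .e, [.B]⟩], [], .α, [], []⟩,
        ⟨[], [.B], .lam, [], [⟨[], .p, []⟩]⟩]
      [] := by
  refine Eqv.of_eq M.right_assoc_left ?_ ?_
  · refine .cons (.paste_move .rho ?_ rfl rfl ?_ rfl rfl) <|
      .cons (.paste_move .α ?_ rfl rfl ?_ rfl rfl) <|
      .paste_move .lam ?_ rfl rfl ?_ rfl rfl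
    all_goals repeat' first
      | rfl
      | exact Rep₂.of_eq_id rfl rfl
      | exact Rep₂.gen .t
      | exact Rep₂.gen .p
      | exact Rep₂.gen .k
      | exact Rep₂.gen .e
      | refine Rep₂.gen_cons ?_ ?_ ?_ ?_ ?_
      | refine Rep₂.gen_wh ?_ ?_ ?_ ?_ ?_
  · refine .id ?_
    all_goals repeat' first
      | rfl
      | exact Rep₂.of_eq_id rfl rfl
      | exact Rep₂.gen .t
      | exact Rep₂.gen .p

theorem Eqv.assoc_left :
    Eqv D [.B, .B] [.B]
      [⟨[], .e, [.B, .B]⟩, ⟨[], .p, [.B]⟩, ⟨[], .p, []⟩]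
      [⟨[], .p, []⟩]
      [⟨[⟨[], .e, [.B, .B]⟩], [], .α, [], []⟩,
        ⟨[], [], .swap .e [] .p, [], [⟨[], .p, []⟩]⟩,
        ⟨[⟨[], .p, []⟩], [], .lam, [], []⟩]
      [⟨[], [], .lam, [.B], [⟨[], .p, []⟩]⟩] := by
  refine Eqv.of_eq M.assoc_left ?_ ?_
  · refine .cons (.paste_move .α ?_ rfl rfl ?_ rfl rfl) <|
      .cons (.paste_move (.swap (φ := .e) (θ := .p)) ?_ rfl rfl ?_ rfl rfl) <|
      .paste_move .lam ?_ rfl rfl ?_ rfl rfl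
    all_goals repeat' first
      | rfl
      | exact Rep₂.of_eq_id rfl rfl
      | exact Rep₂.gen .t
      | exact Rep₂.gen .p
      | exact Rep₂.gen .k
      | exact Rep₂.gen .e
      | refine Rep₂.gen_cons ?_ ?_ ?_ ?_ ?_
      | refine Rep₂.gen_wh ?_ ?_ ?_ ?_ ?_
  · refine .paste_move .lam ?_ rfl rfl ?_ rfl rfl
    all_goals repeat' first
      | rfl
      | exact Rep₂.of_eq_id rfl rfl
      | exact Rep₂.gen .t
      | exact Rep₂.gen .p

theorem Eqv.of_assocAssoc (h : D.AssocAssoc) :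
    Eqv D [.A, .B, .A, .B, .A, .B, .A] [.A, .B]
      [⟨[], .t, [.B, .A, .B, .A]⟩, ⟨[.A], .p, [.A, .B, .A]⟩, ⟨[], .t, [.B, .A]⟩, ⟨[.A], .p, [.A]⟩,
        ⟨[], .t, []⟩]
      [⟨[.A, .B, .A, .B], .t, []⟩, ⟨[.A, .B], .t, [.B]⟩, ⟨[], .t, [.B, .B]⟩, ⟨[.A, .B], .p, []⟩,
        ⟨[.A], .p, []⟩]
      [⟨[], [], .ν, [.B, .A], [⟨[.A], .p, [.A]⟩, ⟨[], .t, []⟩]⟩,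
        ⟨[⟨[.A, .B], .t, [.B, .A]⟩, ⟨[], .t, [.B, .B, .A]⟩], [.A], .α, [.A], [⟨[], .t, []⟩]⟩,
        ⟨[⟨[.A, .B], .t, [.B, .A]⟩], [], .swap .t [] .p, [.A], [⟨[.A], .p, [.A]⟩, ⟨[], .t, []⟩]⟩,
        ⟨[⟨[.A, .B], .t, [.B, .A]⟩, ⟨[.A, .B, .A], .p, [.A]⟩], [], .ν, [], []⟩,
        ⟨[], [.A, .B], .ν, [], [⟨[], .t, [.B]⟩, ⟨[.A], .p, []⟩]⟩,
        ⟨[⟨[.A, .B, .A, .B], .t, []⟩, ⟨[.A, .B], .t, [.B]⟩], [], .unswap .t [] .p, [], [⟨[.A], .p,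
          []⟩]⟩]
      [⟨[⟨[], .t, [.B, .A, .B, .A]⟩, ⟨[.A], .p, [.A, .B, .A]⟩], [], .ν, [], []⟩,
        ⟨[⟨[], .t, [.B, .A, .B, .A]⟩], [.A], .swap .p [] .t, [], [⟨[], .t, [.B]⟩, ⟨[.A], .p, []⟩]⟩,
        ⟨[], [], .swap .t [.B] .t, [], [⟨[.A], .p, [.A, .B]⟩, ⟨[], .t, [.B]⟩, ⟨[.A], .p, []⟩]⟩,
        ⟨[⟨[.A, .B, .A, .B], .t, []⟩], [], .ν, [.B], [⟨[.A], .p, []⟩]⟩,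
        ⟨[⟨[.A, .B, .A, .B], .t, []⟩, ⟨[.A, .B], .t, [.B]⟩, ⟨[], .t, [.B, .B]⟩], [.A], .α, [], []⟩] := by
  unfold SkewWarpingData.AssocAssoc at h
  refine Eqv.of_eq h ?_ ?_
  · refine .cons (.paste_move .ν ?_ rfl rfl ?_ rfl rfl) <|
      .cons (.paste_move .α ?_ rfl rfl ?_ rfl rfl) <|
      .cons (.paste_move (.swap (φ := .t) (θ := .p)) ?_ rfl rfl ?_ rfl rfl) <|
      .cons (.paste_move .ν ?_ rfl rfl ?_ rfl rfl) <|
      .cons (.paste_move .ν ?_ rfl rfl ?_ rfl rfl) <|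
      .paste_move (.unswap (φ := .t) (θ := .p)) ?_ rfl rfl ?_ rfl rfl
    all_goals repeat' first
      | rfl
      | exact Rep₂.of_eq_id rfl rfl
      | exact Rep₂.gen .t
      | exact Rep₂.gen .p
      | exact Rep₂.gen .k
      | exact Rep₂.gen .e
      | refine Rep₂.gen_cons ?_ ?_ ?_ ?_ ?_
      | refine Rep₂.gen_wh ?_ ?_ ?_ ?_ ?_
  · refine .cons (.paste_move .ν ?_ rfl rfl ?_ rfl rfl) <|
      -- The interchange of `(Ap)(tB)` with `t` becomes two moves: `p` passes `t` first, then `t`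
      -- passes `t`.
      .cons₂ (.paste_of (.interchange .mul (.gen .t)) ?_ rfl rfl ?_ rfl rfl rfl) <|
      .cons (.paste_move .ν ?_ rfl rfl ?_ rfl rfl) <| .paste_move .α ?_ rfl rfl ?_ rfl rfl
    all_goals repeat' first
      | rfl
      | exact Rep₂.of_eq_id rfl rfl
      | exact Rep₂.gen .t
      | exact Rep₂.gen .p
      | exact Rep₂.gen .k
      | exact Rep₂.gen .e
      | refine Rep₂.gen_cons ?_ ?_ ?_ ?_ ?_
      | refine Rep₂.gen_wh ?_ ?_ ?_ ?_ ?_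

theorem Eqv.of_rightAssocLeft (h : D.RightAssocLeft) :
    Eqv D [.A, .B, .A] [.A, .B]
      [⟨[], .t, []⟩]
      [⟨[], .t, []⟩, ⟨[.A, .B], .e, []⟩, ⟨[.A], .p, []⟩]
      [⟨[], [], .κ, [.A], [⟨[], .t, []⟩]⟩,
        ⟨[⟨[.A, .B], .k, [.A]⟩], [], .ν, [], []⟩,
        ⟨[], [.A, .B], .ν₀, [], [⟨[], .t, [.B]⟩, ⟨[.A], .p, []⟩]⟩,
        ⟨[], [], .unswap .t [] .e, [], [⟨[.A], .p, []⟩]⟩]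
      [⟨[⟨[], .t, []⟩], [.A], .rho, [], []⟩] := by
  unfold SkewWarpingData.RightAssocLeft at h
  refine Eqv.of_eq h ?_ ?_
  · refine .cons (.paste_move .κ ?_ rfl rfl ?_ rfl rfl) <|
      .cons (.paste_move .ν ?_ rfl rfl ?_ rfl rfl) <|
      .cons (.paste_move .ν₀ ?_ rfl rfl ?_ rfl rfl) <|
      .paste_move (.unswap (φ := .t) (θ := .e)) ?_ rfl rfl ?_ rfl rfl
    all_goals repeat' first
      | rfl
      | exact Rep₂.of_eq_id rfl rfl
      | exact Rep₂.gen .t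
      | exact Rep₂.gen .p
      | exact Rep₂.gen .k
      | exact Rep₂.gen .e
      | refine Rep₂.gen_cons ?_ ?_ ?_ ?_ ?_
      | refine Rep₂.gen_wh ?_ ?_ ?_ ?_ ?_
  · refine .paste_move .rho ?_ rfl rfl ?_ rfl rfl
    all_goals repeat' first
      | rfl
      | exact Rep₂.of_eq_id rfl rfl
      | exact Rep₂.gen .t

theorem Eqv.of_assocLeft (h : D.AssocLeft) :
    Eqv D [.A, .B, .A] [.A, .B]
      [⟨[], .k, [.A, .B, .A]⟩, ⟨[], .t, [.B, .A]⟩, ⟨[.A], .p, [.A]⟩, ⟨[], .t, []⟩]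
      [⟨[], .t, []⟩]
      [⟨[⟨[], .k, [.A, .B, .A]⟩], [], .ν, [], []⟩,
        ⟨[], [], .swap .k [] .t, [], [⟨[], .t, [.B]⟩, ⟨[.A], .p, []⟩]⟩,
        ⟨[⟨[], .t, []⟩], [], .ν₀, [.B], [⟨[.A], .p, []⟩]⟩,
        ⟨[⟨[], .t, []⟩], [.A], .lam, [], []⟩]
      [⟨[], [], .ν₀, [.B, .A], [⟨[.A], .p, [.A]⟩, ⟨[], .t, []⟩]⟩,
        ⟨[], [.A], .lam, [.A], [⟨[], .t, []⟩]⟩] := by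
  unfold SkewWarpingData.AssocLeft at h
  refine Eqv.of_eq h ?_ ?_
  · refine .cons (.paste_move .ν ?_ rfl rfl ?_ rfl rfl) <|
      .cons (.paste_move (.swap (φ := .k) (θ := .t)) ?_ rfl rfl ?_ rfl rfl) <|
      .cons (.paste_move .ν₀ ?_ rfl rfl ?_ rfl rfl) <|
      .paste_move .lam ?_ rfl rfl ?_ rfl rfl
    all_goals repeat' first
      | rfl
      | exact Rep₂.of_eq_id rfl rfl
      | exact Rep₂.gen .t
      | exact Rep₂.gen .p
      | exact Rep₂.gen .k
      | exact Rep₂.gen .e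
      | refine Rep₂.gen_cons ?_ ?_ ?_ ?_ ?_
      | refine Rep₂.gen_wh ?_ ?_ ?_ ?_ ?_
  · refine .cons (.paste_move .ν₀ ?_ rfl rfl ?_ rfl rfl) <|
      .paste_move .lam ?_ rfl rfl ?_ rfl rfl
    all_goals repeat' first
      | rfl
      | exact Rep₂.of_eq_id rfl rfl
      | exact Rep₂.gen .t
      | exact Rep₂.gen .p
      | exact Rep₂.gen .k
      | exact Rep₂.gen .e
      | refine Rep₂.gen_cons ?_ ?_ ?_ ?_ ?_

theorem Eqv.of_rightAssoc (h : D.RightAssoc) :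
    Eqv D [.A, .B, .A, .B] [.A, .B]
      [⟨[], .t, [.B]⟩, ⟨[.A], .p, []⟩]
      [⟨[.A, .B, .A, .B], .k, []⟩, ⟨[.A, .B], .t, [.B]⟩, ⟨[.A, .B, .A], .p, []⟩, ⟨[], .t, [.B]⟩,
        ⟨[.A], .p, []⟩]
      [⟨[⟨[], .t, [.B]⟩, ⟨[.A], .p, []⟩], [], .κ, [], []⟩,
        ⟨[⟨[], .t, [.B]⟩], [.A], .swap .p [] .k, [], [⟨[], .t, [.B]⟩, ⟨[.A], .p, []⟩]⟩,
        ⟨[], [], .swap .t [.B] .k, [], [⟨[.A], .p, [.A, .B]⟩, ⟨[], .t, [.B]⟩, ⟨[.A], .p, []⟩]⟩,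
        ⟨[⟨[.A, .B, .A, .B], .k, []⟩], [], .ν, [.B], [⟨[.A], .p, []⟩]⟩,
        ⟨[⟨[.A, .B, .A, .B], .k, []⟩, ⟨[.A, .B], .t, [.B]⟩, ⟨[], .t, [.B, .B]⟩], [.A], .α, [], []⟩,
        ⟨[⟨[.A, .B, .A, .B], .k, []⟩, ⟨[.A, .B], .t, [.B]⟩], [], .swap .t [] .p, [], [⟨[.A], .p,
          []⟩]⟩]
      [⟨[], [.A, .B], .κ, [], [⟨[], .t, [.B]⟩, ⟨[.A], .p, []⟩]⟩] := by
  unfold SkewWarpingData.RightAssoc at h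
  refine Eqv.of_eq h ?_ ?_
  · refine .cons (.paste_move .κ ?_ rfl rfl ?_ rfl rfl) <|
      .cons₂ (.paste_of (.interchange .mul (.gen .k)) ?_ rfl rfl ?_ rfl rfl rfl) <|
      .cons (.paste_move .ν ?_ rfl rfl ?_ rfl rfl) <| .cons (.paste_move .α ?_ rfl rfl ?_ rfl rfl) <|
      .paste_move (.swap (φ := .t) (θ := .p)) ?_ rfl rfl ?_ rfl rfl
    all_goals repeat' first
      | rfl
      | exact Rep₂.of_eq_id rfl rfl
      | exact Rep₂.gen .t
      | exact Rep₂.gen .p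
      | exact Rep₂.gen .k
      | exact Rep₂.gen .e
      | refine Rep₂.gen_cons ?_ ?_ ?_ ?_ ?_
      | refine Rep₂.gen_wh ?_ ?_ ?_ ?_ ?_
  · refine .paste_move .κ ?_ rfl rfl ?_ rfl rfl
    all_goals repeat' first
      | rfl
      | exact Rep₂.of_eq_id rfl rfl
      | exact Rep₂.gen .t
      | exact Rep₂.gen .p
      | exact Rep₂.gen .k
      | exact Rep₂.gen .e
      | refine Rep₂.gen_cons ?_ ?_ ?_ ?_ ?_
      | refine Rep₂.gen_wh ?_ ?_ ?_ ?_ ?_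

theorem Eqv.of_rightLeft (h : D.RightLeft) :
    Eqv D [] [.A, .B]
      [⟨[], .k, []⟩]
      [⟨[], .k, []⟩]
      [⟨[⟨[], .k, []⟩], [], .κ, [], []⟩,
        ⟨[], [], .swap .k [] .k, [], [⟨[], .t, [.B]⟩, ⟨[.A], .p, []⟩]⟩,
        ⟨[⟨[], .k, []⟩], [], .ν₀, [.B], [⟨[.A], .p, []⟩]⟩,
        ⟨[⟨[], .k, []⟩], [.A], .lam, [], []⟩]
      [] := by
  unfold SkewWarpingData.RightLeft at h
  refine Eqv.of_eq h ?_ ?_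
  · refine .cons (.paste_move .κ ?_ rfl rfl ?_ rfl rfl) <|
      .cons (.paste_move (.swap (φ := .k) (θ := .k)) ?_ rfl rfl ?_ rfl rfl) <|
      .cons (.paste_move .ν₀ ?_ rfl rfl ?_ rfl rfl) <|
      .paste_move .lam ?_ rfl rfl ?_ rfl rfl
    all_goals repeat' first
      | rfl
      | exact Rep₂.of_eq_id rfl rfl
      | exact Rep₂.gen .t
      | exact Rep₂.gen .p
      | exact Rep₂.gen .k
      | exact Rep₂.gen .e
      | refine Rep₂.gen_cons ?_ ?_ ?_ ?_ ?_
      | refine Rep₂.gen_wh ?_ ?_ ?_ ?_ ?_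
  · refine .id ?_
    all_goals repeat' first
      | rfl
      | exact Rep₂.of_eq_id rfl rfl
      | exact Rep₂.gen .t
      | exact Rep₂.gen .p
      | exact Rep₂.gen .k

/-! ### The skew monad axioms for the composite -/

theorem Eqv.comp_rightAssocLeft (h : D.RightAssocLeft) :
    Eqv D [.A, .B, .A, .B] [.A, .B]
      [⟨[], .t, [.B]⟩, ⟨[.A], .p, []⟩]
      [⟨[], .t, [.B]⟩, ⟨[.A], .p, []⟩]
      [⟨[], [], .κ, [.A, .B], [⟨[], .t, [.B]⟩, ⟨[.A], .p, []⟩]⟩,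
        ⟨[⟨[.A, .B], .k, [.A, .B]⟩], [], .ν, [.B], [⟨[.A], .p, []⟩]⟩,
        ⟨[⟨[.A, .B], .k, [.A, .B]⟩, ⟨[.A, .B], .t, [.B]⟩, ⟨[], .t, [.B, .B]⟩], [.A], .α, [], []⟩,
        ⟨[⟨[.A, .B], .k, [.A, .B]⟩, ⟨[.A, .B], .t, [.B]⟩], [], .swap .t [] .p, [], [⟨[.A], .p,
          []⟩]⟩,
        ⟨[], [.A, .B], .ν₀, [.B], [⟨[.A, .B, .A], .p, []⟩, ⟨[], .t, [.B]⟩, ⟨[.A], .p, []⟩]⟩,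
        ⟨[], [.A, .B, .A], .lam, [], [⟨[], .t, [.B]⟩, ⟨[.A], .p, []⟩]⟩]
      [] := by
  refine Eqv.chain (by decide) (by decide) fun E => ?_
  -- `ν₀` acts on steps preceding those touched by `α` and by the `t`–`p` interchange, so it can be
  -- performed right after `ν`.
  replace E := (E.comm 3).comm 2
  -- The inserted inverse completes the left side of warping axiom 2, which is used next; its
  -- partner stays behind.
  replace E := E.subst 3 (Eqv.unswap_swap .t .e).symm
    [] [] [.B] [⟨[.A], .p, [.B]⟩, ⟨[.A], .p, []⟩]
    rfl (by decide) (by decide) rfl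
  replace E := E.subst 0 (.of_rightAssocLeft h)
    [] [] [.B] [⟨[.A], .p, []⟩]
    rfl (by decide) (by decide) rfl
  replace E := E.comm 1
  -- The two remaining interchanges carry `t` past `e` and `p`, the domain of `lam`. By naturality
  -- `lam` may come first, and then nothing is left for `t` to pass.
  replace E := E.subst 2 (.naturality_right (s := [.A, .B, .A]) (t := [.A, .B]) (s' := [.B]) (t' := [.B])
      (v := [⟨[], .e, [.B]⟩, ⟨[], .p, []⟩]) (v' := []) (u := [⟨[], .t, []⟩])
      (c := [⟨[], [], .lam, [], []⟩]) (by decide) (by decide) (by decide))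
    [] [] [] [⟨[.A], .p, []⟩]
    rfl (by decide) (by decide) rfl
  -- Only `rho`, `α`, `lam` remain, whiskered by `A` and placed after `tB`: axiom 2 of `B` cancels
  -- them.
  replace E := E.subst 0 .right_assoc_left
    [⟨[], .t, [.B]⟩] [.A] [] []
    rfl (by decide) (by decide) rfl
  exact E

theorem Eqv.comp_assocLeft (h : D.AssocLeft) :
    Eqv D [.A, .B, .A, .B] [.A, .B]
      [⟨[], .k, [.A, .B, .A, .B]⟩, ⟨[], .t, [.B, .A, .B]⟩, ⟨[.A], .p, [.A, .B]⟩, ⟨[], .t, [.B]⟩,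
        ⟨[.A], .p, []⟩]
      [⟨[], .t, [.B]⟩, ⟨[.A], .p, []⟩]
      [⟨[⟨[], .k, [.A, .B, .A, .B]⟩], [], .ν, [.B], [⟨[.A], .p, []⟩]⟩,
        ⟨[⟨[], .k, [.A, .B, .A, .B]⟩, ⟨[.A, .B], .t, [.B]⟩, ⟨[], .t, [.B, .B]⟩], [.A], .α, [], []⟩,
        ⟨[⟨[], .k, [.A, .B, .A, .B]⟩, ⟨[.A, .B], .t, [.B]⟩], [], .swap .t [] .p, [], [⟨[.A], .p,
          []⟩]⟩,
        ⟨[], [], .swap .k [] .t, [.B], [⟨[.A, .B, .A], .p, []⟩, ⟨[], .t, [.B]⟩, ⟨[.A], .p, []⟩]⟩,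
        ⟨[⟨[], .t, [.B]⟩], [], .swap .k [.A] .p, [], [⟨[], .t, [.B]⟩, ⟨[.A], .p, []⟩]⟩,
        ⟨[⟨[], .t, [.B]⟩, ⟨[.A], .p, []⟩], [], .ν₀, [.B], [⟨[.A], .p, []⟩]⟩,
        ⟨[⟨[], .t, [.B]⟩, ⟨[.A], .p, []⟩], [.A], .lam, [], []⟩]
      [⟨[], [], .ν₀, [.B, .A, .B], [⟨[.A], .p, [.A, .B]⟩, ⟨[], .t, [.B]⟩, ⟨[.A], .p, []⟩]⟩,
        ⟨[], [.A], .lam, [.A, .B], [⟨[], .t, [.B]⟩, ⟨[.A], .p, []⟩]⟩] := by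
  refine Eqv.chain (by decide) (by decide) fun E => ?_
  replace E := (E.comm 2).comm 1
  -- The `t`–`p` and `k`–`p` interchanges together pass `t(kA)` across `p`. Naturality against `ν₀`
  -- replaces them by the single `e`–`p` interchange that occurs in axiom 3 of `B`.
  replace E := E.subst 3 (.naturality_left (s := [.A]) (t := [.A, .B]) (s' := [.B, .B]) (t' := [.B])
      (u := [⟨[], .k, [.A]⟩, ⟨[], .t, []⟩]) (u' := [⟨[.A], .e, []⟩]) (v := [⟨[], .p, []⟩])
      (c := [⟨[], [], .ν₀, [], []⟩]) (by decide) (by decide) (by decide))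
    [⟨[], .t, [.B]⟩] [] [] [⟨[.A], .p, []⟩]
    rfl (by decide) (by decide) rfl
  replace E := E.comm 2
  replace E := E.subst 3 .assoc_left
    [⟨[], .t, [.B]⟩] [.A] [] []
    rfl (by decide) (by decide) rfl
  replace E := E.subst 0 (.of_assocLeft h)
    [] [] [.B] [⟨[.A], .p, []⟩]
    rfl (by decide) (by decide) rfl
  exact E

/-- Both sides are rewritten to the sequence on the right of `L`, in which the `p`–`p` interchange
stands between two uses of `α`, as on the right of axiom 1 of `B`. -/
theorem Eqv.comp_assocAssoc (h : D.AssocAssoc) :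
    Eqv D [.A, .B, .A, .B, .A, .B, .A, .B] [.A, .B]
      [⟨[], .t, [.B, .A, .B, .A, .B]⟩, ⟨[.A], .p, [.A, .B, .A, .B]⟩, ⟨[], .t, [.B, .A, .B]⟩, ⟨[.A],
        .p, [.A, .B]⟩, ⟨[], .t, [.B]⟩, ⟨[.A], .p, []⟩]
      [⟨[.A, .B, .A, .B], .t, [.B]⟩, ⟨[.A, .B, .A, .B, .A], .p, []⟩, ⟨[.A, .B], .t, [.B]⟩, ⟨[.A,
        .B, .A], .p, []⟩, ⟨[], .t, [.B]⟩, ⟨[.A], .p, []⟩]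
      [⟨[], [], .ν, [.B, .A, .B], [⟨[.A], .p, [.A, .B]⟩, ⟨[], .t, [.B]⟩, ⟨[.A], .p, []⟩]⟩,
        ⟨[⟨[.A, .B], .t, [.B, .A, .B]⟩, ⟨[], .t, [.B, .B, .A, .B]⟩], [.A], .α, [.A, .B], [⟨[], .t,
          [.B]⟩, ⟨[.A], .p, []⟩]⟩,
        ⟨[⟨[.A, .B], .t, [.B, .A, .B]⟩], [], .swap .t [] .p, [.A, .B], [⟨[.A], .p, [.A, .B]⟩, ⟨[],
          .t, [.B]⟩, ⟨[.A], .p, []⟩]⟩,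
        ⟨[⟨[.A, .B], .t, [.B, .A, .B]⟩, ⟨[.A, .B, .A], .p, [.A, .B]⟩], [], .ν, [.B], [⟨[.A], .p,
          []⟩]⟩,
        ⟨[⟨[.A, .B], .t, [.B, .A, .B]⟩, ⟨[.A, .B, .A], .p, [.A, .B]⟩, ⟨[.A, .B], .t, [.B]⟩, ⟨[],
          .t, [.B, .B]⟩], [.A], .α, [], []⟩,
        ⟨[⟨[.A, .B], .t, [.B, .A, .B]⟩, ⟨[.A, .B, .A], .p, [.A, .B]⟩, ⟨[.A, .B], .t, [.B]⟩], [],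
          .swap .t [] .p, [], [⟨[.A], .p, []⟩]⟩,
        ⟨[], [.A, .B], .ν, [.B], [⟨[.A, .B, .A], .p, []⟩, ⟨[], .t, [.B]⟩, ⟨[.A], .p, []⟩]⟩,
        ⟨[⟨[.A, .B, .A, .B], .t, [.B]⟩, ⟨[.A, .B], .t, [.B, .B]⟩], [.A, .B, .A], .α, [], [⟨[], .t,
          [.B]⟩, ⟨[.A], .p, []⟩]⟩,
        ⟨[⟨[.A, .B, .A, .B], .t, [.B]⟩], [.A, .B], .swap .t [] .p, [], [⟨[.A, .B, .A], .p, []⟩,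
          ⟨[], .t, [.B]⟩, ⟨[.A], .p, []⟩]⟩]
      [⟨[⟨[], .t, [.B, .A, .B, .A, .B]⟩, ⟨[.A], .p, [.A, .B, .A, .B]⟩], [], .ν, [.B], [⟨[.A], .p,
          []⟩]⟩,
        ⟨[⟨[], .t, [.B, .A, .B, .A, .B]⟩, ⟨[.A], .p, [.A, .B, .A, .B]⟩, ⟨[.A, .B], .t, [.B]⟩, ⟨[],
          .t, [.B, .B]⟩], [.A], .α, [], []⟩,
        ⟨[⟨[], .t, [.B, .A, .B, .A, .B]⟩, ⟨[.A], .p, [.A, .B, .A, .B]⟩, ⟨[.A, .B], .t, [.B]⟩], [],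
          .swap .t [] .p, [], [⟨[.A], .p, []⟩]⟩,
        ⟨[⟨[], .t, [.B, .A, .B, .A, .B]⟩], [.A], .swap .p [] .t, [.B], [⟨[.A, .B, .A], .p, []⟩,
          ⟨[], .t, [.B]⟩, ⟨[.A], .p, []⟩]⟩,
        ⟨[], [], .swap .t [.B] .t, [.B], [⟨[.A], .p, [.A, .B, .B]⟩, ⟨[.A, .B, .A], .p, []⟩, ⟨[],
          .t, [.B]⟩, ⟨[.A], .p, []⟩]⟩,
        ⟨[⟨[.A, .B, .A, .B], .t, [.B]⟩, ⟨[], .t, [.B, .A, .B, .B]⟩], [.A], .swap .p [.A] .p, [],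
          [⟨[], .t, [.B]⟩, ⟨[.A], .p, []⟩]⟩,
        ⟨[⟨[.A, .B, .A, .B], .t, [.B]⟩], [], .swap .t [.B, .A] .p, [], [⟨[.A], .p, [.A, .B]⟩, ⟨[],
          .t, [.B]⟩, ⟨[.A], .p, []⟩]⟩,
        ⟨[⟨[.A, .B, .A, .B], .t, [.B]⟩, ⟨[.A, .B, .A, .B, .A], .p, []⟩], [], .ν, [.B], [⟨[.A], .p,
          []⟩]⟩,
        ⟨[⟨[.A, .B, .A, .B], .t, [.B]⟩, ⟨[.A, .B, .A, .B, .A], .p, []⟩, ⟨[.A, .B], .t, [.B]⟩, ⟨[],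
          .t, [.B, .B]⟩], [.A], .α, [], []⟩,
        ⟨[⟨[.A, .B, .A, .B], .t, [.B]⟩, ⟨[.A, .B, .A, .B, .A], .p, []⟩, ⟨[.A, .B], .t, [.B]⟩], [],
          .swap .t [] .p, [], [⟨[.A], .p, []⟩]⟩] := by
  have L :
      Eqv D [.A, .B, .A, .B, .A, .B, .A, .B] [.A, .B]
        [⟨[], .t, [.B, .A, .B, .A, .B]⟩, ⟨[.A], .p, [.A, .B, .A, .B]⟩, ⟨[], .t, [.B, .A, .B]⟩, ⟨[.A],
          .p, [.A, .B]⟩, ⟨[], .t, [.B]⟩, ⟨[.A], .p, []⟩]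
        [⟨[.A, .B, .A, .B], .t, [.B]⟩, ⟨[.A, .B, .A, .B, .A], .p, []⟩, ⟨[.A, .B], .t, [.B]⟩, ⟨[.A,
          .B, .A], .p, []⟩, ⟨[], .t, [.B]⟩, ⟨[.A], .p, []⟩]
        [⟨[], [], .ν, [.B, .A, .B], [⟨[.A], .p, [.A, .B]⟩, ⟨[], .t, [.B]⟩, ⟨[.A], .p, []⟩]⟩,
          ⟨[⟨[.A, .B], .t, [.B, .A, .B]⟩, ⟨[], .t, [.B, .B, .A, .B]⟩], [.A], .α, [.A, .B], [⟨[], .t,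
            [.B]⟩, ⟨[.A], .p, []⟩]⟩,
          ⟨[⟨[.A, .B], .t, [.B, .A, .B]⟩], [], .swap .t [] .p, [.A, .B], [⟨[.A], .p, [.A, .B]⟩, ⟨[],
            .t, [.B]⟩, ⟨[.A], .p, []⟩]⟩,
          ⟨[⟨[.A, .B], .t, [.B, .A, .B]⟩, ⟨[.A, .B, .A], .p, [.A, .B]⟩], [], .ν, [.B], [⟨[.A], .p,
            []⟩]⟩,
          ⟨[⟨[.A, .B], .t, [.B, .A, .B]⟩, ⟨[.A, .B, .A], .p, [.A, .B]⟩, ⟨[.A, .B], .t, [.B]⟩, ⟨[],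
            .t, [.B, .B]⟩], [.A], .α, [], []⟩,
          ⟨[⟨[.A, .B], .t, [.B, .A, .B]⟩, ⟨[.A, .B, .A], .p, [.A, .B]⟩, ⟨[.A, .B], .t, [.B]⟩], [],
            .swap .t [] .p, [], [⟨[.A], .p, []⟩]⟩,
          ⟨[], [.A, .B], .ν, [.B], [⟨[.A, .B, .A], .p, []⟩, ⟨[], .t, [.B]⟩, ⟨[.A], .p, []⟩]⟩,
          ⟨[⟨[.A, .B, .A, .B], .t, [.B]⟩, ⟨[.A, .B], .t, [.B, .B]⟩], [.A, .B, .A], .α, [], [⟨[], .t,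
            [.B]⟩, ⟨[.A], .p, []⟩]⟩,
          ⟨[⟨[.A, .B, .A, .B], .t, [.B]⟩], [.A, .B], .swap .t [] .p, [], [⟨[.A, .B, .A], .p, []⟩,
            ⟨[], .t, [.B]⟩, ⟨[.A], .p, []⟩]⟩]
        [⟨[⟨[], .t, [.B, .A, .B, .A, .B]⟩, ⟨[.A], .p, [.A, .B, .A, .B]⟩], [], .ν, [.B], [⟨[.A], .p,
            []⟩]⟩,
          ⟨[⟨[], .t, [.B, .A, .B, .A, .B]⟩], [.A], .swap .p [] .t, [.B], [⟨[], .t, [.B, .B]⟩, ⟨[.A],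
            .p, [.B]⟩, ⟨[.A], .p, []⟩]⟩,
          ⟨[], [], .swap .t [.B] .t, [.B], [⟨[.A], .p, [.A, .B, .B]⟩, ⟨[], .t, [.B, .B]⟩, ⟨[.A], .p,
            [.B]⟩, ⟨[.A], .p, []⟩]⟩,
          ⟨[⟨[.A, .B, .A, .B], .t, [.B]⟩], [], .ν, [.B, .B], [⟨[.A], .p, [.B]⟩, ⟨[.A], .p, []⟩]⟩,
          ⟨[⟨[.A, .B, .A, .B], .t, [.B]⟩, ⟨[.A, .B], .t, [.B, .B]⟩, ⟨[], .t, [.B, .B, .B]⟩, ⟨[.A],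
            .p, [.B, .B]⟩], [.A], .α, [], []⟩,
          ⟨[⟨[.A, .B, .A, .B], .t, [.B]⟩, ⟨[.A, .B], .t, [.B, .B]⟩, ⟨[], .t, [.B, .B, .B]⟩], [.A],
            .swap .p [] .p, [], [⟨[.A], .p, []⟩]⟩,
          ⟨[⟨[.A, .B, .A, .B], .t, [.B]⟩, ⟨[.A, .B], .t, [.B, .B]⟩, ⟨[], .t, [.B, .B, .B]⟩, ⟨[.A, .B,
            .B], .p, []⟩], [.A], .α, [], []⟩,
          ⟨[⟨[.A, .B, .A, .B], .t, [.B]⟩, ⟨[.A, .B], .t, [.B, .B]⟩], [], .swap .t [.B] .p, [], [⟨[.A,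
            .B], .p, []⟩, ⟨[.A], .p, []⟩]⟩,
          ⟨[⟨[.A, .B, .A, .B], .t, [.B]⟩, ⟨[.A, .B], .t, [.B, .B]⟩, ⟨[.A, .B, .A, .B], .p, []⟩], [],
            .swap .t [] .p, [], [⟨[.A], .p, []⟩]⟩,
          ⟨[⟨[.A, .B, .A, .B], .t, [.B]⟩], [.A, .B], .swap .t [] .p, [], [⟨[.A, .B, .A], .p, []⟩,
            ⟨[], .t, [.B]⟩, ⟨[.A], .p, []⟩]⟩] := by
    refine Eqv.chain (by decide) (by decide) fun E => ?_
    -- The last `ν`, whiskered by `AB` on the left, moves ahead of the second `α` and the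
    -- interchange after it, as warping axiom 1 requires.
    replace E := (E.comm 5).comm 4
    -- The inverse interchange of `t` and `p` ends the longer side of warping axiom 1, so it is
    -- created together with its partner.
    replace E := E.subst 5 (Eqv.unswap_swap .t .p).symm
      [⟨[.A, .B, .A, .B], .t, [.B]⟩, ⟨[.A, .B], .t, [.B, .B]⟩] [] [.B] [⟨[.A], .p, [.B]⟩, ⟨[.A], .p, []⟩]
      rfl (by decide) (by decide) rfl
    replace E := E.subst 0 (.of_assocAssoc h)
      [] [] [.B] [⟨[.A], .p, []⟩]
      rfl (by decide) (by decide) rfl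
    replace E := E.comm 5
    -- Two interchanges carry `t` past `p(pB)`, the domain of the third `α`. Naturality lets that
    -- `α` act first, so the three uses of `α` become consecutive.
    replace E := E.subst 6 (.naturality_right (s := [.A, .B, .A]) (t := [.A, .B]) (s' := [.B, .B, .B]) (t' := [.B])
        (v := [⟨[], .p, [.B]⟩, ⟨[], .p, []⟩]) (v' := [⟨[.B], .p, []⟩, ⟨[], .p, []⟩]) (u := [⟨[], .t,
          []⟩])
        (c := [⟨[], [], .α, [], []⟩]) (by decide) (by decide) (by decide))
      [⟨[.A, .B, .A, .B], .t, [.B]⟩, ⟨[.A, .B], .t, [.B, .B]⟩] [] [] [⟨[.A], .p, []⟩]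
      rfl (by decide) (by decide) rfl
    replace E := E.subst 4 .assoc_assoc
      [⟨[.A, .B, .A, .B], .t, [.B]⟩, ⟨[.A, .B], .t, [.B, .B]⟩, ⟨[], .t, [.B, .B, .B]⟩] [.A] [] []
      rfl (by decide) (by decide) rfl
    exact E
  refine L.trans (Eqv.symm ?_)
  refine Eqv.chain (by decide) (by decide) fun E => ?_
  -- The `p`–`t` and `t`–`t` interchanges act on earlier steps than the first `α` and the `t`–`p`
  -- interchange, and are moved ahead of both.
  replace E := (((E.comm 2).comm 1).comm 3).comm 2
  -- Three interchanges pass the domain `t(ApA)(tBA)` of `ν` across `p`. By naturality `ν` acts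
  -- first, and its codomain is passed across `p` instead.
  replace E := E.subst 4 (.naturality_left (s := [.A, .B, .A, .B, .A]) (t := [.A, .B]) (s' := [.B, .B]) (t' := [.B])
      (u := [⟨[], .t, [.B, .A]⟩, ⟨[.A], .p, [.A]⟩, ⟨[], .t, []⟩]) (u' := [⟨[.A, .B], .t, []⟩, ⟨[],
        .t, [.B]⟩, ⟨[.A], .p, []⟩]) (v := [⟨[], .p, []⟩])
      (c := [⟨[], [], .ν, [], []⟩]) (by decide) (by decide) (by decide))
    [⟨[.A, .B, .A, .B], .t, [.B]⟩] [] [] [⟨[.A], .p, []⟩]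
    rfl (by decide) (by decide) rfl
  -- Only the order of disjoint moves still differs from `L`.
  replace E := (((E.comm 3).comm 7).comm 6).comm 8
  exact E

/-! ### Formal composites denoting the composite data -/

theorem Rep₂.comp_p : Rep₂ D D.comp.p [.A, .B, .A, .B] [.A, .B]
    [⟨[], .t, [.B]⟩, ⟨[.A], .p, []⟩] := Rep₂.mul

theorem Rep₂.comp_e : Rep₂ D D.comp.e [] [.A, .B] [⟨[], .k, []⟩] := Rep₂.gen .k

theorem Rep₃.comp_rho : Rep₃ D D.comp.rho [.A, .B] [.A, .B] []
    [⟨[.A, .B], .k, []⟩, ⟨[], .t, [.B]⟩, ⟨[.A], .p, []⟩] [⟨[], [], .κ, [], []⟩] :=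
  .paste_move .κ (.of_eq_id rfl rfl) rfl rfl (.of_eq_id rfl rfl) rfl rfl

theorem Rep₃.comp_lam : Rep₃ D D.comp.lam [.A, .B] [.A, .B]
    [⟨[], .k, [.A, .B]⟩, ⟨[], .t, [.B]⟩, ⟨[.A], .p, []⟩] []
    [⟨[], [], .ν₀, [.B], [⟨[.A], .p, []⟩]⟩, ⟨[], [.A], .lam, [], []⟩] :=
  .cons (.paste_move .ν₀ (.of_eq_id rfl rfl) rfl rfl (.gen_wh (.gen .p) rfl rfl rfl rfl) rfl rfl) <|
    .paste_move .lam (.of_eq_id rfl rfl) rfl rfl (.of_eq_id rfl rfl) rfl rfl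

theorem Rep₃.comp_α : Rep₃ D D.comp.α [.A, .B, .A, .B, .A, .B] [.A, .B]
    [⟨[], .t, [.B, .A, .B]⟩, ⟨[.A], .p, [.A, .B]⟩, ⟨[], .t, [.B]⟩, ⟨[.A], .p, []⟩]
    [⟨[.A, .B], .t, [.B]⟩, ⟨[.A, .B, .A], .p, []⟩, ⟨[], .t, [.B]⟩, ⟨[.A], .p, []⟩]
    [⟨[], [], .ν, [.B], [⟨[.A], .p, []⟩]⟩,
      ⟨[⟨[.A, .B], .t, [.B]⟩, ⟨[], .t, [.B, .B]⟩], [.A], .α, [], []⟩,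
      ⟨[⟨[.A, .B], .t, [.B]⟩], [], .swap .t [] .p, [], [⟨[.A], .p, []⟩]⟩] :=
  -- The source is bracketed as `(AB)(AB)(AB)`, which equals the value of the word only
  -- propositionally, hence the `simp`.
  .cons (.paste_move .ν (.of_eq_id (by simp [ev]) rfl) rfl rfl
      (.gen_wh (.gen .p) rfl rfl rfl rfl) rfl rfl) <|
    .cons (.paste_move .α (.gen_cons (.gen .t) rfl rfl rfl (.gen_wh (.gen .t) rfl rfl rfl rfl))
      rfl rfl (.of_eq_id rfl rfl) rfl rfl) <|
    .paste_move (.swap (φ := .t) (θ := .p)) (.gen_wh (.gen .t) rfl rfl rfl rfl) rfl rfl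
      (.gen_wh (.gen .p) rfl rfl rfl rfl) rfl rfl

/-- Contexts produce unreduced expressions for paths. Stating the matching conditions as hypotheses
allows them to be closed by computation once unification has fixed the paths. -/
theorem Rep₃.comp_of {a b : X ⟶ X} {θ φ ψ : a ⟶ b} {Γ : θ ⟶ φ} {Ξ : φ ⟶ ψ}
    (h : Rep₃ D Γ s t x y c) (h' : Rep₃ D Ξ s t z T d) {x' z' : Path} (hy : z = y) (hx : x' = x)
    (hz : z' = T) (hc : c' = c ++ d) : Rep₃ D (Γ ≫ Ξ) s t x' z' c' := by
  subst hy hx hz hc; exact h.comp h'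

end Diagram

/-! ### The five axioms carried back from syntax to cells -/

open Diagram Letter in
/-- The composite of a skew monad with a skew warping. -/
def SkewWarping.skewMonad {X : C} {B : X ⟶ X} {M : SkewMonad B} {A : X ⟶ X} (W : SkewWarping M A) :
    SkewMonad (A ⊙ B) where
  toSkewMonadData := W.toSkewWarpingData.comp
  assoc_assoc := by
    have p := Rep₂.comp_p (D := W.toSkewWarpingData)
    have α := Rep₃.comp_α (D := W.toSkewWarpingData)
    refine (Eqv.comp_assocAssoc W.assoc_assoc).eq_of_rep ?_ ?_
    · refine .comp_of (α.paste (l' := []) (r' := [.A, .B]) (.of_eq_id (by simp [ev]) rfl)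
          rfl rfl p _ _ _ _)
        (.comp_of (α.paste (l' := []) (r' := []) (p.wh (l' := [.A, .B]) (r' := [.A, .B]) rfl rfl _ _)
          rfl rfl (.of_eq_id rfl rfl) _ _ _ _)
          (α.paste (l' := [.A, .B]) (r' := []) (.of_eq_id (by simp [ev]) rfl) rfl rfl p _ _ _ _)
          rfl rfl rfl rfl) rfl rfl rfl rfl
    · refine .comp_of (α.paste (l' := []) (r' := [])
          (p.wh (l' := []) (r' := [.A, .B, .A, .B]) rfl (by simp [ev]) _ _) rfl rfl
          (.of_eq_id rfl rfl) _ _ _ _)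
        -- Interchanging the multiplication with itself expands to four generator interchanges: `p`
        -- and `t` past `t`, then `p` and `t` past `p`.
        (.comp_of ((Rep₃.interchange p p).paste (l' := []) (r' := []) (.of_eq_id (by simp [ev]) rfl)
          rfl rfl p _ _ _ _)
          (α.paste (l' := []) (r' := [])
            (p.wh (l' := [.A, .B, .A, .B]) (r' := []) (by simp [ev]) rfl _ _) rfl rfl
            (.of_eq_id rfl rfl) _ _ _ _)
          rfl rfl rfl rfl) rfl rfl rfl rfl
  right_assoc_left := by
    have p := Rep₂.comp_p (D := W.toSkewWarpingData)
    have e := Rep₂.comp_e (D := W.toSkewWarpingData)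
    have α := Rep₃.comp_α (D := W.toSkewWarpingData)
    refine (Eqv.comp_rightAssocLeft W.right_assoc_left).eq_of_rep ?_ (.id p)
    refine .comp_of (Rep₃.comp_rho.paste (l' := []) (r' := [.A, .B]) (.of_eq_id (by simp [ev]) rfl)
        rfl rfl p _ _ _ _)
      (.comp_of (α.paste (l' := []) (r' := []) (e.wh (l' := [.A, .B]) (r' := [.A, .B]) rfl rfl _ _)
        rfl rfl (.of_eq_id rfl rfl) _ _ _ _)
        (Rep₃.comp_lam.paste (l' := [.A, .B]) (r' := []) (.of_eq_id (by simp [ev]) rfl) rfl rfl p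
          _ _ _ _)
        rfl rfl rfl rfl) rfl rfl rfl rfl
  assoc_left := by
    have p := Rep₂.comp_p (D := W.toSkewWarpingData)
    have e := Rep₂.comp_e (D := W.toSkewWarpingData)
    have α := Rep₃.comp_α (D := W.toSkewWarpingData)
    refine (Eqv.comp_assocLeft W.assoc_left).eq_of_rep ?_ ?_
    · refine .comp_of (α.paste (l' := []) (r' := [])
          (e.wh (l' := []) (r' := [.A, .B, .A, .B]) rfl (by simp [ev]) _ _) rfl rfl
          (.of_eq_id rfl rfl) _ _ _ _)
        (.comp_of ((Rep₃.interchange e p).paste (l' := []) (r' := []) (.of_eq_id (by simp [ev]) rfl)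
          rfl rfl p _ _ _ _)
          (Rep₃.comp_lam.paste (l' := []) (r' := []) p rfl rfl (.of_eq_id rfl rfl) _ _ _ _)
          rfl rfl rfl rfl) rfl rfl rfl rfl
    · exact Rep₃.paste_of Rep₃.comp_lam (l' := []) (r' := [.A, .B]) (.of_eq_id (by simp [ev]) rfl)
        rfl rfl p rfl rfl rfl
  right_assoc := by
    have p := Rep₂.comp_p (D := W.toSkewWarpingData)
    have e := Rep₂.comp_e (D := W.toSkewWarpingData)
    have α := Rep₃.comp_α (D := W.toSkewWarpingData)
    -- Warping axiom 4 is the required axiom once both interchanges with `k` are expanded in the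
    -- same way; axiom 5 is equally direct.
    refine (Eqv.of_rightAssoc W.right_assoc).eq_of_rep ?_ ?_
    · refine .comp_of (Rep₃.comp_rho.paste (l' := []) (r' := []) p rfl rfl (.of_eq_id rfl rfl) _ _ _ _)
        (.comp_of ((Rep₃.interchange p e).paste (l' := []) (r' := []) (.of_eq_id (by simp [ev]) rfl)
          rfl rfl p _ _ _ _)
          (α.paste (l' := []) (r' := [])
            (e.wh (l' := [.A, .B, .A, .B]) (r' := []) (by simp [ev]) rfl _ _) rfl rfl
            (.of_eq_id rfl rfl) _ _ _ _)
          rfl rfl rfl rfl) rfl rfl rfl rfl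
    · exact Rep₃.paste_of Rep₃.comp_rho (l' := [.A, .B]) (r' := []) (.of_eq_id (by simp [ev]) rfl)
        rfl rfl p rfl rfl rfl
  right_left := by
    have p := Rep₂.comp_p (D := W.toSkewWarpingData)
    have e := Rep₂.comp_e (D := W.toSkewWarpingData)
    refine (Eqv.of_rightLeft W.right_left).eq_of_rep ?_ (.id e)
    refine .comp_of (Rep₃.comp_rho.paste (l' := []) (r' := []) e rfl rfl (.of_eq_id rfl rfl) _ _ _ _)
      (.comp_of ((Rep₃.interchange e e).paste (l' := []) (r' := []) (.of_eq_id (by simp [ev]) rfl)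
        rfl rfl p _ _ _ _)
        (Rep₃.comp_lam.paste (l' := []) (r' := []) e rfl rfl (.of_eq_id rfl rfl) _ _ _ _)
        rfl rfl rfl rfl) rfl rfl rfl rfl

end GrayCategory

theorem theorem3 {C : Type u} [GrayCategory.{z, w, v, u} C] {X : C} {B : X ⟶ X}
    (M : GrayCategory.SkewMonad B) (A : X ⟶ X) (W : GrayCategory.SkewWarping M A) :
    ∃ S : GrayCategory.SkewMonad (A ⊙ B),
      S.toSkewMonadData = W.toSkewWarpingData.comp :=
  ⟨W.skewMonad, rfl⟩
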